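/- **Setting.** Let $E\subset\mathbb R^d$ be open and let $\phi:\mathbb R^d\times\mathbb R_+\to\mathbb R^d$ be continuous with $\phi(x,0)=x$ and $\phi(x,t+s)=\phi(\phi(x,t),s)$, where $\mathbb R_+=[0,\infty)$. Put $t_*(x)=\inf\{t>0:\phi(x,t)\in\partial E\}\in(0,\infty]$ for $x\in E$, and set $\phi(x,t_*(x))=\Delta$ when $t_*(x)=\infty$, for a fixed point $\Delta\in\partial E$ (if $\partial E=\emptyset$, any fixed point). Let $\mathbb U$ be a compact metric space with its Borel $\sigma$-algebra, and let $\mathbb U(y)\subset\mathbb U$ be compact for $y\in\overline E$, with $\{(y,a):y\in\overline E,\ a\in\mathbb U(y)\}$ Borel. Let $\lambda,f:\overline E\times\mathbb U\to\mathbb R_+$ and $r:\partial E\times\mathbb U\to\mathbb R_+$ be measurable and let $Q$ be a stochastic kernel on $E$ given $\overline E\times\mathbb U$. Assume $\int_0^t\sup_{a\in\mathbb U(\phi(x,s))}\lambda(\phi(x,s),a)\,ds<\infty$ for all $x\in E$ and all finite $t\le t_*(x)$. **Policies and process.** A policy $U=(u,u_\partial)\in\mathcal U$ consists of Borel functions $u:\mathbb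 N\times E\times\mathbb R_+\to\mathbb U$ and $u_\partial:\mathbb N\times E\to\mathbb U$ with $u(n,x,t)\in\mathbb U(\phi(x,t))$ whenever $\phi(x,t)\in\overline E$, and $u_\partial(n,x)\in\mathbb U(\phi(x,t_*(x)))$. Under $P^U_{(x,0)}$, put $T_0=0$, $Z_0=x$; given the past up to the $n$-th jump, the waiting time $S=T_{n+1}-T_n$ satisfies $P(S>t)=e^{-\int_0^t\lambda(\phi(Z_n,s),u(n,Z_n,s))ds}$ for $t<t_*(Z_n)$ and $P(S>t)=0$ for $t\ge t_*(Z_n)$, and if $S<\infty$ the next location $Z_{n+1}$ is drawn from $Q(\phi(Z_n,S),u(n,Z_n,S);\cdot)$ if $S<t_*(Z_n)$ and from $Q(\phi(Z_n,t_*(Z_n)),u_\partial(n,Z_n);\cdot)$ if $S=t_*(Z_n)$. For $t\in[T_n,T_{n+1})$ put $X(t)=\phi(Z_n,t-T_n)$, $N(t)=n$, $Z(t)=Z_n$, $\tau(t)=t-T_n$. Assume $E^U_{(x,0)}\big[\sum_{i\ge1}I_{\{T_i\le t\}}\big]<\infty$ for all $x\in E$, $U\in\mathcal U$, $t\ge0$.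 With $p^*(t)=\sum_{i\ge1}I_{\{T_i\le t\}}I_{\{X(T_i-)\in\partial E\}}$, let $$\mathcal A(U,x)=\limsup_{t\to\infty}\frac1tE^U_{(x,0)}\Big[\int_0^tf\big(X(s),u(N(s),Z(s),\tau(s))\big)ds+\int_0^tr\big(X(s-),u_\partial(N(s-),Z(s-))\big)dp^*(s)\Big],$$ $$\mathcal J_{\mathcal A}(x)=\inf_{U\in\mathcal U}\mathcal A(U,x).$$ **One-stage problem.** For $x\in E$ let $\mathbb V(x)$ be the set of pairs $\Upsilon=(\nu,\nu_\partial)$ with $\nu:\mathbb R_+\to\mathbb U$ Borel, $\nu(t)\in\mathbb U(\phi(x,t))$ whenever $\phi(x,t)\in\overline E$, and $\nu_\partial\in\mathbb U(\phi(x,t_*(x)))$. Let $\Lambda^\nu(x,t)=\int_0^t\lambda(\phi(x,s),\nu(s))ds$, $Qh(y,a)=\int_Eh(z)Q(y,a;dz)$, and (with $e^{-\infty}=0$) $$\mathcal L(x,\Upsilon)=\int_0^{t_*(x)}e^{-\Lambda^\nu(x,s)}ds,\qquad Lf(x,\Upsilon)=\int_0^{t_*(x)}e^{-\Lambda^\nu(x,s)}f(\phi(x,s),\nu(s))ds,$$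 $$Hr(x,\Upsilon)=e^{-\Lambda^\nu(x,t_*(x))}r(\phi(x,t_*(x)),\nu_\partial),$$ $$Gh(x,\Upsilon)=\int_0^{t_*(x)}e^{-\Lambda^\nu(x,s)}\lambda(\phi(x,s),\nu(s))\,Qh(\phi(x,s),\nu(s))ds+e^{-\Lambda^\nu(x,t_*(x))}Qh(\phi(x,t_*(x)),\nu_\partial)$$ for $h\ge0$, and $Gh=Gh^+-Gh^-$ for $h$ bounded below. For $\rho\in[0,\infty)$ (with $0\cdot\infty=0$) let $$\mathcal T(\rho,h)(x)=\inf_{\Upsilon\in\mathbb V(x)}\big\{-\rho\mathcal L(x,\Upsilon)+Lf(x,\Upsilon)+Hr(x,\Upsilon)+Gh(x,\Upsilon)\big\};$$ an equation for $\mathcal T(\rho,h)$ includes the requirement that none of these expressions is of the undefined form $-\infty+\infty$. The space of Borel functions $\mathbb R_+\to\mathbb U$ carries the Borel $\sigma$-algebra of the coarsest topology making $\nu\mapsto\int_0^\infty g(t,\nu(t))dt$ continuous for every $g\in L^1(\mathbb R_+;C(\mathbb U))$; in it, functions that are equal almost everywhere are not distinguished. **Theorem.** Let $\rho\in[0,\infty)$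 and let $h:E\to\mathbb R$ be measurable and bounded below, such that $\mathcal T(\rho,h)(x)=h(x)$ for all $x\in E$ and $$\limsup_{t\to\infty}\frac1t\limsup_{m\to\infty}E^U_{(x,0)}\big[h(X(t\wedge T_m))\big]=0\qquad\text{for all }U\in\mathcal U,\ x\in E.$$ Suppose that $\hat\Gamma=(\hat\gamma,\hat\gamma_\partial)$ is a measurable map on $E$ with $\hat\Gamma(x)\in\mathbb V(x)$ and $$\mathcal T(\rho,h)(x)=-\rho\mathcal L(x,\hat\Gamma(x))+Lf(x,\hat\Gamma(x))+Hr(x,\hat\Gamma(x))+Gh(x,\hat\Gamma(x))\qquad\text{for all }x\in E.$$ Then: 1. There is an admissible policy $\widehat U=(\hat u,\hat u_\partial)\in\mathcal U$, with $\hat u(n,\cdot,\cdot)$ not depending on $n$, such that for all $n,x$: $\hat u_\partial(n,x)=\hat\gamma_\partial(x)$ and $\hat u(n,x,t)=\hat\gamma(x)(t)$ for almost every $t$. If $(x,t)\mapsto\hat\gamma(x)(t)$ is jointly measurable, then the policy given by $\hat u(n,x,t)=\hat\gamma(x)(t)$ for all $n,x,t$ and $\hat u_\partial(n,x)=\hat\gamma_\partial(x)$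 is itself in $\mathcal U$. 2. Every $\widehat U\in\mathcal U$ with $\hat u_\partial(n,x)=\hat\gamma_\partial(x)$ and $\hat u(n,x,t)=\hat\gamma(x)(t)$ for almost every $t$, for all $n,x$, is optimal, and $$\rho=\mathcal J_{\mathcal A}(x)=\mathcal A(\widehat U,x)\qquad\text{for all }x\in E.$$ -/

import Mathlib

open MeasureTheory ProbabilityTheory Filter Topology
open scoped ENNReal NNReal

namespace PDMP

/-- The Euclidean space `ℝ^d`. -/
abbrev Space (d : ℕ) : Type := EuclideanSpace ℝ (Fin d)

/-- Lebesgue measure on `ℝ₊ = [0, ∞)`. -/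
noncomputable def leb : Measure ℝ≥0 :=
  (volume.restrict (Set.Ici (0 : ℝ))).map Real.toNNReal

/-- `e^{-a}` for `a ∈ [0, ∞]`, with `e^{-∞} = 0`. -/
noncomputable def expNeg (a : ℝ≥0∞) : ℝ≥0∞ := EReal.exp (-(a : EReal))

/-- `t_*(x) = inf {t > 0 : φ(x,t) ∈ ∂E}`, with `inf ∅ = ∞`. -/
noncomputable def exitTime {d : ℕ} (E : Set (Space d)) (φ : Space d → ℝ≥0 → Space d)
    (x : Space d) : ℝ≥0∞ :=
  ⨅ (t : ℝ≥0) (_ : 0 < t ∧ φ x t ∈ frontier E), (t : ℝ≥0∞)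

/-- The data of a controlled piecewise deterministic Markov process, with costs.
Functions on `closure E` (or on `frontier E`) are given as functions on the whole of `ℝ^d`, of which
only the values on `closure E` (or on `frontier E`) matter. -/
structure Model (d : ℕ) (𝕌 : Type*) [TopologicalSpace 𝕌] [MeasurableSpace 𝕌] where
  /-- the state space, an open subset of `ℝ^d` -/
  E : Set (Space d)
  isOpen_E : IsOpen E
  /-- the flow -/
  φ : Space d → ℝ≥0 → Space d
  continuous_φ : Continuous (fun p : Space d × ℝ≥0 => φ p.1 p.2)
  φ_zero : ∀ x, φ x 0 = x
  φ_add : ∀ x t s, φ x (t + s) = φ (φ x t) s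
  /-- the boundary point that stands for `φ(x, t_*(x))` when `t_*(x) = ∞` -/
  Δ : Space d
  Δ_mem : (frontier E).Nonempty → Δ ∈ frontier E
  /-- the jump rate `λ(x,a)` -/
  lam : Space d × 𝕌 → ℝ≥0
  measurable_lam : Measurable lam
  /-- the law `Q(x,a; ·)` of the post-jump location -/
  Q : Kernel (Space d × 𝕌) E
  markov_Q : IsMarkovKernel Q
  /-- the set `𝕌(x)` of feasible actions at `x` -/
  act : Space d → Set 𝕌
  isCompact_act : ∀ x ∈ closure E, IsCompact (act x)
  measurableSet_graph : MeasurableSet {p : Space d × 𝕌 | p.1 ∈ closure E ∧ p.2 ∈ act p.1}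
  /-- `∫_0^t sup_{a ∈ 𝕌(φ(x,s))} λ(φ(x,s),a) ds < ∞` for finite `t ≤ t_*(x)` -/
  rate_lt_top : ∀ x ∈ E, ∀ t : ℝ≥0, (t : ℝ≥0∞) ≤ exitTime E φ x →
    ∫⁻ s in {s : ℝ≥0 | s < t}, (⨆ a ∈ act (φ x s), (lam (φ x s, a) : ℝ≥0∞)) ∂leb < ∞
  /-- the running cost -/
  f : Space d × 𝕌 → ℝ≥0
  measurable_f : Measurable f
  /-- the boundary cost -/
  r : Space d × 𝕌 → ℝ≥0
  measurable_r : Measurable r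

/-- A Borel function `ν : ℝ₊ → 𝕌`. -/
structure OrdControl (𝕌 : Type*) [MeasurableSpace 𝕌] where
  toFun : ℝ≥0 → 𝕌
  measurable_toFun : Measurable toFun

instance {𝕌 : Type*} [MeasurableSpace 𝕌] : CoeFun (OrdControl 𝕌) (fun _ => ℝ≥0 → 𝕌) :=
  ⟨OrdControl.toFun⟩

/-- The trace on the ordinary controls (`ν` being identified with the relaxed control
`t ↦ δ_{ν(t)}`) of the weak* topology of the relaxed controls: the coarsest topology for which
`ν ↦ ∫_{ℝ₊} g(t, ν(t)) dt` is continuous for every `g ∈ L¹(ℝ₊; C(𝕌))`. -/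
noncomputable instance OrdControl.instTopologicalSpace {𝕌 : Type*} [TopologicalSpace 𝕌] [CompactSpace 𝕌]
    [MeasurableSpace 𝕌] : TopologicalSpace (OrdControl 𝕌) :=
  ⨅ g : {g : ℝ≥0 → C(𝕌, ℝ) // Integrable g leb},
    TopologicalSpace.induced (fun ν : OrdControl 𝕌 => ∫ t, g.1 t (ν t) ∂leb) inferInstance

/-- The Borel `σ`-algebra of that topology. -/
noncomputable instance OrdControl.instMeasurableSpace {𝕌 : Type*} [TopologicalSpace 𝕌] [CompactSpace 𝕌]
    [MeasurableSpace 𝕌] : MeasurableSpace (OrdControl 𝕌) :=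
  borel (OrdControl 𝕌)

namespace Model

variable {d : ℕ} {𝕌 : Type*} [TopologicalSpace 𝕌] [MeasurableSpace 𝕌]

/-- The time `t_*(x)` that the flow takes to reach the boundary. -/
noncomputable def tstar (M : Model d 𝕌) (x : Space d) : ℝ≥0∞ := exitTime M.E M.φ x

/-- The time interval `[0, t) ∩ ℝ₊`, for `t ∈ [0, ∞]`. -/
def before (t : ℝ≥0∞) : Set ℝ≥0 := {s | (s : ℝ≥0∞) < t}

/-- `φ(x, t_*(x))`, which is `Δ` when `t_*(x) = ∞`. -/
noncomputable def exitPoint (M : Model d 𝕌) (x : Space d) : Space d :=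
  open Classical in if M.tstar x = ∞ then M.Δ else M.φ x (M.tstar x).toNNReal

/-- `Λ^ν(x,t) = ∫_0^t λ(φ(x,s), ν(s)) ds`, for `t ∈ [0, ∞]`. -/
noncomputable def cumRate (M : Model d 𝕌) (x : Space d) (ν : ℝ≥0 → 𝕌) (t : ℝ≥0∞) : ℝ≥0∞ :=
  ∫⁻ s in before t, (M.lam (M.φ x s, ν s) : ℝ≥0∞) ∂leb

/-! ### One-stage operators -/

/-- The set `𝕍(x)` of ordinary controls `Υ = (ν, ν_∂)` that are feasible from `x`; feasible actions
are defined on `closure E` only. -/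
def V (M : Model d 𝕌) (x : Space d) : Set (OrdControl 𝕌 × 𝕌) :=
  {Υ | (∀ t, M.φ x t ∈ closure M.E → Υ.1 t ∈ M.act (M.φ x t)) ∧ Υ.2 ∈ M.act (M.exitPoint x)}

/-- `𝓛(x,Υ) = ∫_0^{t_*(x)} e^{-Λ^ν(x,s)} ds`. -/
noncomputable def calL (M : Model d 𝕌) (x : Space d) (Υ : OrdControl 𝕌 × 𝕌) : ℝ≥0∞ :=
  ∫⁻ s in before (M.tstar x), expNeg (M.cumRate x Υ.1 s) ∂leb

/-- `Lv(x,Υ) = ∫_0^{t_*(x)} e^{-Λ^ν(x,s)} v(φ(x,s), ν(s)) ds`. -/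
noncomputable def opL (M : Model d 𝕌) (v : Space d × 𝕌 → ℝ≥0) (x : Space d)
    (Υ : OrdControl 𝕌 × 𝕌) : ℝ≥0∞ :=
  ∫⁻ s in before (M.tstar x), expNeg (M.cumRate x Υ.1 s) * v (M.φ x s, Υ.1 s) ∂leb

/-- `Hw(x,Υ) = e^{-Λ^ν(x,t_*(x))} w(φ(x,t_*(x)), ν_∂)`. -/
noncomputable def opH (M : Model d 𝕌) (w : Space d × 𝕌 → ℝ≥0) (x : Space d)
    (Υ : OrdControl 𝕌 × 𝕌) : ℝ≥0∞ :=
  expNeg (M.cumRate x Υ.1 (M.tstar x)) * w (M.exitPoint x, Υ.2)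

/-- `Gk(x,Υ) = ∫_0^{t_*(x)} e^{-Λ^ν(x,s)} λQk(φ(x,s), ν(s)) ds
+ e^{-Λ^ν(x,t_*(x))} Qk(φ(x,t_*(x)), ν_∂)`, for `k ≥ 0`. -/
noncomputable def opG (M : Model d 𝕌) (k : Space d → ℝ≥0∞) (x : Space d)
    (Υ : OrdControl 𝕌 × 𝕌) : ℝ≥0∞ :=
  ∫⁻ s in before (M.tstar x), expNeg (M.cumRate x Υ.1 s) *
      (M.lam (M.φ x s, Υ.1 s) * ∫⁻ z, k z ∂(M.Q (M.φ x s, Υ.1 s))) ∂leb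
    + expNeg (M.cumRate x Υ.1 (M.tstar x)) * ∫⁻ z, k z ∂(M.Q (M.exitPoint x, Υ.2))

/-- `-ρ𝓛(x,Υ) + Lf(x,Υ) + Hr(x,Υ) + Gh(x,Υ)`, where `Gh = Gh⁺ - Gh⁻`. In `EReal`, `⊥ + ⊤ = ⊥`: an
expression of the form `-∞ + ∞`, which has no meaning, gets the value `-∞`, so that an equation
between the infimum of these expressions and a real-valued function holds only if all of them are
meaningful. -/
noncomputable def oneStage (M : Model d 𝕌) (ρ : ℝ≥0) (h : Space d → ℝ) (x : Space d)
    (Υ : OrdControl 𝕌 × 𝕌) : EReal :=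
  -(((ρ : ℝ≥0∞) * M.calL x Υ : ℝ≥0∞) : EReal) + (M.opL M.f x Υ : EReal) + (M.opH M.r x Υ : EReal)
    + ((M.opG (fun y => ENNReal.ofReal (h y)) x Υ : EReal)
      - (M.opG (fun y => ENNReal.ofReal (-h y)) x Υ : EReal))

/-- The one-stage optimization operator `𝓣(ρ,h)(x)`, an infimum over `𝕍(x)`. -/
noncomputable def opT (M : Model d 𝕌) (ρ : ℝ≥0) (h : Space d → ℝ) (x : Space d) : EReal :=
  ⨅ Υ ∈ M.V x, M.oneStage ρ h x Υ

/-! ### Policies -/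

/-- An admissible control policy `U = (u, u_∂)`; the class `𝓤` is the type of these. -/
structure Policy (M : Model d 𝕌) where
  u : ℕ → M.E → ℝ≥0 → 𝕌
  measurable_u : Measurable (fun p : ℕ × M.E × ℝ≥0 => u p.1 p.2.1 p.2.2)
  u_mem : ∀ n (x : M.E) t, M.φ x t ∈ closure M.E → u n x t ∈ M.act (M.φ x t)
  ub : ℕ → M.E → 𝕌
  measurable_ub : Measurable (fun p : ℕ × M.E => ub p.1 p.2)
  ub_mem : ∀ n (x : M.E), ub n x ∈ M.act (M.exitPoint x)

/-- The law on `[0, ∞]` of the time until the next jump, from `x` and under the control `ν`: it has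
the density `λ e^{-Λ}` on `(0, t_*(x))` and an atom of mass `e^{-Λ(t_*(x))}` at `t_*(x)`; that is, it
gives to `(t, ∞]` the mass `e^{-Λ(t)}` for `t < t_*(x)`, and `0` for `t ≥ t_*(x)`. -/
noncomputable def sojournLaw (M : Model d 𝕌) (x : Space d) (ν : ℝ≥0 → 𝕌) : Measure ℝ≥0∞ :=
  ((leb.restrict (before (M.tstar x))).withDensity
      (fun s => M.lam (M.φ x s, ν s) * expNeg (M.cumRate x ν s))).map (fun s : ℝ≥0 => (s : ℝ≥0∞))
    + expNeg (M.cumRate x ν (M.tstar x)) • Measure.dirac (M.tstar x)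

/-- The point at which the process jumps after the time `s` since the last jump, from `z`, and the
action applied there: `(φ(z,s), u(n,z,s))` if `s < t_*(z)`, and `(φ(z,t_*(z)), u_∂(n,z))`
otherwise. -/
noncomputable def jumpPoint {M : Model d 𝕌} (U : M.Policy) (n : ℕ) (p : M.E × ℝ≥0∞) :
    Space d × 𝕌 :=
  open Classical in
  if p.2 < M.tstar p.1 then (M.φ p.1 p.2.toNNReal, U.u n p.1 p.2.toNNReal)
  else (M.exitPoint p.1, U.ub n p.1)


/-! ### Measurability of the transition kernels, and conservation of mass -/

instance : SFinite leb := by unfold leb; infer_instance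

theorem measurable_tstar (M : Model d 𝕌) : Measurable (fun x : M.E => M.tstar x) := by
  apply measurable_of_Iio
  intro c
  have key : ∀ q : ℝ≥0, IsClosed {x : Space d | ∃ t ∈ Set.Icc (0 : ℝ≥0) q, M.φ x t ∈ frontier M.E} := by
    intro q
    have hc : IsCompact (Set.Icc (0 : ℝ≥0) q) := isCompact_Icc
    have : CompactSpace (Set.Icc (0 : ℝ≥0) q) := isCompact_iff_compactSpace.mp hc
    have h1 : IsClosed {p : Space d × Set.Icc (0 : ℝ≥0) q | M.φ p.1 p.2 ∈ frontier M.E} := by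
      apply isClosed_frontier.preimage
      exact M.continuous_φ.comp (continuous_fst.prodMk (continuous_subtype_val.comp continuous_snd))
    have h2 := isClosedMap_fst_of_compactSpace _ h1
    convert h2 using 1
    ext x
    constructor
    · rintro ⟨t, ht, hx⟩
      exact ⟨(x, ⟨t, ht⟩), hx, rfl⟩
    · rintro ⟨⟨y, t⟩, hx, rfl⟩
      exact ⟨t.1, t.2, hx⟩
  have : (fun x : M.E => M.tstar x) ⁻¹' Set.Iio c
      = ⋃ q : ℚ, ⋃ (_ : ((q : ℝ).toNNReal : ℝ≥0∞) < c), Subtype.val ⁻¹'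
        {x : Space d | ∃ t ∈ Set.Icc (0 : ℝ≥0) (q : ℝ).toNNReal, M.φ x t ∈ frontier M.E} := by
    ext x
    simp only [Set.mem_preimage, Set.mem_Iio, tstar, exitTime, iInf_lt_iff, Set.mem_iUnion,
      Set.mem_ofPred_eq, exists_prop]
    constructor
    · rintro ⟨t, ⟨_, ht⟩, htc⟩
      obtain ⟨q, _, hq1, hq2⟩ := ENNReal.lt_iff_exists_rat_btwn.mp htc
      exact ⟨q, hq2, t, ⟨zero_le, (ENNReal.coe_lt_coe.mp hq1).le⟩, ht⟩
    · rintro ⟨q, hq, t, ⟨_, ht⟩, hx⟩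
      refine ⟨t, ⟨?_, hx⟩, lt_of_le_of_lt (ENNReal.coe_le_coe.mpr ht) hq⟩
      rcases eq_or_lt_of_le (zero_le : 0 ≤ t) with h0 | h0
      · rw [← h0, M.φ_zero, frontier, M.isOpen_E.interior_eq] at hx
        exact absurd x.2 hx.2
      · exact h0
  rw [this]
  exact MeasurableSet.iUnion fun q => MeasurableSet.iUnion fun _ =>
    (key _).measurableSet.preimage measurable_subtype_coe

theorem measurableSet_before (t : ℝ≥0∞) : MeasurableSet (before t) :=
  measurableSet_lt measurable_coe_nnreal_ennreal measurable_const

theorem measurable_expNeg : Measurable expNeg := by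
  unfold expNeg
  exact EReal.measurable_exp.comp (by fun_prop)

theorem leb_before (t : ℝ≥0∞) : leb (before t) = t := by
  rw [leb, Measure.map_apply (by fun_prop) (measurableSet_before t),
    Measure.restrict_apply ((measurableSet_before t).preimage (by fun_prop))]
  induction t with
  | top =>
    have : Real.toNNReal ⁻¹' before ∞ ∩ Set.Ici 0 = Set.Ici 0 := by
      ext x; simp [before]
    rw [this, Real.volume_Ici]
  | coe c =>
    have : Real.toNNReal ⁻¹' before c ∩ Set.Ici 0 = Set.Ico 0 (c : ℝ) := by
      ext x
      simp only [before, Set.mem_inter_iff, Set.mem_preimage, Set.mem_ofPred_eq,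
        ENNReal.coe_lt_coe, Set.mem_Ici, Set.mem_Ico]
      constructor
      · rintro ⟨h1, h2⟩
        exact ⟨h2, (Real.toNNReal_lt_iff_lt_coe h2).mp h1⟩
      · rintro ⟨h1, h2⟩
        exact ⟨(Real.toNNReal_lt_iff_lt_coe h1).mpr h2, h1⟩
    rw [this, Real.volume_Ico, sub_zero, ENNReal.ofReal_coe_nnreal]

instance : NullSingletonClass leb where
  measure_singleton y := by
    rw [leb, Measure.map_apply (by fun_prop) (measurableSet_singleton y),
      Measure.restrict_apply ((measurableSet_singleton y).preimage (by fun_prop))]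
    refine measure_mono_null (t := {(y : ℝ)}) ?_ (by simp)
    rintro x ⟨hx, h0⟩
    have hx' : x.toNNReal = y := hx
    rw [Set.mem_singleton_iff, ← hx', Real.coe_toNNReal _ h0]

theorem expNeg_coe (c : ℝ≥0) : expNeg c = ENNReal.ofReal (Real.exp (-(c : ℝ))) := by
  have : ((c : ℝ≥0∞) : EReal) = ((c : ℝ) : EReal) := rfl
  rw [expNeg, this, ← EReal.coe_neg, EReal.exp_coe]

theorem lintegral_expNeg_Ioi (a : ℝ≥0∞) :
    ∫⁻ y in {y : ℝ≥0 | a < y}, expNeg y ∂leb = expNeg a := by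
  have hm : MeasurableSet {y : ℝ≥0 | a < y} :=
    measurableSet_lt measurable_const measurable_coe_nnreal_ennreal
  induction a with
  | top => simp [expNeg]
  | coe c =>
    have hE : Measurable fun y : ℝ≥0 => expNeg y :=
      measurable_expNeg.comp measurable_coe_nnreal_ennreal
    rw [leb, setLIntegral_map hm hE measurable_real_toNNReal, Measure.restrict_restrict (hm.preimage (by fun_prop)), expNeg_coe]
    have : Real.toNNReal ⁻¹' {y : ℝ≥0 | (c : ℝ≥0∞) < y} ∩ Set.Ici 0 = Set.Ioi (c : ℝ) := by
      ext x
      simp only [Set.mem_inter_iff, Set.mem_preimage, Set.mem_ofPred_eq,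
        ENNReal.coe_lt_coe, Set.mem_Ici, Set.mem_Ioi]
      constructor
      · rintro ⟨h1, h2⟩
        exact Real.lt_toNNReal_iff_coe_lt.mp h1
      · intro h1
        exact ⟨Real.lt_toNNReal_iff_coe_lt.mpr h1, c.2.trans h1.le⟩
    rw [this, ← integral_exp_neg_Ioi (c : ℝ), ofReal_integral_eq_lintegral_ofReal
      (integrableOn_exp_neg_Ioi _) (Eventually.of_forall fun x => (Real.exp_pos _).le)]
    refine setLIntegral_congr_fun measurableSet_Ioi fun x hx => ?_
    rw [expNeg_coe, Real.coe_toNNReal _ (c.2.trans (le_of_lt hx))]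

/-- The level sets of `t ↦ m [0,t)`, for an atomless measure `m`. -/
theorem measure_sublevel (m : Measure ℝ≥0) [NullSingletonClass m] (T : ℝ≥0∞)
    (hT : ∀ t : ℝ≥0, (t : ℝ≥0∞) ≤ T → m (before t) < ∞) (Y : ℝ≥0) :
    m {s | (s : ℝ≥0∞) < T ∧ m (before s) < Y} = min (Y : ℝ≥0∞) (m (before T)) := by
  have mono : ∀ a b : ℝ≥0∞, a ≤ b → m (before a) ≤ m (before b) := fun a b hab =>
    measure_mono fun s (hs : (s : ℝ≥0∞) < a) => lt_of_lt_of_le hs hab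
  set A : Set ℝ≥0 := {s | (s : ℝ≥0∞) < T ∧ m (before s) < Y} with hA
  set c : ℝ≥0∞ := ⨆ s ∈ A, (s : ℝ≥0∞) with hc
  have hcT : c ≤ T := iSup₂_le fun s hs => hs.1.le
  have hle : ∀ s ∈ A, (s : ℝ≥0∞) ≤ c := fun s hs => le_iSup₂ (f := fun (s : ℝ≥0) (_ : s ∈ A) => (s : ℝ≥0∞)) s hs
  have hsub : before c ⊆ A := by
    intro s hs
    obtain ⟨s', hs', hlt⟩ : ∃ s' ∈ A, (s : ℝ≥0∞) < s' := by
      have hs2 : (s : ℝ≥0∞) < ⨆ s ∈ A, (s : ℝ≥0∞) := hs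
      simpa only [lt_iSup_iff, exists_prop] using hs2
    exact ⟨hlt.trans hs'.1, (mono _ _ hlt.le).trans_lt hs'.2⟩
  have hmA : m A = m (before c) := by
    refine le_antisymm ?_ (measure_mono hsub)
    have : A ⊆ before c ∪ {c.toNNReal} := by
      intro s hs
      rcases lt_or_eq_of_le (hle s hs) with h | h
      · exact Or.inl h
      · right; rw [Set.mem_singleton_iff, ← h, ENNReal.toNNReal_coe]
    refine (measure_mono this).trans ((measure_union_le _ _).trans ?_)
    rw [measure_singleton, add_zero]
  have hleft : m (before c) ≤ Y := by
    -- continuity from below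
    rcases eq_or_ne c 0 with h0 | h0
    · rw [h0]; simp [before]
    · obtain ⟨u, hu_mono, hu_lt, hu⟩ := exists_seq_strictMono_tendsto' (pos_iff_ne_zero.mpr h0)
      have hU : before c = ⋃ n, before (u n) := by
        ext s
        simp only [before, Set.mem_ofPred_eq, Set.mem_iUnion]
        constructor
        · intro hs
          exact (hu.eventually (lt_mem_nhds hs)).exists
        · rintro ⟨n, hn⟩
          exact hn.trans (hu_lt n).2
      have hmon : Monotone fun n => before (u n) := fun i j hij s (hs : (s : ℝ≥0∞) < u i) =>
        lt_of_lt_of_le hs (hu_mono.monotone hij)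
      rw [hU, hmon.measure_iUnion]
      refine iSup_le fun n => ?_
      have hne : u n ≠ ∞ := ((hu_lt n).2.trans_le le_top).ne
      have : (u n).toNNReal ∈ before c := by
        simp only [before, Set.mem_ofPred_eq, ENNReal.coe_toNNReal hne]
        exact (hu_lt n).2
      have := (hsub this).2
      rw [ENNReal.coe_toNNReal hne] at this
      exact this.le
  rw [hmA]
  refine le_antisymm (le_min hleft (mono _ _ hcT)) ?_
  rcases lt_or_eq_of_le hcT with hlt | heq
  · refine (min_le_left _ _).trans ?_
    -- continuity from above
    have hcne : c ≠ ∞ := (hlt.trans_le le_top).ne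
    obtain ⟨u, hu_anti, hu_mem, hu⟩ := exists_seq_strictAnti_tendsto' hlt
    have hI : ⋂ n, before (u n) ⊆ before c ∪ {c.toNNReal} := by
      intro s hs
      have h1 : ∀ n, (s : ℝ≥0∞) < u n := fun n => Set.mem_iInter.mp hs n
      have h2 : (s : ℝ≥0∞) ≤ c := ge_of_tendsto' hu fun n => (h1 n).le
      rcases lt_or_eq_of_le h2 with h | h
      · exact Or.inl h
      · right; rw [Set.mem_singleton_iff, ← h, ENNReal.toNNReal_coe]
    have hne : ∀ n, u n ≠ ∞ := fun n => ((hu_mem n).2.trans_le le_top).ne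
    have hfin : m (before (u 0)) ≠ ∞ := by
      have := hT (u 0).toNNReal (by rw [ENNReal.coe_toNNReal (hne 0)]; exact (hu_mem 0).2.le)
      rw [ENNReal.coe_toNNReal (hne 0)] at this
      exact this.ne
    have hanti : Antitone fun n => before (u n) := fun i j hij s (hs : (s : ℝ≥0∞) < u j) =>
      lt_of_lt_of_le hs (hu_anti.antitone hij)
    have hlim := hanti.measure_iInter (μ := m)
      (fun n => (measurableSet_before _).nullMeasurableSet) ⟨0, hfin⟩
    calc (Y : ℝ≥0∞) ≤ ⨅ n, m (before (u n)) := by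
          refine le_iInf fun n => ?_
          by_contra hcon
          push Not at hcon
          have hin : (u n).toNNReal ∈ A := by
            simp only [hA, Set.mem_ofPred_eq, ENNReal.coe_toNNReal (hne n)]
            exact ⟨(hu_mem n).2, hcon⟩
          have := hle _ hin
          rw [ENNReal.coe_toNNReal (hne n)] at this
          exact absurd (hu_mem n).1 (not_lt.mpr this)
      _ = m (⋂ n, before (u n)) := hlim.symm
      _ ≤ m (before c ∪ {c.toNNReal}) := measure_mono hI
      _ ≤ m (before c) + m {c.toNNReal} := measure_union_le _ _
      _ = m (before c) := by rw [measure_singleton, add_zero]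
  · rw [heq]; exact min_le_right _ _

/-- `∫_{[0,T)} e^{-m[0,s)} m(ds) + e^{-m[0,T)} = 1`. -/
theorem lintegral_expNeg_add (m : Measure ℝ≥0) [SFinite m] [NullSingletonClass m] (T : ℝ≥0∞)
    (hT : ∀ t : ℝ≥0, (t : ℝ≥0∞) ≤ T → m (before t) < ∞) :
    ∫⁻ s in before T, expNeg (m (before s)) ∂m + expNeg (m (before T)) = 1 := by
  have hF : Measurable fun s : ℝ≥0 => m (before s) := by
    refine Monotone.measurable fun a b hab => measure_mono fun s hs => ?_
    exact lt_of_lt_of_le (show (s : ℝ≥0∞) < a from hs) (ENNReal.coe_le_coe.mpr hab)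
  have hE : Measurable fun y : ℝ≥0 => expNeg y :=
    measurable_expNeg.comp measurable_coe_nnreal_ennreal
  have h1 : ∫⁻ s in before T, expNeg (m (before s)) ∂m
      = ∫⁻ y, expNeg y * min (y : ℝ≥0∞) (m (before T)) ∂leb := by
    calc ∫⁻ s in before T, expNeg (m (before s)) ∂m
        = ∫⁻ s in before T, ∫⁻ y, {p : ℝ≥0 × ℝ≥0 | m (before p.1) < p.2}.indicator
            (fun p => expNeg p.2) (s, y) ∂leb ∂m := by
          refine lintegral_congr fun s => ?_
          rw [← lintegral_expNeg_Ioi, ← lintegral_indicator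
            (measurableSet_lt measurable_const measurable_coe_nnreal_ennreal)]
          rfl
      _ = ∫⁻ y, ∫⁻ s in before T, {p : ℝ≥0 × ℝ≥0 | m (before p.1) < p.2}.indicator
            (fun p => expNeg p.2) (s, y) ∂m ∂leb := by
          refine lintegral_lintegral_swap (Measurable.aemeasurable ?_)
          exact (hE.comp measurable_snd).indicator (measurableSet_lt (hF.comp measurable_fst)
            (measurable_coe_nnreal_ennreal.comp measurable_snd))
      _ = _ := by
          refine lintegral_congr fun y => ?_
          have hms : MeasurableSet {s : ℝ≥0 | m (before s) < y} :=
            measurableSet_lt hF measurable_const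
          have : (fun s : ℝ≥0 => {p : ℝ≥0 × ℝ≥0 | m (before p.1) < p.2}.indicator
              (fun p => expNeg p.2) (s, y)) = {s : ℝ≥0 | m (before s) < y}.indicator
              (fun _ => expNeg y) := rfl
          rw [this, lintegral_indicator hms, setLIntegral_const, Measure.restrict_apply hms,
            ← measure_sublevel m T hT y]
          congr 2
          ext s
          exact and_comm
  have h2 : ∫⁻ y, expNeg y * min (y : ℝ≥0∞) (m (before T)) ∂leb
      = ∫⁻ v in before (m (before T)), expNeg v ∂leb := by
    set B := m (before T)
    calc ∫⁻ y, expNeg y * min (y : ℝ≥0∞) B ∂leb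
        = ∫⁻ y, ∫⁻ v in before B, {p : ℝ≥0 × ℝ≥0 | (p.2 : ℝ≥0∞) < p.1}.indicator
            (fun p => expNeg p.1) (y, v) ∂leb ∂leb := by
          refine lintegral_congr fun y => ?_
          have hms : MeasurableSet (before y) := measurableSet_before _
          have : (fun v : ℝ≥0 => {p : ℝ≥0 × ℝ≥0 | (p.2 : ℝ≥0∞) < p.1}.indicator
              (fun p => expNeg p.1) (y, v)) = (before y).indicator (fun _ => expNeg y) := rfl
          rw [this, lintegral_indicator hms, setLIntegral_const, Measure.restrict_apply hms]
          have h3 : before y ∩ before B = before (min (y : ℝ≥0∞) B) := by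
            ext s; simp [before]
          rw [h3, leb_before]
      _ = ∫⁻ v in before B, ∫⁻ y, {p : ℝ≥0 × ℝ≥0 | (p.2 : ℝ≥0∞) < p.1}.indicator
            (fun p => expNeg p.1) (y, v) ∂leb ∂leb := by
          refine lintegral_lintegral_swap (Measurable.aemeasurable ?_)
          exact (hE.comp measurable_fst).indicator (measurableSet_lt
            (measurable_coe_nnreal_ennreal.comp measurable_snd)
            (measurable_coe_nnreal_ennreal.comp measurable_fst))
      _ = _ := by
          refine lintegral_congr fun v => ?_
          rw [← lintegral_expNeg_Ioi v, ← lintegral_indicator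
            (measurableSet_lt measurable_const measurable_coe_nnreal_ennreal)]
          rfl
  rw [h1, h2, ← lintegral_expNeg_Ioi (m (before T))]
  set B := m (before T)
  have h4 : ∫⁻ y in {y : ℝ≥0 | B < y}, expNeg y ∂leb
      = ∫⁻ y in (before B)ᶜ, expNeg y ∂leb := by
    refine setLIntegral_congr ?_
    have : (before B)ᶜ = {y : ℝ≥0 | B < y} ∪ {y : ℝ≥0 | B = y} := by
      ext y; simp [before, le_iff_lt_or_eq]
    rw [this]
    refine (union_ae_eq_left_of_ae_eq_empty ?_).symm
    refine ae_eq_empty.mpr (measure_mono_null (t := {B.toNNReal}) ?_ (measure_singleton _))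
    intro y hy
    rw [Set.mem_singleton_iff, show B = y from hy, ENNReal.toNNReal_coe]
  rw [h4, lintegral_add_compl _ (measurableSet_before B)]
  have h5 := lintegral_expNeg_Ioi 0
  have h6 : expNeg 0 = 1 := by simp [expNeg]
  rw [h6] at h5
  rw [← h5]
  symm
  refine (setLIntegral_congr (t := Set.univ) ?_).trans (setLIntegral_univ _)
  rw [eventuallyEq_univ]
  refine mem_ae_iff.mpr (measure_mono_null (t := {0}) ?_ (measure_singleton _))
  intro y hy
  simpa using hy

theorem Policy.measurable_path {M : Model d 𝕌} (U : M.Policy) (n : ℕ) :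
    Measurable (fun p : M.E × ℝ≥0 => (M.φ p.1 p.2, U.u n p.1 p.2)) := by
  refine Measurable.prodMk ?_ ?_
  · exact M.continuous_φ.measurable.comp
      ((measurable_subtype_coe.comp measurable_fst).prodMk measurable_snd)
  · exact U.measurable_u.comp (by fun_prop : Measurable fun p : M.E × ℝ≥0 => (n, p.1, p.2))

theorem Policy.measurable_cumRate {M : Model d 𝕌} (U : M.Policy) (n : ℕ) :
    Measurable (fun p : M.E × ℝ≥0∞ => M.cumRate p.1 (U.u n p.1) p.2) := by
  have : (fun p : M.E × ℝ≥0∞ => M.cumRate p.1 (U.u n p.1) p.2) = fun p => ∫⁻ s,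
      {q : (M.E × ℝ≥0∞) × ℝ≥0 | (q.2 : ℝ≥0∞) < q.1.2}.indicator
        (fun q => (M.lam (M.φ q.1.1 q.2, U.u n q.1.1 q.2) : ℝ≥0∞)) (p, s) ∂leb := by
    ext p
    rw [cumRate, ← lintegral_indicator (measurableSet_before _)]
    rfl
  rw [this]
  apply Measurable.lintegral_prod_right'
  apply Measurable.indicator
  · exact (M.measurable_lam.comp ((U.measurable_path n).comp
      (by fun_prop : Measurable fun q : (M.E × ℝ≥0∞) × ℝ≥0 => (q.1.1, q.2)))).coe_nnreal_ennreal
  · exact measurableSet_lt (by fun_prop) (by fun_prop)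

theorem Policy.measurable_sojournLaw {M : Model d 𝕌} (U : M.Policy) (n : ℕ) :
    Measurable (fun z : M.E => M.sojournLaw z (U.u n z)) := by
  refine Measure.measurable_of_measurable_coe _ fun A hA => ?_
  have hd : Measurable (fun q : M.E × ℝ≥0 =>
      (M.lam (M.φ q.1 q.2, U.u n q.1 q.2) : ℝ≥0∞) * expNeg (M.cumRate q.1 (U.u n q.1) q.2)) := by
    refine ((M.measurable_lam.comp (U.measurable_path n)).coe_nnreal_ennreal).mul ?_
    exact measurable_expNeg.comp ((U.measurable_cumRate n).comp
      (by fun_prop : Measurable fun q : M.E × ℝ≥0 => (q.1, (q.2 : ℝ≥0∞))))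
  have : (fun z : M.E => M.sojournLaw z (U.u n z) A) = fun z => (∫⁻ s,
      {q : M.E × ℝ≥0 | (q.2 : ℝ≥0∞) < M.tstar q.1 ∧ (q.2 : ℝ≥0∞) ∈ A}.indicator
        (fun q => (M.lam (M.φ q.1 q.2, U.u n q.1 q.2) : ℝ≥0∞)
          * expNeg (M.cumRate q.1 (U.u n q.1) q.2)) (z, s) ∂leb)
      + expNeg (M.cumRate z (U.u n z) (M.tstar z)) * A.indicator 1 (M.tstar z) := by
    ext z
    have hA' : MeasurableSet ((fun s : ℝ≥0 => (s : ℝ≥0∞)) ⁻¹' A) :=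
      hA.preimage (by fun_prop)
    rw [sojournLaw, Measure.add_apply, Measure.map_apply (by fun_prop) hA,
      withDensity_apply _ hA', Measure.restrict_restrict hA', Measure.smul_apply, smul_eq_mul,
      Measure.dirac_apply' _ hA, ← lintegral_indicator (hA'.inter (measurableSet_before _))]
    congr 2
    ext s
    classical
    rw [Set.indicator_apply, Set.indicator_apply]
    exact if_congr and_comm rfl rfl
  rw [this]
  refine Measurable.add ?_ ?_
  · apply Measurable.lintegral_prod_right'
    refine hd.indicator (MeasurableSet.inter ?_ ?_)
    · exact measurableSet_lt (by fun_prop) ((measurable_tstar M).comp measurable_fst)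
    · exact hA.preimage (by fun_prop)
  · refine Measurable.mul ?_ ?_
    · exact measurable_expNeg.comp
        ((U.measurable_cumRate n).comp (measurable_id.prodMk (measurable_tstar M)))
    · exact (measurable_one.indicator hA).comp (measurable_tstar M)

theorem flow_mem (M : Model d 𝕌) {x : Space d} (hx : x ∈ M.E) {s : ℝ≥0}
    (hs : (s : ℝ≥0∞) < M.tstar x) : M.φ x s ∈ M.E := by
  by_contra hcon
  have hcont : Continuous (M.φ x) :=
    M.continuous_φ.comp (continuous_const.prodMk continuous_id)
  have hpre : IsPreconnected (M.φ x '' Set.Icc 0 s) :=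
    isPreconnected_Icc.image _ hcont.continuousOn
  obtain ⟨t, ht, hy⟩ : ∃ t ∈ Set.Icc 0 s, M.φ x t ∈ frontier M.E := by
    by_contra hno
    have hcl : ∀ t ∈ Set.Icc 0 s, M.φ x t ∈ closure M.E → M.φ x t ∈ M.E := fun t ht hc => by
      by_contra hE
      exact hno ⟨t, ht, hc, by rwa [M.isOpen_E.interior_eq]⟩
    obtain ⟨y, -, hy1, hy2⟩ := hpre M.E (closure M.E)ᶜ M.isOpen_E isClosed_closure.isOpen_compl
      (by
        rintro _ ⟨t, ht, rfl⟩
        by_cases hc : M.φ x t ∈ closure M.E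
        · exact Or.inl (hcl t ht hc)
        · exact Or.inr hc)
      ⟨x, ⟨0, ⟨le_rfl, zero_le⟩, M.φ_zero x⟩, hx⟩
      ⟨_, ⟨s, ⟨zero_le, le_rfl⟩, rfl⟩, fun hc => hcon (hcl s ⟨zero_le, le_rfl⟩ hc)⟩
    exact hy2 (subset_closure hy1)
  have ht0 : 0 < t := by
    rcases eq_or_lt_of_le (zero_le : 0 ≤ t) with h0 | h0
    · rw [← h0, M.φ_zero, frontier, M.isOpen_E.interior_eq] at hy
      exact absurd hx hy.2
    · exact h0
  have : M.tstar x ≤ t := iInf₂_le t ⟨ht0, hy⟩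
  exact absurd (hs.trans_le this) (not_lt.mpr (ENNReal.coe_le_coe.mpr ht.2))

theorem Policy.cumRate_lt_top {M : Model d 𝕌} (U : M.Policy) (n : ℕ) (x : M.E) (t : ℝ≥0)
    (ht : (t : ℝ≥0∞) ≤ M.tstar x) : M.cumRate x (U.u n x) t < ∞ := by
  refine lt_of_le_of_lt ?_ (M.rate_lt_top x x.2 t ht)
  have : before (t : ℝ≥0∞) = {s : ℝ≥0 | s < t} := by ext s; simp [before]
  rw [cumRate, this]
  refine setLIntegral_mono' measurableSet_Iio fun s hs => ?_
  have hE : M.φ x s ∈ M.E :=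
    M.flow_mem x.2 (lt_of_lt_of_le (ENNReal.coe_lt_coe.mpr hs) ht)
  exact le_iSup₂ (f := fun a (_ : a ∈ M.act (M.φ x s)) => (M.lam (M.φ x s, a) : ℝ≥0∞))
    (U.u n x s) (U.u_mem n x s (subset_closure hE))

theorem measurable_exitPoint (M : Model d 𝕌) : Measurable (fun x : M.E => M.exitPoint x) := by
  unfold exitPoint
  refine Measurable.ite ?_ measurable_const ?_
  · exact measurable_tstar M (measurableSet_singleton ∞)
  · exact M.continuous_φ.measurable.comp
      (measurable_subtype_coe.prodMk (measurable_tstar M).ennreal_toNNReal)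

theorem Policy.measurable_jumpPoint {M : Model d 𝕌} (U : M.Policy) (n : ℕ) :
    Measurable (jumpPoint U n) := by
  unfold jumpPoint
  refine Measurable.ite ?_ ?_ ?_
  · exact measurableSet_lt measurable_snd ((measurable_tstar M).comp measurable_fst)
  · exact (U.measurable_path n).comp (measurable_fst.prodMk measurable_snd.ennreal_toNNReal)
  · refine ((measurable_exitPoint M).comp measurable_fst).prodMk ?_
    exact U.measurable_ub.comp (by fun_prop : Measurable fun p : M.E × ℝ≥0∞ => (n, p.1))

theorem Policy.isProbabilityMeasure_sojournLaw {M : Model d 𝕌} (U : M.Policy) (n : ℕ) (x : M.E) :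
    IsProbabilityMeasure (M.sojournLaw x (U.u n x)) := by
  constructor
  have hl : Measurable fun s : ℝ≥0 => (M.lam (M.φ x s, U.u n x s) : ℝ≥0∞) :=
    (M.measurable_lam.comp ((U.measurable_path n).comp measurable_prodMk_left)).coe_nnreal_ennreal
  have hc : Measurable fun s : ℝ≥0 => expNeg (M.cumRate x (U.u n x) s) :=
    measurable_expNeg.comp ((U.measurable_cumRate n).comp
      (measurable_const.prodMk measurable_coe_nnreal_ennreal : Measurable fun s : ℝ≥0 =>
        (x, (s : ℝ≥0∞))))
  set m : Measure ℝ≥0 := leb.withDensity fun s => (M.lam (M.φ x s, U.u n x s) : ℝ≥0∞) with hm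
  have hcm : ∀ t, M.cumRate x (U.u n x) t = m (before t) := fun t => by
    rw [hm, withDensity_apply _ (measurableSet_before t), cumRate]
  have key := lintegral_expNeg_add m (M.tstar x) fun t ht => by
    rw [← hcm]; exact U.cumRate_lt_top n x t ht
  rw [sojournLaw, Measure.add_apply, Measure.map_apply measurable_coe_nnreal_ennreal .univ,
    Set.preimage_univ, withDensity_apply _ .univ, Measure.restrict_univ, Measure.smul_apply,
    smul_eq_mul, measure_univ, mul_one, ← key, ← hcm]
  congr 1
  rw [hm, restrict_withDensity (measurableSet_before _),
    lintegral_withDensity_eq_lintegral_mul _ hl]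
  · exact lintegral_congr fun s => by rw [Pi.mul_apply, ← hm, ← hcm]
  · simpa only [← hm, ← hcm] using hc

/-- The transition kernel of the time between the `n`-th and the next jump, given the location at
the `n`-th jump. -/
noncomputable def sojournKernel {M : Model d 𝕌} (U : M.Policy) (n : ℕ) : Kernel M.E ℝ≥0∞ where
  toFun z := M.sojournLaw z (U.u n z)
  measurable' := U.measurable_sojournLaw n

instance {M : Model d 𝕌} (U : M.Policy) (n : ℕ) : IsMarkovKernel (sojournKernel U n) :=
  ⟨fun x => U.isProbabilityMeasure_sojournLaw n x⟩

/-- The transition kernel of the next post-jump location, given the location at the `n`-th jump and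
the time elapsed since. When that time is infinite the value is drawn but never used. -/
noncomputable def locationKernel {M : Model d 𝕌} (U : M.Policy) (n : ℕ) :
    Kernel (M.E × ℝ≥0∞) M.E :=
  M.Q.comap (jumpPoint U n) (U.measurable_jumpPoint n)

instance {M : Model d 𝕌} (U : M.Policy) (n : ℕ) : IsMarkovKernel (locationKernel U n) := by
  have := M.markov_Q
  unfold locationKernel
  infer_instance

/-- The transition kernel of (next inter-jump time, next post-jump location), given the location at
the `n`-th jump. -/
noncomputable def stepKernel {M : Model d 𝕌} (U : M.Policy) (n : ℕ) :
    Kernel M.E (ℝ≥0∞ × M.E) :=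
  sojournKernel U n ⊗ₖ locationKernel U n

instance {M : Model d 𝕌} (U : M.Policy) (n : ℕ) : IsMarkovKernel (stepKernel U n) := by
  unfold stepKernel; infer_instance

/-! ### The controlled process -/

/-- The sample space: sequences `(S_n, Z_n)_{n ≥ 0}`, where `Z_n` is the location just after the
`n`-th jump and `S_n`, for `n ≥ 1`, is the time between the `(n-1)`-th and the `n`-th jump. -/
abbrev Path (M : Model d 𝕌) : Type := ℕ → ℝ≥0∞ × M.E

/-- The kernel `stepKernel`, as a function of the whole past. -/
noncomputable def histKernel {M : Model d 𝕌} (U : M.Policy) (n : ℕ) :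
    Kernel ((i : Finset.Iic n) → ℝ≥0∞ × M.E) (ℝ≥0∞ × M.E) :=
  (stepKernel U n).comap (fun y => (y ⟨n, Finset.mem_Iic.mpr le_rfl⟩).2)
    (measurable_snd.comp (measurable_pi_apply _))

instance {M : Model d 𝕌} (U : M.Policy) (n : ℕ) : IsMarkovKernel (histKernel U n) := by
  unfold histKernel; infer_instance

/-- The law `P^U_{(x,0)}`. -/
noncomputable def law {M : Model d 𝕌} (U : M.Policy) (x : M.E) : Measure M.Path :=
  Kernel.traj (X := fun _ => ℝ≥0∞ × M.E) (histKernel U) 0 (fun _ => (0, x))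

/-- The location `Z_n` just after the `n`-th jump. -/
def Z {M : Model d 𝕌} (n : ℕ) (ω : M.Path) : M.E := (ω n).2

/-- The `n`-th jump time `T_n ∈ [0, ∞]`, with `T_0 = 0`. -/
noncomputable def T {M : Model d 𝕌} (n : ℕ) (ω : M.Path) : ℝ≥0∞ :=
  ∑ i ∈ Finset.range n, (ω (i + 1)).1

/-- The number `N(t)` of jumps up to time `t`: the `n` with `T_n ≤ t < T_{n+1}`. -/
noncomputable def N {M : Model d 𝕌} (t : ℝ≥0) (ω : M.Path) : ℕ :=
  sInf {n | (t : ℝ≥0∞) < T (n + 1) ω}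

/-- The time `τ(t)` elapsed at time `t` since the last jump. -/
noncomputable def elapsed {M : Model d 𝕌} (t : ℝ≥0) (ω : M.Path) : ℝ≥0 :=
  t - (T (N t ω) ω).toNNReal

/-- The state `X(t) = φ(Z(t), τ(t))`, where `Z(t) = Z_{N(t)}`. -/
noncomputable def state {M : Model d 𝕌} (t : ℝ≥0) (ω : M.Path) : Space d :=
  M.φ (Z (N t ω) ω) (elapsed t ω)

/-- `∫_0^t f(X(s), u(N(s), Z(s), τ(s))) ds`. -/
noncomputable def runningCost {M : Model d 𝕌} (U : M.Policy) (t : ℝ≥0) (ω : M.Path) : ℝ≥0∞ :=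
  ∫⁻ s in {s : ℝ≥0 | s ≤ t},
    (M.f (state s ω, U.u (N s ω) (Z (N s ω) ω) (elapsed s ω)) : ℝ≥0∞) ∂leb

/-- `∫_0^t r(X(s-), u_∂(N(s-), Z(s-))) dp^*(s)`: the sum over the jump times `T_{n+1} ≤ t` at which
`X(T_{n+1}-) = φ(Z_n, T_{n+1} - T_n)` lies on the boundary. -/
noncomputable def boundaryCost {M : Model d 𝕌} (U : M.Policy) (t : ℝ≥0) (ω : M.Path) : ℝ≥0∞ :=
  open Classical in
  ∑' n, if T (n + 1) ω ≤ t ∧ M.φ (Z n ω) (ω (n + 1)).1.toNNReal ∈ frontier M.E then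
    (M.r (M.φ (Z n ω) (ω (n + 1)).1.toNNReal, U.ub n (Z n ω)) : ℝ≥0∞) else 0

/-- The long-run average cost `𝓐(U,x)`. -/
noncomputable def avgCost {M : Model d 𝕌} (U : M.Policy) (x : M.E) : ℝ≥0∞ :=
  limsup (fun t : ℝ≥0 =>
    (∫⁻ ω, (runningCost U t ω + boundaryCost U t ω) ∂(law U x)) / (t : ℝ≥0∞)) atTop

/-- The optimal value `𝓙_𝓐(x) = inf_{U ∈ 𝓤} 𝓐(U,x)`. -/
noncomputable def value (M : Model d 𝕌) (x : M.E) : ℝ≥0∞ := ⨅ U : M.Policy, avgCost U x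

/-- The standing assumption that `E^U_{(x,0)}[∑_{i ≥ 1} I_{T_i ≤ t}] < ∞` for all `x`, `U`, `t`. -/
def FiniteJumps (M : Model d 𝕌) : Prop :=
  ∀ (x : M.E) (U : M.Policy) (t : ℝ≥0),
    ∫⁻ ω, (∑' i : ℕ, {ω' : M.Path | T (i + 1) ω' ≤ t}.indicator 1 ω) ∂(law U x) < ∞

/-- The state `X(t ∧ T_m)`. -/
noncomputable def stopped {M : Model d 𝕌} (t : ℝ≥0) (m : ℕ) (ω : M.Path) : Space d :=
  state (min (t : ℝ≥0∞) (T m ω)).toNNReal ω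

/-- `E^U_{(x,0)}[h(X(t ∧ T_m))] ∈ (-∞, ∞]`, for `h` bounded below: the expectation of the positive
part minus that of the negative part. -/
noncomputable def expStopped {M : Model d 𝕌} (U : M.Policy) (h : Space d → ℝ) (x : M.E) (t : ℝ≥0)
    (m : ℕ) : EReal :=
  ((∫⁻ ω, ENNReal.ofReal (h (stopped t m ω)) ∂(law U x) : ℝ≥0∞) : EReal)
    - ((∫⁻ ω, ENNReal.ofReal (-h (stopped t m ω)) ∂(law U x) : ℝ≥0∞) : EReal)

/-- The policy `U` is the one built from the selector `Γ = (γ, γ_∂)`: `u_∂(n,x) = γ_∂(x)`, and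
`u(n,x,t) = γ(x)(t)` for almost every `t` (in `𝕍` functions that are equal almost everywhere are
identified). -/
def Policy.IsInducedBy {M : Model d 𝕌} (U : M.Policy)
    (Γ : M.E → OrdControl 𝕌 × 𝕌) : Prop :=
  ∀ n x, U.ub n x = (Γ x).2 ∧ ∀ᵐ t ∂leb, U.u n x t = (Γ x).1 t

end Model

end PDMP

/-!
The data of the theorem say that `h` solves the optimality equation `𝓣(ρ,h) = h` and that `Γ` attains
the infimum in it. The argument is a verification argument; signs and integrability are kept out of
it by passing from `h` to `k = h + c ≥ 0`. Since `G1 = 1`, the equation for `h` becomes the inequality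
`k(x) + ρ𝓛(x,Υ) ≤ Lf(x,Υ) + Hr(x,Υ) + Gk(x,Υ)` for all feasible `Υ` (`Model.IsSubsolution`), with the
reverse inequality for `Υ = Γ(x)` (`Model.IsMinimizer`), all terms being in `[0, ∞]`
(`Model.oneStage_shift`).

*From one sojourn to a finite horizon.* The flow satisfies `φ(x, v + s) = φ(φ(x,v), s)`, so the
functionals of `x` split at a time `v < t_*(x)` into the part before `v` and `e^{-Λ(v)}` times the
functionals of `φ(x,v)`. For the inequality `≤` the tail of a control is replaced by `Γ(φ(x,v))`; for
the reverse inequality the subsolution property is applied to the tail of `Γ(x)`, and the common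
finite term is cancelled. This gives the optimality inequalities over `[0, min v t_*(x)]`
(`Model.IsSubsolution.le_stageStop`, `Model.IsSubsolution.stageStop_le`).

*From one sojourn to the process.* The expected running cost, boundary cost, and value of `k` at the
end of the piece of a sojourn that lies before `t` add up to the finite-horizon functional
(`Model.lintegral_step_eq_stageStop`). By the Markov property of the embedded chain
(`Model.lintegral_law_next`), the inequalities can be summed over the first `m` sojourns:
`k(x) + ρ E[t ∧ T_m] ≤ E[cost up to t ∧ T_m] + E[k(X(t ∧ T_m))]` for every policy, with the reverse
inequality for a policy induced by `Γ` (`Model.le_sum_cost_add_stopped`,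
`Model.sum_cost_add_stopped_le`). As `T_m → ∞`, the growth condition removes the last term after
division by `t`, which gives `ρ ≤ 𝓐(U,x)` for all `U` (`Model.le_avgCost`); in the reverse inequality
the last term is dropped, which gives `𝓐(U,x) ≤ ρ` for `U` induced by `Γ` (`Model.avgCost_le`).

*The policy.* The map `x ↦ γ(x)` is measurable into the controls modulo null sets only, which makes
`(x,t) ↦ ∫_0^t ψ(γ(x)(s)) ds` measurable for `ψ ∈ C(𝕌)`. Lebesgue's differentiation theorem, applied to
countably many `ψ` that separate the points of `𝕌`, then gives a jointly measurable version of
`γ(x)(t)` (`exists_measurable_version`). It may be infeasible on a null set of times, where it is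
replaced by a Borel selection of `𝕌(·)`. That selection exists because a Borel set with compact sections
has a Borel projection, a consequence of Novikov's separation theorem (`seqSeparable_of_analyticSet`,
`exists_measurable_selection`).
-/

namespace PDMP
open Model

/-! ### Borel selections of Borel sets with compact sections -/

/-- A sequence of sets is Borel separated if it has Borel enlargements with empty intersection. -/
def SeqSeparable {α : Type*} [MeasurableSpace α] (A : ℕ → Set α) : Prop :=
  ∃ B : ℕ → Set α, (∀ n, MeasurableSet (B n)) ∧ (∀ n, A n ⊆ B n) ∧ ⋂ n, B n = ∅

theorem SeqSeparable.mono {α : Type*} [MeasurableSpace α] {A A' : ℕ → Set α}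
    (h : SeqSeparable A') (hA : ∀ n, A n ⊆ A' n) : SeqSeparable A := by
  obtain ⟨B, hB, hAB, h0⟩ := h
  exact ⟨B, hB, fun n => (hA n).trans (hAB n), h0⟩

/-- Separation may be checked after one of the sets is cut into countably many pieces. -/
theorem SeqSeparable.of_iUnion {α : Type*} [MeasurableSpace α] {A : ℕ → Set α} (n₀ : ℕ)
    {A' : ℕ → ℕ → Set α} (hA' : ∀ i, SeqSeparable (A' i)) (h₀ : A n₀ ⊆ ⋃ i, A' i n₀)
    (h : ∀ i n, n ≠ n₀ → A n ⊆ A' i n) : SeqSeparable A := by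
  choose B hB hAB h0 using hA'
  classical
  refine ⟨fun n => if n = n₀ then ⋃ i, B i n else ⋂ i, B i n, fun n => ?_, fun n => ?_, ?_⟩
  · dsimp only
    split_ifs
    · exact MeasurableSet.iUnion fun i => hB i n
    · exact MeasurableSet.iInter fun i => hB i n
  · dsimp only
    split_ifs with hn
    · subst hn
      exact h₀.trans (Set.iUnion_mono fun i => hAB i n)
    · exact Set.subset_iInter fun i => (h i n hn).trans (hAB i n)
  · refine Set.eq_empty_of_forall_notMem fun x hx => ?_
    rw [Set.mem_iInter] at hx
    have hx₀ := hx n₀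
    simp only [if_true, Set.mem_iUnion] at hx₀
    obtain ⟨i, hi⟩ := hx₀
    have : x ∈ ⋂ n, B i n := by
      refine Set.mem_iInter.mpr fun n => ?_
      by_cases hn : n = n₀
      · rw [hn]; exact hi
      · have := hx n
        simp only [hn, if_false, Set.mem_iInter] at this
        exact this i
    rw [h0] at this
    exact this

/-- **Novikov's separation theorem** for continuous images of the Baire space. One sequence `w`
codes the points `w ⟨n, ·⟩` of countably many copies of the Baire space, so that lengthening a
cylinder by one coordinate cuts only one of the sets `range (f n)`. -/
theorem seqSeparable_range {α : Type*} [TopologicalSpace α] [T2Space α] [MeasurableSpace α]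
    [OpensMeasurableSpace α] {f : ℕ → (ℕ → ℕ) → α} (hf : ∀ n, Continuous (f n))
    (h : ⋂ n, Set.range (f n) = ∅) : SeqSeparable fun n => Set.range (f n) := by
  let g : ℕ → (ℕ → ℕ) → α := fun n w => f n fun j => w (Nat.pair n j)
  have hg : ∀ n, Continuous (g n) := fun n =>
    (hf n).comp (continuous_pi fun j => continuous_apply _)
  have hfg : ∀ n, Set.range (f n) ⊆ Set.range (g n) := by
    rintro n _ ⟨z, rfl⟩
    refine ⟨fun m => z (Nat.unpair m).2, ?_⟩
    simp only [g, Nat.unpair_pair]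
  have hgf : ∀ n, Set.range (g n) ⊆ Set.range (f n) := by
    rintro n _ ⟨z, rfl⟩
    exact ⟨_, rfl⟩
  suffices SeqSeparable fun n => Set.range (g n) from this.mono hfg
  by_contra hsep
  have step : ∀ (k : ℕ) (w : ℕ → ℕ), ¬ SeqSeparable (fun n => g n '' PiNat.cylinder w k) →
      ∃ i, ¬ SeqSeparable (fun n => g n '' PiNat.cylinder (Function.update w k i) (k + 1)) := by
    intro k w
    contrapose!
    intro H
    refine SeqSeparable.of_iUnion (Nat.unpair k).1 H ?_ ?_
    · rw [← PiNat.iUnion_cylinder_update w k, Set.image_iUnion]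
    · rintro i n hn _ ⟨w', hw', rfl⟩
      refine ⟨Function.update w' k i, ?_, ?_⟩
      · intro j hj
        rcases Nat.lt_succ_iff_lt_or_eq.mp hj with hj | rfl
        · rw [Function.update_of_ne hj.ne, Function.update_of_ne hj.ne]
          exact hw' j hj
        · simp
      · simp only [g]
        congr 1
        ext j
        refine Function.update_of_ne (fun hk => hn ?_) _ _
        rw [← hk, Nat.unpair_pair]
  choose! c hc using step
  let p : ℕ → ℕ → ℕ := fun k => k.rec (fun _ => 0) fun k w => Function.update w k (c k w)
  have hp : ∀ k, p (k + 1) = Function.update (p k) k (c k (p k)) := fun k => rfl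
  have hpn : ∀ k, ¬ SeqSeparable fun n => g n '' PiNat.cylinder (p k) k := by
    intro k
    induction k with
    | zero => simpa using hsep
    | succ k ih => rw [hp]; exact hc k _ ih
  let w : ℕ → ℕ := fun k => p (k + 1) k
  have hstat : ∀ i k, i < k → p k i = w i := by
    intro i k hik
    induction k, (hik : i + 1 ≤ k) using Nat.le_induction with
    | base => rfl
    | succ k hk ih => rw [hp, Function.update_of_ne (by omega), ih]
  have hw : ∀ k, ¬ SeqSeparable fun n => g n '' PiNat.cylinder w k := by
    intro k
    have : PiNat.cylinder w k = PiNat.cylinder (p k) k := by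
      rw [← PiNat.mem_cylinder_iff_eq]
      intro i hi
      exact (hstat i k hi).symm
    rw [this]
    exact hpn k
  obtain ⟨i, j, hij⟩ : ∃ i j, g i w ≠ g j w := by
    by_contra hall
    push Not at hall
    have : g 0 w ∈ ⋂ n, Set.range (f n) :=
      Set.mem_iInter.mpr fun n => hgf n ⟨w, hall n 0⟩
    rw [h] at this
    exact this
  obtain ⟨u, v, hu, hv, hiu, hjv, huv⟩ := t2_separation hij
  have hnear : ∀ {n : ℕ} {u : Set α}, IsOpen u → g n w ∈ u →
      ∃ k, ∀ l, k ≤ l → g n '' PiNat.cylinder w l ⊆ u := by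
    intro n u hu hmem
    let : MetricSpace (ℕ → ℕ) := PiNat.metricSpaceNatNat
    obtain ⟨ε, hε, hball⟩ := Metric.mem_nhds_iff.mp
      ((hg n).continuousAt.preimage_mem_nhds (hu.mem_nhds hmem))
    obtain ⟨k, hk⟩ := exists_pow_lt_of_lt_one hε (by norm_num : (1 / 2 : ℝ) < 1)
    refine ⟨k, fun l hl => ?_⟩
    rw [Set.image_subset_iff]
    refine subset_trans (fun z hz => ?_) hball
    have hz' := PiNat.cylinder_anti w hl hz
    rw [PiNat.mem_cylinder_iff_dist_le] at hz'
    exact hz'.trans_lt hk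
  obtain ⟨k₁, hk₁⟩ := hnear hu hiu
  obtain ⟨k₂, hk₂⟩ := hnear hv hjv
  have hne : i ≠ j := fun h => hij (by rw [h])
  classical
  refine hw (max k₁ k₂) ⟨fun n => if n = i then u else if n = j then v else Set.univ,
    fun n => ?_, fun n => ?_, ?_⟩
  · dsimp only
    split_ifs
    · exact hu.measurableSet
    · exact hv.measurableSet
    · exact .univ
  · dsimp only
    split_ifs with h1 h2
    · subst h1; exact hk₁ _ (le_max_left _ _)
    · subst h2; exact hk₂ _ (le_max_right _ _)
    · exact Set.subset_univ _
  · refine Set.eq_empty_of_forall_notMem fun x hx => ?_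
    rw [Set.mem_iInter] at hx
    have h1 := hx i
    have h2 := hx j
    simp only [if_true, hne.symm, if_false] at h1 h2
    exact Set.disjoint_left.mp huv h1 h2

/-- **Novikov's separation theorem**: analytic sets with empty intersection have Borel
enlargements with empty intersection. -/
theorem seqSeparable_of_analyticSet {α : Type*} [TopologicalSpace α] [T2Space α]
    [MeasurableSpace α] [OpensMeasurableSpace α] {A : ℕ → Set α} (hA : ∀ n, AnalyticSet (A n))
    (h : ⋂ n, A n = ∅) : SeqSeparable A := by
  by_cases hemp : ∃ n, A n = ∅
  · obtain ⟨n₀, hn₀⟩ := hemp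
    classical
    refine ⟨fun n => if n = n₀ then ∅ else Set.univ, fun n => ?_, fun n => ?_, ?_⟩
    · dsimp only; split_ifs <;> simp
    · dsimp only
      split_ifs with hn
      · rw [hn, hn₀]
      · exact Set.subset_univ _
    · refine Set.eq_empty_of_forall_notMem fun x hx => ?_
      simpa using Set.mem_iInter.mp hx n₀
  · push Not at hemp
    have : ∀ n, ∃ f : (ℕ → ℕ) → α, Continuous f ∧ Set.range f = A n := fun n => by
      have := hA n
      rw [AnalyticSet] at this
      exact this.resolve_left (hemp n).ne_empty
    choose f hf hfA using this
    have := seqSeparable_range hf (by simpa only [hfA] using h)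
    simpa only [hfA] using this

/-- The complement of a Borel set with closed sections is a countable union of rectangles with a
Borel and a basic open side. -/
theorem exists_rectangles_of_isClosed_sections {X Y : Type*} [TopologicalSpace X] [PolishSpace X]
    [MeasurableSpace X] [BorelSpace X] [TopologicalSpace Y] [PolishSpace Y] [MeasurableSpace Y]
    [BorelSpace Y] {P : Set (X × Y)} (hP : MeasurableSet P)
    (hcl : ∀ x, IsClosed {y | (x, y) ∈ P}) :
    ∃ (C : ℕ → Set X) (V : ℕ → Set Y), (∀ n, MeasurableSet (C n)) ∧ (∀ n, IsOpen (V n)) ∧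
      Pᶜ = ⋃ n, C n ×ˢ V n := by
  obtain ⟨V, hV, hbasis⟩ :
      ∃ V : ℕ → Set Y, (∀ n, IsOpen (V n)) ∧
        ∀ (O : Set Y) (y : Y), IsOpen O → y ∈ O → ∃ n, y ∈ V n ∧ V n ⊆ O := by
    obtain ⟨b, hbc, -, hb⟩ := TopologicalSpace.exists_countable_basis Y
    have hbc' : (insert ∅ b).Countable := hbc.insert _
    obtain ⟨V, hV⟩ := hbc'.exists_eq_range (Set.insert_nonempty _ _)
    refine ⟨V, fun n => ?_, fun O y hO hy => ?_⟩
    · have : V n ∈ insert ∅ b := by rw [hV]; exact ⟨n, rfl⟩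
      rcases this with h | h
      · rw [h]; exact isOpen_empty
      · exact hb.isOpen h
    · obtain ⟨v, hv, hyv, hvO⟩ := hb.exists_subset_of_mem_open hy hO
      have : v ∈ Set.range V := by rw [← hV]; exact Or.inr hv
      obtain ⟨n, rfl⟩ := this
      exact ⟨n, hyv, hvO⟩
  -- `D n` is the set of the `x` whose section meets `V n`
  let D : ℕ → Set X := fun n => Prod.fst '' (P ∩ Prod.snd ⁻¹' V n)
  have hD : ∀ n, AnalyticSet (D n) := fun n =>
    (hP.inter ((hV n).measurableSet.preimage measurable_snd)).analyticSet.image_of_continuous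
      continuous_fst
  let A : ℕ → Set (X × Y) := fun n => n.casesOn Pᶜ fun n => D n ×ˢ Set.univ ∪ Prod.snd ⁻¹' (V n)ᶜ
  have hA : ∀ n, AnalyticSet (A n) := by
    rintro (_ | n)
    · exact hP.compl.analyticSet
    · have h1 : AnalyticSet (D n ×ˢ (Set.univ : Set Y)) := by
        rw [Set.prod_univ]
        exact (hD n).preimage continuous_fst
      have h2 : AnalyticSet (Prod.snd ⁻¹' (V n)ᶜ : Set (X × Y)) :=
        ((hV n).measurableSet.compl.preimage measurable_snd).analyticSet
      have : A (n + 1) = ⋃ b : Bool, b.casesOn (D n ×ˢ Set.univ) (Prod.snd ⁻¹' (V n)ᶜ) := by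
        ext p; simp [A, or_comm]
      rw [this]
      exact AnalyticSet.iUnion fun b => by cases b <;> assumption
  have hA0 : ⋂ n, A n = ∅ := by
    refine Set.eq_empty_of_forall_notMem fun p hp => ?_
    rw [Set.mem_iInter] at hp
    have hp0 : p ∈ Pᶜ := hp 0
    obtain ⟨n, hn, hnO⟩ := hbasis _ p.2 (hcl p.1).isOpen_compl hp0
    rcases hp (n + 1) with h | h
    · obtain ⟨q, ⟨hqP, hqV⟩, hq⟩ := h.1
      refine hnO hqV ?_
      change (p.1, q.2) ∈ P
      rw [← hq]
      exact hqP
    · exact h hn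
  obtain ⟨B, hB, hAB, hB0⟩ := seqSeparable_of_analyticSet hA hA0
  have hsep : ∀ n, MeasurablySeparable (Prod.fst '' (B (n + 1))ᶜ) (D n) := by
    intro n
    refine AnalyticSet.measurablySeparable
      ((hB (n + 1)).compl.analyticSet.image_of_continuous continuous_fst) (hD n) ?_
    rw [Set.disjoint_left]
    rintro _ ⟨p, hp, rfl⟩ hpD
    exact hp (hAB (n + 1) (Or.inl ⟨hpD, trivial⟩))
  choose C hC1 hC2 hC using hsep
  refine ⟨C, V, hC, hV, Set.Subset.antisymm ?_ ?_⟩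
  · intro p hp
    have : p ∉ ⋂ n, B n := by rw [hB0]; exact Set.notMem_empty p
    rw [Set.mem_iInter] at this
    push Not at this
    obtain ⟨n, hn⟩ := this
    cases n with
    | zero => exact absurd (hAB 0 hp) hn
    | succ n =>
      refine Set.mem_iUnion.mpr ⟨n, hC1 n ⟨p, hn, rfl⟩, ?_⟩
      by_contra hpV
      exact hn (hAB (n + 1) (Or.inr hpV))
  · rintro p hp hpP
    obtain ⟨n, hn1, hn2⟩ := Set.mem_iUnion.mp hp
    exact Set.disjoint_left.mp (hC2 n) ⟨p, ⟨hpP, hn2⟩, rfl⟩ hn1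

/-- The projection of a Borel set with compact sections is a Borel set. -/
theorem measurableSet_exists_of_isClosed_sections {X Y : Type*} [TopologicalSpace X]
    [PolishSpace X] [MeasurableSpace X] [BorelSpace X] [TopologicalSpace Y] [PolishSpace Y]
    [CompactSpace Y] [MeasurableSpace Y] [BorelSpace Y] {P : Set (X × Y)} (hP : MeasurableSet P)
    (hcl : ∀ x, IsClosed {y | (x, y) ∈ P}) : MeasurableSet {x | ∃ y, (x, y) ∈ P} := by
  obtain ⟨C, V, hC, hV, hCV⟩ := exists_rectangles_of_isClosed_sections hP hcl
  -- by compactness, a section is empty if and only if finitely many rectangles cover it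
  have : {x | ∃ y, (x, y) ∈ P}ᶜ
      = ⋃ F : Finset ℕ, ⋃ (_ : Set.univ ⊆ ⋃ n ∈ F, V n), ⋂ n ∈ F, C n := by
    ext x
    simp only [Set.mem_compl_iff, Set.mem_ofPred_eq, not_exists, Set.mem_iUnion, Set.mem_iInter,
      exists_prop]
    constructor
    · intro hx
      have hcov : Set.univ ⊆ ⋃ n : {n // x ∈ C n}, V n := by
        intro y _
        have : (x, y) ∈ Pᶜ := hx y
        rw [hCV] at this
        obtain ⟨n, hn⟩ := Set.mem_iUnion.mp this
        exact Set.mem_iUnion.mpr ⟨⟨n, hn.1⟩, hn.2⟩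
      obtain ⟨F, hF⟩ := isCompact_univ.elim_finite_subcover _ (fun n : {n // x ∈ C n} => hV n.1) hcov
      refine ⟨F.map (Function.Embedding.subtype _), fun y hy => ?_, ?_⟩
      · obtain ⟨n, hnF, hn⟩ := Set.mem_iUnion₂.mp (hF hy)
        exact Set.mem_iUnion₂.mpr ⟨n.1, Finset.mem_map_of_mem _ hnF, hn⟩
      · intro n hn
        obtain ⟨m, -, rfl⟩ := Finset.mem_map.mp hn
        exact m.2
    · rintro ⟨F, hF, hx⟩ y
      obtain ⟨n, hnF, hn⟩ := Set.mem_iUnion₂.mp (hF (Set.mem_univ y))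
      have : (x, y) ∈ Pᶜ := by
        rw [hCV]
        exact Set.mem_iUnion.mpr ⟨n, hx n hnF, hn⟩
      exact this
  rw [← MeasurableSet.compl_iff, this]
  exact MeasurableSet.iUnion fun F => MeasurableSet.iUnion fun _ =>
    Finset.measurableSet_biInter F fun n _ => hC n

/-- A Borel set in a product with the Cantor space that has closed sections contains the graph of a
Borel function, defined wherever the section is nonempty: the lexicographically least points of the
sections. -/
theorem exists_measurable_selection_cantor {X : Type*} [TopologicalSpace X] [PolishSpace X]
    [MeasurableSpace X] [BorelSpace X] {P : Set (X × (ℕ → Bool))} (hP : MeasurableSet P)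
    (hcl : ∀ x, IsClosed {y | (x, y) ∈ P}) :
    ∃ s : X → ℕ → Bool, Measurable s ∧ ∀ x, (∃ y, (x, y) ∈ P) → (x, s x) ∈ P := by
  have : PolishSpace (ℕ → Bool) := by
    have h₁ : TopologicalSpace.IsCompletelyMetrizableSpace (ℕ → Bool) := inferInstance
    have h₂ : SecondCountableTopology (ℕ → Bool) := inferInstance
    exact { h₁, h₂ with }
  -- `R (n + 1)` keeps the points of `R n` whose `n`-th coordinate is the least possible
  let next : ℕ → Set (X × (ℕ → Bool)) → Set (X × (ℕ → Bool)) := fun n R =>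
    {p ∈ R | (∃ y, (p.1, y) ∈ R ∧ y n = false) → p.2 n = false}
  let R : ℕ → Set (X × (ℕ → Bool)) := fun n => n.rec P next
  have hR : ∀ n, R (n + 1) = next n (R n) := fun n => rfl
  have hopen : ∀ n, IsClosed {y : ℕ → Bool | y n = false} := fun n =>
    isClosed_eq (continuous_apply n) continuous_const
  have main : ∀ n, MeasurableSet (R n) ∧ ∀ x, IsClosed {y | (x, y) ∈ R n} := by
    intro n
    induction n with
    | zero => exact ⟨hP, hcl⟩
    | succ n ih =>
      have hex : MeasurableSet {x | ∃ y, (x, y) ∈ R n ∧ y n = false} :=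
        measurableSet_exists_of_isClosed_sections
          (P := R n ∩ Prod.snd ⁻¹' {y : ℕ → Bool | y n = false})
          (ih.1.inter ((hopen n).measurableSet.preimage measurable_snd))
          (fun x => (ih.2 x).inter (hopen n))
      constructor
      · have : R (n + 1) = R n ∩ (Prod.fst ⁻¹' {x | ∃ y, (x, y) ∈ R n ∧ y n = false}ᶜ
            ∪ Prod.snd ⁻¹' {y : ℕ → Bool | y n = false}) := by
          ext p
          simp only [hR, next, Set.mem_ofPred_eq, Set.mem_inter_iff, Set.mem_union,
            Set.mem_preimage, Set.mem_compl_iff, imp_iff_not_or]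
        rw [this]
        exact ih.1.inter ((hex.compl.preimage measurable_fst).union
          ((hopen n).measurableSet.preimage measurable_snd))
      · intro x
        rcases em (∃ y : ℕ → Bool, (x, y) ∈ R n ∧ y n = false) with hx | hx
        · have : {y | (x, y) ∈ R (n + 1)} = {y | (x, y) ∈ R n} ∩ {y : ℕ → Bool | y n = false} := by
            ext y
            exact ⟨fun h => ⟨h.1, h.2 hx⟩, fun h => ⟨h.1, fun _ => h.2⟩⟩
          rw [this]
          exact (ih.2 x).inter (hopen n)
        · have : {y | (x, y) ∈ R (n + 1)} = {y | (x, y) ∈ R n} := by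
            ext y
            exact ⟨fun h => h.1, fun h => ⟨h, fun h' => absurd h' hx⟩⟩
          rw [this]
          exact ih.2 x
  have hex : ∀ n, MeasurableSet {x | ∃ y, (x, y) ∈ R n ∧ y n = false} := fun n =>
    measurableSet_exists_of_isClosed_sections
      (P := R n ∩ Prod.snd ⁻¹' {y : ℕ → Bool | y n = false})
      ((main n).1.inter ((hopen n).measurableSet.preimage measurable_snd))
      (fun x => ((main n).2 x).inter (hopen n))
  let N : ℕ → Set X := fun n => {x | ∃ y, (x, y) ∈ R n ∧ y n = false}
  have hdec : ∀ n, DecidablePred (· ∈ N n) := fun n => Classical.decPred _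
  let s : X → ℕ → Bool := fun x n => if x ∈ N n then false else true
  refine ⟨s, measurable_pi_lambda _ fun n => Measurable.ite (hex n) measurable_const
    measurable_const, fun x hx => ?_⟩
  have hne : ∀ n, {y | (x, y) ∈ R n}.Nonempty := by
    intro n
    induction n with
    | zero => exact hx
    | succ n ih =>
      rcases em (∃ y : ℕ → Bool, (x, y) ∈ R n ∧ y n = false) with hy | hy
      · obtain ⟨y, hyR, hyn⟩ := hy
        exact ⟨y, hyR, fun _ => hyn⟩
      · obtain ⟨y, hyR⟩ := ih
        exact ⟨y, hyR, fun h => absurd h hy⟩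
  have hanti : ∀ n, {y | (x, y) ∈ R (n + 1)} ⊆ {y | (x, y) ∈ R n} := fun n y hy => hy.1
  obtain ⟨y, hy⟩ := IsCompact.nonempty_iInter_of_sequence_nonempty_isCompact_isClosed
    (fun n => {y | (x, y) ∈ R n}) hanti hne ((main 0).2 x).isCompact (fun n => (main n).2 x)
  rw [Set.mem_iInter] at hy
  have hys : y = s x := by
    ext n
    have h1 : (x, y) ∈ R (n + 1) := hy (n + 1)
    have h2 : (x, y) ∈ R n := hy n
    rcases em (∃ y : ℕ → Bool, (x, y) ∈ R n ∧ y n = false) with hyn | hyn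
    · have h3 := h1.2 hyn
      have hN : x ∈ N n := hyn
      simp only [s, hN, if_true]
      exact h3
    · have h3 : y n ≠ false := fun h => hyn ⟨y, h2, h⟩
      have hN : x ∉ N n := hyn
      simp only [s, hN, if_false]
      simpa using h3
  rw [← hys]
  exact hy 0

/-- A Borel set in a product with a compact metric space that has compact sections contains the
graph of a Borel function, defined wherever the section is nonempty. -/
theorem exists_measurable_selection {X Y : Type*} [TopologicalSpace X] [PolishSpace X]
    [MeasurableSpace X] [BorelSpace X] [MetricSpace Y] [CompactSpace Y] [Nonempty Y]
    [MeasurableSpace Y] [BorelSpace Y] {P : Set (X × Y)} (hP : MeasurableSet P)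
    (hcl : ∀ x, IsClosed {y | (x, y) ∈ P}) :
    ∃ s : X → Y, Measurable s ∧ ∀ x, (∃ y, (x, y) ∈ P) → (x, s x) ∈ P := by
  obtain ⟨g, hg, hgs⟩ := exists_nat_bool_continuous_surjective_of_compact Y
  obtain ⟨s, hs, hsP⟩ := exists_measurable_selection_cantor (P := Prod.map id g ⁻¹' P)
    (hP.preimage (measurable_id.prodMap hg.measurable)) (fun x => (hcl x).preimage hg)
  refine ⟨fun x => g (s x), hg.measurable.comp hs, fun x ⟨y, hy⟩ => ?_⟩
  obtain ⟨c, rfl⟩ := hgs y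
  exact hsP x ⟨c, hy⟩

/-! ### Lebesgue measure on the half-line -/

theorem leb_map_coe : leb.map ((↑) : ℝ≥0 → ℝ) = volume.restrict (Set.Ici (0 : ℝ)) := by
  rw [leb, Measure.map_map measurable_coe_nnreal_real measurable_real_toNNReal]
  refine (Measure.map_congr (g := id) ?_).trans Measure.map_id
  filter_upwards [ae_restrict_mem measurableSet_Ici] with x hx
  exact Real.coe_toNNReal x hx

theorem ae_leb_of_ae_volume {p : ℝ → Prop} (h : ∀ᵐ t, p t) : ∀ᵐ t : ℝ≥0 ∂leb, p t := by
  refine ae_of_ae_map measurable_coe_nnreal_real.aemeasurable ?_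
  rw [leb_map_coe]
  exact ae_restrict_of_ae h

theorem leb_map_add (t : ℝ≥0) : leb.map (fun s => t + s) = leb.restrict (Set.Ici t) := by
  ext A hA
  have hm : Measurable fun s : ℝ≥0 => t + s := by fun_prop
  rw [Measure.map_apply hm hA, Measure.restrict_apply hA, leb,
    Measure.map_apply measurable_real_toNNReal (hm hA),
    Measure.map_apply measurable_real_toNNReal (hA.inter measurableSet_Ici),
    Measure.restrict_apply (measurable_real_toNNReal (hm hA)),
    Measure.restrict_apply (measurable_real_toNNReal (hA.inter measurableSet_Ici)),
    ← measure_preimage_add_right volume (t : ℝ) (Real.toNNReal ⁻¹' (A ∩ Set.Ici t) ∩ Set.Ici 0)]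
  congr 1
  ext y
  have ht : (0 : ℝ) ≤ t := t.2
  simp only [Set.mem_inter_iff, Set.mem_preimage, Set.mem_Ici]
  constructor
  · rintro ⟨h1, h2⟩
    have : (y + t).toNNReal = t + y.toNNReal := by
      rw [Real.toNNReal_add h2 ht, Real.toNNReal_coe, add_comm]
    rw [this]
    exact ⟨⟨h1, le_self_add⟩, by linarith⟩
  · rintro ⟨⟨h1, h2⟩, h3⟩
    have hy : 0 ≤ y := by
      have := (NNReal.coe_le_coe.mpr h2)
      rw [Real.coe_toNNReal _ h3] at this
      linarith
    rw [Real.toNNReal_add hy ht, Real.toNNReal_coe, add_comm] at h1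
    exact ⟨h1, hy⟩

theorem setIntegral_leb_before (t : ℝ≥0) {F : ℝ≥0 → ℝ} (hF : Measurable F) :
    ∫ s in before t, F s ∂leb = ∫ s in (0 : ℝ)..t, F s.toNNReal := by
  rw [leb, setIntegral_map (measurableSet_before t) hF.aestronglyMeasurable
    measurable_real_toNNReal.aemeasurable, Measure.restrict_restrict
    (measurable_real_toNNReal (measurableSet_before t)), intervalIntegral.integral_of_le (show (0 : ℝ) ≤ t from t.2),
    ← integral_Ico_eq_integral_Ioc]
  congr 2
  ext x
  simp only [before, Set.mem_inter_iff, Set.mem_preimage, Set.mem_ofPred_eq,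
    ENNReal.coe_lt_coe, Set.mem_Ici, Set.mem_Ico]
  constructor
  · rintro ⟨h1, h2⟩
    exact ⟨h2, (Real.toNNReal_lt_iff_lt_coe h2).mp h1⟩
  · rintro ⟨h1, h2⟩
    exact ⟨(Real.toNNReal_lt_iff_lt_coe h1).mpr h2, h1⟩

/-! ### Jointly measurable versions of measurable families of controls -/

section Versions

variable {𝕌 : Type*} [MetricSpace 𝕌] [CompactSpace 𝕌] [MeasurableSpace 𝕌] [BorelSpace 𝕌]

theorem measurable_setIntegral_control {𝕌 : Type*} [TopologicalSpace 𝕌] [CompactSpace 𝕌]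
    [MeasurableSpace 𝕌] (ψ : C(𝕌, ℝ)) (t : ℝ≥0) :
    Measurable fun ν : OrdControl 𝕌 => ∫ s in before t, ψ (ν s) ∂leb := by
  have : OpensMeasurableSpace (OrdControl 𝕌) := ⟨le_rfl⟩
  have hg : Integrable (fun s => (before (t : ℝ≥0∞)).indicator (fun _ => (1 : ℝ)) s • ψ) leb := by
    refine Integrable.smul_const ?_ ψ
    rw [integrable_indicator_iff (measurableSet_before _)]
    exact integrableOn_const (by rw [leb_before]; exact ENNReal.coe_ne_top)
  have hc : Continuous fun ν : OrdControl 𝕌 =>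
      ∫ s, ((before (t : ℝ≥0∞)).indicator (fun _ => (1 : ℝ)) s • ψ) (ν s) ∂leb :=
    continuous_iInf_dom (i := (⟨_, hg⟩ : {g : ℝ≥0 → C(𝕌, ℝ) // Integrable g leb}))
      continuous_induced_dom
  convert hc.measurable using 2 with ν
  rw [← integral_indicator (measurableSet_before _)]
  refine integral_congr_ae (Eventually.of_forall fun s => ?_)
  by_cases hs : s ∈ before (t : ℝ≥0∞)
  · simp [hs]
  · simp [hs]

/-- The derivative of the indefinite integral of `t ↦ ψ (γ x t)`, as a limit of difference
quotients, is jointly measurable; by Lebesgue's differentiation theorem it is `ψ (γ x t)` for almost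
every `t`. -/
theorem exists_measurable_version_comp {X : Type*} [MeasurableSpace X] {γ : X → OrdControl 𝕌}
    (hγ : Measurable γ) (ψ : C(𝕌, ℝ)) :
    ∃ F : X × ℝ≥0 → ℝ, Measurable F ∧ ∀ x, ∀ᵐ t ∂leb, F (x, t) = ψ (γ x t) := by
  have hmeas : ∀ x, Measurable fun t : ℝ≥0 => ψ (γ x t) := fun x =>
    ψ.continuous.measurable.comp (γ x).measurable_toFun
  have hloc : ∀ x, LocallyIntegrable (fun t : ℝ => ψ (γ x t.toNNReal)) volume := fun x => by
    refine (locallyIntegrable_const ‖ψ‖).mono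
      ((hmeas x).comp measurable_real_toNNReal).aestronglyMeasurable
      (Eventually.of_forall fun t => ?_)
    rw [norm_norm]
    exact ψ.norm_coe_le_norm _
  let J : ℝ≥0 → X → ℝ := fun t x => ∫ s in before t, ψ (γ x s) ∂leb
  have hJ : ∀ t x, J t x = ∫ s in (0 : ℝ)..t, ψ (γ x s.toNNReal) := fun t x =>
    setIntegral_leb_before t (hmeas x)
  have hJm : Measurable (Function.uncurry J) := by
    refine measurable_uncurry_of_continuous_of_measurable (fun x => ?_) fun t =>
      (measurable_setIntegral_control ψ t).comp hγ
    simp only [hJ]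
    refine (intervalIntegral.continuous_primitive (fun a b => ?_) 0).comp NNReal.continuous_coe
    exact intervalIntegrable_iff.mpr
      (((hloc x).integrableOn_isCompact isCompact_uIcc).mono_set Set.uIoc_subset_uIcc)
  let δ : ℕ → ℝ≥0 := fun n => 1 / ((n : ℝ≥0) + 1)
  let D : ℕ → X × ℝ≥0 → ℝ := fun n p => ((δ n : ℝ))⁻¹ * (J (p.2 + δ n) p.1 - J p.2 p.1)
  have hD : ∀ n, Measurable (D n) := fun n => by
    refine Measurable.const_mul (Measurable.sub ?_ ?_) _
    · exact hJm.comp ((measurable_snd.add_const _).prodMk measurable_fst)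
    · exact hJm.comp (measurable_snd.prodMk measurable_fst)
  refine ⟨fun p => limsup (fun n => D n p) atTop, Measurable.limsup hD, fun x => ?_⟩
  filter_upwards [ae_leb_of_ae_volume (LocallyIntegrable.ae_hasDerivAt_integral (hloc x))] with t ht
  have h := (ht 0).tendsto_slope_zero_right
  have hδ : Tendsto (fun n => (δ n : ℝ)) atTop (𝓝[>] 0) := by
    refine tendsto_nhdsWithin_iff.mpr ⟨?_, Eventually.of_forall fun n => ?_⟩
    · have := tendsto_one_div_add_atTop_nhds_zero_nat (𝕜 := ℝ)
      simpa [δ] using this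
    · change (0 : ℝ) < ((1 / ((n : ℝ≥0) + 1) : ℝ≥0) : ℝ)
      positivity
  have hlim := h.comp hδ
  rw [Real.toNNReal_coe] at hlim
  refine Tendsto.limsup_eq ?_
  refine hlim.congr fun n => ?_
  simp only [D, hJ, Function.comp, smul_eq_mul, NNReal.coe_add]

/-- A family of controls that is measurable for the Borel `σ`-algebra of `OrdControl 𝕌` has a
jointly measurable version: the distances to the points of a dense sequence have one. -/
theorem exists_measurable_version [Nonempty 𝕌] {X : Type*} [MeasurableSpace X]
    {γ : X → OrdControl 𝕌} (hγ : Measurable γ) :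
    ∃ v : X × ℝ≥0 → 𝕌, Measurable v ∧ ∀ x, ∀ᵐ t ∂leb, v (x, t) = γ x t := by
  have : SecondCountableTopology 𝕌 := inferInstance
  let a : ℕ → 𝕌 := TopologicalSpace.denseSeq 𝕌
  let ψ : ℕ → C(𝕌, ℝ) := fun j => ⟨fun y => dist y (a j), by fun_prop⟩
  choose F hF hFψ using fun j => exists_measurable_version_comp hγ (ψ j)
  let e : 𝕌 → ℕ → ℝ := fun y j => ψ j y
  have he : Continuous e := continuous_pi fun j => (ψ j).continuous
  have hinj : Function.Injective e := by
    intro y z hyz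
    have h : (fun b => dist y b) = fun b => dist z b := by
      refine (TopologicalSpace.denseRange_denseSeq 𝕌).equalizer (by fun_prop) (by fun_prop) ?_
      ext j
      exact congrFun hyz j
    have h' := congrFun h z
    rw [dist_self] at h'
    exact dist_eq_zero.mp h'
  obtain ⟨g, hg, hge⟩ := (he.isClosedEmbedding hinj).measurableEmbedding.exists_measurable_extend
    measurable_id fun _ => inferInstance
  refine ⟨fun p => g fun j => F j p, hg.comp (measurable_pi_lambda _ hF), fun x => ?_⟩
  filter_upwards [ae_all_iff.mpr fun j => hFψ j x] with t ht
  have : (fun j => F j (x, t)) = e (γ x t) := funext ht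
  rw [this]
  exact congrFun hge _

end Versions

/-! ### The stationary policy built from a selector -/

namespace Model

variable {d : ℕ} {𝕌 : Type*} [MetricSpace 𝕌] [CompactSpace 𝕌] [MeasurableSpace 𝕌] [BorelSpace 𝕌]

/-- The feasible actions have a Borel selection. -/
theorem exists_measurable_selection_act [Nonempty 𝕌] (M : Model d 𝕌) :
    ∃ s : Space d → 𝕌, Measurable s ∧
      ∀ y ∈ closure M.E, (M.act y).Nonempty → s y ∈ M.act y := by
  obtain ⟨s, hs, h⟩ := exists_measurable_selection M.measurableSet_graph fun y => by
    by_cases hy : y ∈ closure M.E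
    · simpa [hy] using (M.isCompact_act y hy).isClosed
    · simp [hy]
  exact ⟨s, hs, fun y hy ⟨b, hb⟩ => (h y ⟨b, hy, hb⟩).2⟩

/-- A measurable selector induces a stationary policy. On the null set of times at which the jointly
measurable version of the selector is not feasible, a Borel selection of the feasible actions is
used instead. -/
theorem exists_policy_isInducedBy (M : Model d 𝕌) {Γ : M.E → OrdControl 𝕌 × 𝕌}
    (hΓ_meas : Measurable Γ) (hΓ_mem : ∀ x : M.E, Γ x ∈ M.V x) :
    ∃ U : M.Policy, U.IsInducedBy Γ ∧ ∀ n, U.u n = U.u 0 := by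
  rcases isEmpty_or_nonempty M.E with hE | ⟨⟨x₀⟩⟩
  · refine ⟨⟨fun _ x => hE.elim x, measurable_of_empty _, fun _ x => hE.elim x,
      fun _ x => hE.elim x, measurable_of_empty _, fun _ x => hE.elim x⟩, fun _ x => hE.elim x, fun _ => rfl⟩
  have : Nonempty 𝕌 := ⟨(Γ x₀).2⟩
  obtain ⟨v, hv, hvΓ⟩ := exists_measurable_version (measurable_fst.comp hΓ_meas)
  obtain ⟨s, hs, hs_mem⟩ := M.exists_measurable_selection_act
  have hφ : Measurable fun p : M.E × ℝ≥0 => M.φ p.1 p.2 :=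
    M.continuous_φ.measurable.comp ((measurable_subtype_coe.comp measurable_fst).prodMk measurable_snd)
  let good : Set (M.E × ℝ≥0) :=
    {p | M.φ p.1 p.2 ∈ closure M.E ∧ v p ∈ M.act (M.φ p.1 p.2)} ∪
      {p | M.φ p.1 p.2 ∈ (closure M.E)ᶜ}
  have hgood : MeasurableSet good :=
    (M.measurableSet_graph.preimage (hφ.prodMk hv)).union
      (isClosed_closure.measurableSet.compl.preimage hφ)
  classical
  let w : M.E × ℝ≥0 → 𝕌 := fun p => if p ∈ good then v p else s (M.φ p.1 p.2)
  have hw : Measurable w := Measurable.ite hgood hv (hs.comp hφ)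
  refine ⟨⟨fun _ x t => w (x, t), hw.comp measurable_snd, fun n x t ht => ?_, fun _ x => (Γ x).2,
    (measurable_snd.comp hΓ_meas).comp measurable_snd, fun _ x => (hΓ_mem x).2⟩, fun n x => ⟨rfl, ?_⟩,
    fun _ => rfl⟩
  · by_cases hp : (x, t) ∈ good
    · simp only [w, hp, if_true]
      exact hp.elim (fun h => h.2) fun h => absurd ht h
    · simp only [w, hp, if_false]
      exact hs_mem _ ht ⟨_, (hΓ_mem x).1 t ht⟩
  · filter_upwards [hvΓ x] with t ht
    have hp : (x, t) ∈ good := by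
      by_cases hc : M.φ x t ∈ closure M.E
      · refine Or.inl ⟨hc, ?_⟩
        rw [ht]
        exact (hΓ_mem x).1 t hc
      · exact Or.inr hc
    simp only [w, hp, if_true]
    exact ht

theorem exists_policy_eq {𝕌 : Type*} [TopologicalSpace 𝕌] [CompactSpace 𝕌] [MeasurableSpace 𝕌]
    (M : Model d 𝕌) {Γ : M.E → OrdControl 𝕌 × 𝕌}
    (hΓ_meas : Measurable Γ) (hΓ_mem : ∀ x : M.E, Γ x ∈ M.V x)
    (hjoint : Measurable fun p : M.E × ℝ≥0 => (Γ p.1).1 p.2) :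
    ∃ U : M.Policy, ∀ n x, U.ub n x = (Γ x).2 ∧ ∀ t, U.u n x t = (Γ x).1 t :=
  ⟨⟨fun _ x t => (Γ x).1 t, hjoint.comp measurable_snd, fun _ x => (hΓ_mem x).1, fun _ x => (Γ x).2,
    (measurable_snd.comp hΓ_meas).comp measurable_snd, fun _ x => (hΓ_mem x).2⟩,
    fun _ _ => ⟨rfl, fun _ => rfl⟩⟩

end Model

/-! ### The one-stage functionals over a finite horizon -/

theorem expNeg_add (a b : ℝ≥0∞) : expNeg (a + b) = expNeg a * expNeg b := by
  induction a with
  | top => simp [expNeg]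
  | coe a =>
    induction b with
    | top => simp [expNeg]
    | coe b =>
      rw [← ENNReal.coe_add, expNeg_coe, expNeg_coe, expNeg_coe,
        ← ENNReal.ofReal_mul (Real.exp_pos _).le, ← Real.exp_add, NNReal.coe_add, neg_add]

theorem expNeg_le_one (a : ℝ≥0∞) : expNeg a ≤ 1 := by
  induction a with
  | top => simp [expNeg]
  | coe a =>
    rw [expNeg_coe, ← ENNReal.ofReal_one]
    exact ENNReal.ofReal_le_ofReal (Real.exp_le_one_iff.mpr (neg_nonpos.mpr a.2))

theorem expNeg_ne_top (a : ℝ≥0∞) : expNeg a ≠ ∞ :=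
  ((expNeg_le_one a).trans_lt ENNReal.one_lt_top).ne

theorem setLIntegral_before_add (t : ℝ≥0) (τ : ℝ≥0∞) (F : ℝ≥0 → ℝ≥0∞) :
    ∫⁻ s in before (t + τ), F s ∂leb
      = ∫⁻ s in before t, F s ∂leb + ∫⁻ s in before τ, F (t + s) ∂leb := by
  have hunion : before (t + τ) = before t ∪ (before (t + τ) ∩ Set.Ici t) := by
    ext s
    simp only [before, Set.mem_ofPred_eq, Set.mem_union, Set.mem_inter_iff, Set.mem_Ici,
      ENNReal.coe_lt_coe]
    constructor
    · intro h
      exact (lt_or_ge s t).imp id fun h' => ⟨h, h'⟩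
    · rintro (h | h)
      · exact (ENNReal.coe_lt_coe.mpr h).trans_le le_self_add
      · exact h.1
  have hdisj : Disjoint (before t) (before (t + τ) ∩ Set.Ici t) := by
    rw [Set.disjoint_left]
    rintro s hs ⟨-, hs'⟩
    exact absurd (ENNReal.coe_lt_coe.mp hs) (not_lt.mpr hs')
  have hemb : MeasurableEmbedding fun s : ℝ≥0 => t + s :=
    (by fun_prop : Continuous fun s : ℝ≥0 => t + s).measurableEmbedding (add_right_injective t)
  have hpre : (fun s : ℝ≥0 => t + s) ⁻¹' before (t + τ) = before τ := by
    ext s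
    simp only [before, Set.mem_preimage, Set.mem_ofPred_eq, ENNReal.coe_add]
    exact ENNReal.add_lt_add_iff_left ENNReal.coe_ne_top
  rw [hunion, lintegral_union ((measurableSet_before _).inter measurableSet_Ici) hdisj,
    ← Measure.restrict_restrict (measurableSet_before _), ← leb_map_add, hemb.restrict_map,
    hemb.lintegral_map, hpre]

namespace Model

variable {d : ℕ} {𝕌 : Type*} [TopologicalSpace 𝕌] [MeasurableSpace 𝕌]

theorem tstar_eq_add (M : Model d 𝕌) {x : Space d} {t : ℝ≥0} (ht : (t : ℝ≥0∞) < M.tstar x) :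
    M.tstar x = t + M.tstar (M.φ x t) := by
  refine le_antisymm ?_ ?_
  · rw [tstar, tstar, exitTime, exitTime, ENNReal.add_iInf]
    refine le_iInf fun s => ?_
    by_cases hs : 0 < s ∧ M.φ (M.φ x t) s ∈ frontier M.E
    swap
    · rw [iInf_neg hs, add_top]
      exact le_top
    · rw [iInf_pos hs]
      rw [← M.φ_add] at hs
      rw [← ENNReal.coe_add]
      exact iInf₂_le (t + s) ⟨add_pos_of_nonneg_of_pos zero_le hs.1, hs.2⟩
  · refine le_iInf₂ fun s hs => ?_
    have hts : (t : ℝ≥0∞) < s := ht.trans_le (iInf₂_le s hs)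
    have hts' : t < s := ENNReal.coe_lt_coe.mp hts
    have hadd : t + (s - t) = s := add_tsub_cancel_of_le hts'.le
    have : M.tstar (M.φ x t) ≤ ((s - t : ℝ≥0) : ℝ≥0∞) := by
      refine iInf₂_le (s - t) ⟨tsub_pos_of_lt hts', ?_⟩
      rw [← M.φ_add, hadd]
      exact hs.2
    calc (t : ℝ≥0∞) + M.tstar (M.φ x t) ≤ t + ((s - t : ℝ≥0) : ℝ≥0∞) := by gcongr
      _ = s := by rw [← ENNReal.coe_add, hadd]

theorem exitPoint_flow (M : Model d 𝕌) {x : Space d} {t : ℝ≥0} (ht : (t : ℝ≥0∞) < M.tstar x) :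
    M.exitPoint (M.φ x t) = M.exitPoint x := by
  have h := M.tstar_eq_add ht
  unfold exitPoint
  by_cases htop : M.tstar (M.φ x t) = ∞
  · have : M.tstar x = ∞ := by rw [h, htop, add_top]
    rw [if_pos htop, if_pos this]
  · have : M.tstar x ≠ ∞ := by rw [h]; exact ENNReal.add_ne_top.mpr ⟨ENNReal.coe_ne_top, htop⟩
    rw [if_neg htop, if_neg this, h, ENNReal.toNNReal_add ENNReal.coe_ne_top htop,
      ENNReal.toNNReal_coe, M.φ_add]

theorem flow_tstar_mem_frontier (M : Model d 𝕌) {x : Space d} (hx : x ∈ M.E)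
    (h : M.tstar x ≠ ∞) : M.φ x (M.tstar x).toNNReal ∈ frontier M.E := by
  let S : Set ℝ≥0 := {t | M.φ x t ∈ frontier M.E}
  have hS : IsClosed S := isClosed_frontier.preimage
    (M.continuous_φ.comp (continuous_const.prodMk continuous_id))
  have hpos : ∀ t ∈ S, 0 < t := by
    intro t ht
    rcases eq_or_lt_of_le (zero_le : 0 ≤ t) with h0 | h0
    · have ht' : M.φ x t ∈ frontier M.E := ht
      rw [← h0, M.φ_zero, frontier, M.isOpen_E.interior_eq] at ht'
      exact absurd hx ht'.2
    · exact h0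
  have hne : S.Nonempty := by
    by_contra hne
    refine h (iInf₂_eq_top.mpr fun t ht => absurd ⟨t, ht.2⟩ hne)
  have heq : M.tstar x = ((sInf S : ℝ≥0) : ℝ≥0∞) := by
    rw [ENNReal.coe_sInf hne]
    refine iInf_congr fun t => ?_
    refine iInf_congr_Prop ⟨fun ht => ht.2, fun ht => ⟨hpos t ht, ht⟩⟩ fun _ => rfl
  rw [heq, ENNReal.toNNReal_coe]
  exact hS.csInf_mem hne (OrderBot.bddBelow S)

theorem tstar_pos (M : Model d 𝕌) {x : Space d} (hx : x ∈ M.E) : 0 < M.tstar x := by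
  by_contra h
  have h0 : M.tstar x = 0 := le_antisymm (not_lt.mp h) zero_le
  have hf := M.flow_tstar_mem_frontier hx (by rw [h0]; exact ENNReal.zero_ne_top)
  rw [h0, ENNReal.toNNReal_zero, M.φ_zero, frontier, M.isOpen_E.interior_eq] at hf
  exact hf.2 hx

theorem measurable_flow (M : Model d 𝕌) (x : Space d) : Measurable (M.φ x) :=
  (M.continuous_φ.comp (continuous_const.prodMk continuous_id)).measurable

theorem cumRate_add (M : Model d 𝕌) (x : Space d) (ν : ℝ≥0 → 𝕌) (t : ℝ≥0) (τ : ℝ≥0∞) :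
    M.cumRate x ν (t + τ) = M.cumRate x ν t + M.cumRate (M.φ x t) (fun s => ν (t + s)) τ := by
  unfold cumRate
  rw [setLIntegral_before_add]
  simp only [M.φ_add]

theorem cumRate_mono (M : Model d 𝕌) (x : Space d) (ν : ℝ≥0 → 𝕌) : Monotone (M.cumRate x ν) :=
  fun _ _ hab => lintegral_mono_set fun _ hs => lt_of_lt_of_le hs hab

theorem measurable_expNeg_cumRate (M : Model d 𝕌) (x : Space d) (ν : ℝ≥0 → 𝕌) :
    Measurable fun s : ℝ≥0 => expNeg (M.cumRate x ν s) :=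
  measurable_expNeg.comp ((M.cumRate_mono x ν).measurable.comp measurable_coe_nnreal_ennreal)

theorem cumRate_congr (M : Model d 𝕌) (x : Space d) {ν ν' : ℝ≥0 → 𝕌} {τ : ℝ≥0∞}
    (h : ∀ᵐ s : ℝ≥0 ∂leb, (s : ℝ≥0∞) < τ → ν s = ν' s) : M.cumRate x ν τ = M.cumRate x ν' τ := by
  refine setLIntegral_congr_fun_ae (measurableSet_before τ) ?_
  filter_upwards [h] with s hs hsτ
  rw [hs hsτ]

/-- `∫_0^τ e^{-Λ^ν(x,s)} w(φ(x,s), ν(s)) ds`: the expectation of the integral of `w` along the flow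
up to the first jump or the time `τ`, when `τ ≤ t_*(x)`. -/
noncomputable def stage (M : Model d 𝕌) (w : Space d × 𝕌 → ℝ≥0∞) (x : Space d) (ν : ℝ≥0 → 𝕌)
    (τ : ℝ≥0∞) : ℝ≥0∞ :=
  ∫⁻ s in before τ, expNeg (M.cumRate x ν s) * w (M.φ x s, ν s) ∂leb

theorem stage_add (M : Model d 𝕌) (w : Space d × 𝕌 → ℝ≥0∞) (x : Space d) (ν : ℝ≥0 → 𝕌) (t : ℝ≥0)
    (τ : ℝ≥0∞) : M.stage w x ν (t + τ) = M.stage w x ν t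
      + expNeg (M.cumRate x ν t) * M.stage w (M.φ x t) (fun s => ν (t + s)) τ := by
  unfold stage
  rw [setLIntegral_before_add, ← lintegral_const_mul' _ _ (expNeg_ne_top _)]
  congr 1
  refine lintegral_congr fun s => ?_
  rw [ENNReal.coe_add, cumRate_add, expNeg_add, M.φ_add, mul_assoc]

theorem stage_congr (M : Model d 𝕌) (w : Space d × 𝕌 → ℝ≥0∞) (x : Space d) {ν ν' : ℝ≥0 → 𝕌}
    {τ : ℝ≥0∞} (h : ∀ᵐ s : ℝ≥0 ∂leb, (s : ℝ≥0∞) < τ → ν s = ν' s) :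
    M.stage w x ν τ = M.stage w x ν' τ := by
  refine setLIntegral_congr_fun_ae (measurableSet_before τ) ?_
  filter_upwards [h] with s hs hsτ
  rw [hs hsτ, M.cumRate_congr x (τ := s)]
  filter_upwards [h] with s' hs' hlt
  exact hs' (hlt.trans hsτ)

theorem stage_fun_add (M : Model d 𝕌) {w : Space d × 𝕌 → ℝ≥0∞} (hw : Measurable w)
    (w' : Space d × 𝕌 → ℝ≥0∞) (x : Space d) {ν : ℝ≥0 → 𝕌} (hν : Measurable ν) (τ : ℝ≥0∞) :
    M.stage (fun p => w p + w' p) x ν τ = M.stage w x ν τ + M.stage w' x ν τ := by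
  unfold stage
  rw [← lintegral_add_left]
  · simp only [mul_add]
  · exact (M.measurable_expNeg_cumRate x ν).mul (hw.comp ((M.measurable_flow x).prodMk hν))

/-- The running cost, together with the rate of jumping times the expectation of `k` after the
jump. -/
noncomputable def runGain (M : Model d 𝕌) (k : Space d → ℝ≥0∞) (p : Space d × 𝕌) : ℝ≥0∞ :=
  M.f p + M.lam p * ∫⁻ z, k z ∂(M.Q p)

/-- The boundary cost, together with the expectation of `k` after a jump from the boundary. -/
noncomputable def exitGain (M : Model d 𝕌) (k : Space d → ℝ≥0∞) (p : Space d × 𝕌) : ℝ≥0∞ :=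
  M.r p + ∫⁻ z, k z ∂(M.Q p)

/-- `Lf(x,Υ) + Hr(x,Υ) + Gk(x,Υ)`, for `k ≥ 0`. -/
noncomputable def stageValue (M : Model d 𝕌) (k : Space d → ℝ≥0∞) (x : Space d)
    (Υ : OrdControl 𝕌 × 𝕌) : ℝ≥0∞ :=
  M.stage (M.runGain k) x Υ.1 (M.tstar x)
    + expNeg (M.cumRate x Υ.1 (M.tstar x)) * M.exitGain k (M.exitPoint x, Υ.2)

theorem calL_eq_stage (M : Model d 𝕌) (x : Space d) (Υ : OrdControl 𝕌 × 𝕌) :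
    M.calL x Υ = M.stage 1 x Υ.1 (M.tstar x) := by
  simp [calL, stage]

theorem measurable_lintegral_Q (M : Model d 𝕌) {k : Space d → ℝ≥0∞} (hk : Measurable k) :
    Measurable fun p : Space d × 𝕌 => ∫⁻ z, k z ∂(M.Q p) :=
  (hk.comp measurable_subtype_coe).lintegral_kernel

theorem opG_eq_stage (M : Model d 𝕌) (k : Space d → ℝ≥0∞) (x : Space d) (Υ : OrdControl 𝕌 × 𝕌) :
    M.opG k x Υ = M.stage (fun p => M.lam p * ∫⁻ z, k z ∂(M.Q p)) x Υ.1 (M.tstar x)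
      + expNeg (M.cumRate x Υ.1 (M.tstar x)) * ∫⁻ z, k z ∂(M.Q (M.exitPoint x, Υ.2)) := rfl

theorem opL_add_opH_add_opG (M : Model d 𝕌) (k : Space d → ℝ≥0∞) (x : Space d)
    (Υ : OrdControl 𝕌 × 𝕌) :
    M.opL M.f x Υ + M.opH M.r x Υ + M.opG k x Υ = M.stageValue k x Υ := by
  have hf : Measurable fun p : Space d × 𝕌 => (M.f p : ℝ≥0∞) := M.measurable_f.coe_nnreal_ennreal
  have h := M.stage_fun_add hf (fun p => M.lam p * ∫⁻ z, k z ∂(M.Q p)) x Υ.1.measurable_toFun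
    (M.tstar x)
  have hL : M.opL M.f x Υ = M.stage (fun p => (M.f p : ℝ≥0∞)) x Υ.1 (M.tstar x) := rfl
  rw [stageValue, exitGain, opG_eq_stage, hL, opH, mul_add]
  unfold runGain
  rw [h]
  ring

theorem opG_add (M : Model d 𝕌) {k : Space d → ℝ≥0∞} (hk : Measurable k) (k' : Space d → ℝ≥0∞)
    (x : Space d) (Υ : OrdControl 𝕌 × 𝕌) :
    M.opG (fun y => k y + k' y) x Υ = M.opG k x Υ + M.opG k' x Υ := by
  have hQ : ∀ p, ∫⁻ z, (k z + k' z) ∂(M.Q p) = ∫⁻ z, k z ∂(M.Q p) + ∫⁻ z, k' z ∂(M.Q p) := fun p =>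
    lintegral_add_left (hk.comp measurable_subtype_coe) _
  have hm : Measurable fun p : Space d × 𝕌 => (M.lam p : ℝ≥0∞) * ∫⁻ z, k z ∂(M.Q p) :=
    M.measurable_lam.coe_nnreal_ennreal.mul (M.measurable_lintegral_Q hk)
  simp only [opG_eq_stage, hQ, mul_add]
  rw [M.stage_fun_add hm _ x Υ.1.measurable_toFun]
  ring

theorem cumRate_lt_top_of_mem (M : Model d 𝕌) {x : Space d} (hx : x ∈ M.E)
    {Υ : OrdControl 𝕌 × 𝕌} (hΥ : Υ ∈ M.V x) (t : ℝ≥0) (ht : (t : ℝ≥0∞) ≤ M.tstar x) :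
    M.cumRate x Υ.1 t < ∞ := by
  refine lt_of_le_of_lt ?_ (M.rate_lt_top x hx t ht)
  have : before (t : ℝ≥0∞) = {s : ℝ≥0 | s < t} := by ext s; simp [before]
  rw [cumRate, this]
  refine setLIntegral_mono' measurableSet_Iio fun s hs => ?_
  have hE : M.φ x s ∈ M.E :=
    M.flow_mem hx (lt_of_lt_of_le (ENNReal.coe_lt_coe.mpr hs) ht)
  exact le_iSup₂ (f := fun a (_ : a ∈ M.act (M.φ x s)) => (M.lam (M.φ x s, a) : ℝ≥0∞))
    (Υ.1 s) (hΥ.1 s (subset_closure hE))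

/-- The law of the sojourn time has total mass one, at every horizon up to `t_*(x)`. -/
theorem stage_lam_add_expNeg (M : Model d 𝕌) {x : Space d} (hx : x ∈ M.E)
    {Υ : OrdControl 𝕌 × 𝕌} (hΥ : Υ ∈ M.V x) {τ : ℝ≥0∞} (hτ : τ ≤ M.tstar x) :
    M.stage (fun p => (M.lam p : ℝ≥0∞)) x Υ.1 τ + expNeg (M.cumRate x Υ.1 τ) = 1 := by
  have hl : Measurable fun s : ℝ≥0 => (M.lam (M.φ x s, Υ.1 s) : ℝ≥0∞) :=
    (M.measurable_lam.comp ((M.measurable_flow x).prodMk Υ.1.measurable_toFun)).coe_nnreal_ennreal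
  set m : Measure ℝ≥0 := leb.withDensity fun s => (M.lam (M.φ x s, Υ.1 s) : ℝ≥0∞) with hm
  have hcm : ∀ t, M.cumRate x Υ.1 t = m (before t) := fun t => by
    rw [hm, withDensity_apply _ (measurableSet_before t), cumRate]
  rw [hcm, ← lintegral_expNeg_add m τ fun t ht => by
    rw [← hcm]; exact M.cumRate_lt_top_of_mem hx hΥ t (ht.trans hτ)]
  congr 1
  rw [hm, restrict_withDensity (measurableSet_before _),
    lintegral_withDensity_eq_lintegral_mul _ hl, stage]
  · exact lintegral_congr fun s => by rw [Pi.mul_apply, ← hm, ← hcm, mul_comm]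
  · simpa only [← hm, ← hcm] using M.measurable_expNeg_cumRate x Υ.1

theorem opG_const (M : Model d 𝕌) {x : Space d} (hx : x ∈ M.E) {Υ : OrdControl 𝕌 × 𝕌}
    (hΥ : Υ ∈ M.V x) (c : ℝ≥0) : M.opG (fun _ => c) x Υ = c := by
  have := M.markov_Q
  have h := M.stage_lam_add_expNeg hx hΥ le_rfl
  have hQ : ∀ p, ∫⁻ _, (c : ℝ≥0∞) ∂(M.Q p) = c := fun p => by simp
  have hs : M.stage (fun p => (M.lam p : ℝ≥0∞) * c) x Υ.1 (M.tstar x)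
      = M.stage (fun p => (M.lam p : ℝ≥0∞)) x Υ.1 (M.tstar x) * c := by
    unfold stage
    rw [← lintegral_mul_const' _ _ ENNReal.coe_ne_top]
    simp only [mul_assoc]
  rw [opG_eq_stage]
  simp only [hQ]
  rw [hs, ← add_mul, h, one_mul]

theorem opG_mono (M : Model d 𝕌) {k k' : Space d → ℝ≥0∞} (h : ∀ x ∈ M.E, k x ≤ k' x)
    (x : Space d) (Υ : OrdControl 𝕌 × 𝕌) : M.opG k x Υ ≤ M.opG k' x Υ := by
  unfold opG
  gcongr <;> exact h _ (Subtype.coe_prop _)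

theorem opG_congr (M : Model d 𝕌) {k k' : Space d → ℝ≥0∞} (h : ∀ x ∈ M.E, k x = k' x)
    (x : Space d) (Υ : OrdControl 𝕌 × 𝕌) : M.opG k x Υ = M.opG k' x Υ :=
  le_antisymm (M.opG_mono (fun y hy => (h y hy).le) x Υ)
    (M.opG_mono (fun y hy => (h y hy).ge) x Υ)

end Model

theorem ofReal_add_add_ofReal_neg {a : ℝ} {c : ℝ≥0} (h : 0 ≤ a + c) :
    ENNReal.ofReal (a + c) + ENNReal.ofReal (-a) = ENNReal.ofReal a + c := by
  rw [← ENNReal.ofReal_coe_nnreal (p := c)]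
  rcases le_total 0 a with ha | ha
  · rw [ENNReal.ofReal_of_nonpos (neg_nonpos.mpr ha), add_zero, ENNReal.ofReal_add ha c.coe_nonneg]
  · rw [ENNReal.ofReal_of_nonpos ha, zero_add, ← ENNReal.ofReal_add h (neg_nonneg.mpr ha)]
    congr 1
    ring

/-- Passage from `EReal` to `ℝ≥0∞`, after the addition of `c`, which makes everything
nonnegative. A finite lower bound excludes `l = ∞`, because `⊥ + ⊤ = ⊥`. -/
theorem ereal_le_iff {l L H P N K : ℝ≥0∞} {c : ℝ≥0} {h : ℝ} (hc : 0 ≤ h + c) (hN : N ≠ ∞)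
    (hK : K + N = P + c) :
    ((h : EReal) ≤ -(l : EReal) + L + H + ((P : EReal) - N) →
      l ≠ ∞ ∧ ENNReal.ofReal (h + c) + l ≤ L + H + K) ∧
    (-(l : EReal) + L + H + ((P : EReal) - N) = h → L + H + K ≤ ENNReal.ofReal (h + c) + l) := by
  lift N to ℝ≥0 using hN
  have hl : l = ∞ → -(l : EReal) + L + H + ((P : EReal) - N) = ⊥ := by
    rintro rfl
    simp
  by_cases hltop : l = ∞
  · rw [hl hltop]
    exact ⟨fun h' => absurd h' (by simp), fun h' => absurd h' (by simp)⟩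
  lift l to ℝ≥0 using hltop
  set a : EReal := -((l : ℝ≥0∞) : EReal) + L + H + ((P : EReal) - ((N : ℝ≥0∞) : EReal)) with ha
  have hreal : ∀ q : ℝ≥0, -((q : ℝ≥0∞) : EReal) + ((q : ℝ≥0∞) : EReal) = 0 := fun q => by
    have : ((q : ℝ≥0∞) : EReal) = ((q : ℝ) : EReal) := rfl
    rw [this, ← EReal.coe_neg, ← EReal.coe_add, neg_add_cancel, EReal.coe_zero]
  have hsum : a + (l : ℝ≥0∞) + (N : ℝ≥0∞) = ((L + H + P : ℝ≥0∞) : EReal) := by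
    calc a + ((l : ℝ≥0∞) : EReal) + ((N : ℝ≥0∞) : EReal)
        = (-((l : ℝ≥0∞) : EReal) + ((l : ℝ≥0∞) : EReal)) + L + H + P
          + (-((N : ℝ≥0∞) : EReal) + ((N : ℝ≥0∞) : EReal)) := by
          rw [ha, sub_eq_add_neg]
          generalize -((l : ℝ≥0∞) : EReal) = l', -((N : ℝ≥0∞) : EReal) = N'
          ac_rfl
      _ = _ := by
          rw [hreal, hreal, zero_add, add_zero, EReal.coe_ennreal_add, EReal.coe_ennreal_add]
  have hleft : ((ENNReal.ofReal (h + c) + l + N : ℝ≥0∞) : EReal)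
      = (h : EReal) + (l : ℝ≥0∞) + (N : ℝ≥0∞) + (c : ℝ≥0∞) := by
    rw [EReal.coe_ennreal_add, EReal.coe_ennreal_add, EReal.coe_ennreal_ofReal, max_eq_left hc,
      EReal.coe_add]
    have : ((c : ℝ≥0∞) : EReal) = ((c : ℝ) : EReal) := rfl
    rw [this]
    ac_rfl
  have hright : ((L + H + K + N : ℝ≥0∞) : EReal)
      = a + (l : ℝ≥0∞) + (N : ℝ≥0∞) + (c : ℝ≥0∞) := by
    rw [hsum, ← EReal.coe_ennreal_add, add_assoc (L + H), hK, add_assoc (L + H)]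
  refine ⟨fun h' => ⟨ENNReal.coe_ne_top, ?_⟩, fun h' => ?_⟩
  · refine ENNReal.le_of_add_le_add_right (ENNReal.coe_ne_top (r := N)) ?_
    rw [← EReal.coe_ennreal_le_coe_ennreal_iff, hleft, hright]
    gcongr
  · refine ENNReal.le_of_add_le_add_right (ENNReal.coe_ne_top (r := N)) ?_
    rw [← EReal.coe_ennreal_le_coe_ennreal_iff, hleft, hright, h']

namespace Model

variable {d : ℕ} {𝕌 : Type*} [TopologicalSpace 𝕌] [MeasurableSpace 𝕌]

/-! ### The optimality inequalities over a finite horizon -/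

/-- `k` satisfies the optimality inequality `k(x) ≤ -ρ𝓛(x,Υ) + Lf(x,Υ) + Hr(x,Υ) + Gk(x,Υ)` for all
feasible `Υ`, with finite `ρ𝓛(x,Υ)`. -/
def IsSubsolution (M : Model d 𝕌) (ρ : ℝ≥0) (k : Space d → ℝ≥0∞) : Prop :=
  ∀ x ∈ M.E, ∀ Υ ∈ M.V x,
    (ρ : ℝ≥0∞) * M.calL x Υ ≠ ∞ ∧ k x + ρ * M.calL x Υ ≤ M.stageValue k x Υ

/-- `Υ` satisfies the reverse of the optimality inequality at `x`. -/
def IsMinimizer (M : Model d 𝕌) (ρ : ℝ≥0) (k : Space d → ℝ≥0∞) (x : Space d)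
    (Υ : OrdControl 𝕌 × 𝕌) : Prop :=
  M.stageValue k x Υ ≤ k x + ρ * M.calL x Υ

/-- Adding to `h` a constant that makes it nonnegative changes both sides of the optimality equation
by that constant, since `G1 = 1`. -/
theorem oneStage_shift (M : Model d 𝕌) (ρ : ℝ≥0) {h : Space d → ℝ} (hmeas : Measurable h) {c : ℝ≥0}
    (hc : ∀ x ∈ M.E, 0 ≤ h x + c) {x : Space d} (hx : x ∈ M.E) {Υ : OrdControl 𝕌 × 𝕌}
    (hΥ : Υ ∈ M.V x) :
    ((h x : EReal) ≤ M.oneStage ρ h x Υ → (ρ : ℝ≥0∞) * M.calL x Υ ≠ ∞ ∧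
      ENNReal.ofReal (h x + c) + ρ * M.calL x Υ
        ≤ M.stageValue (fun y => ENNReal.ofReal (h y + c)) x Υ) ∧
    (M.oneStage ρ h x Υ = h x → M.IsMinimizer ρ (fun y => ENNReal.ofReal (h y + c)) x Υ) := by
  have hneg : M.opG (fun y => ENNReal.ofReal (-h y)) x Υ ≠ ∞ := by
    refine ne_top_of_le_ne_top (ENNReal.coe_ne_top (r := c)) ?_
    rw [← M.opG_const hx hΥ c]
    refine M.opG_mono (fun y hy => ?_) x Υ
    rw [← ENNReal.ofReal_coe_nnreal]
    exact ENNReal.ofReal_le_ofReal (by linarith [hc y hy])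
  have hK : M.opG (fun y => ENNReal.ofReal (h y + c)) x Υ + M.opG (fun y => ENNReal.ofReal (-h y)) x Υ
      = M.opG (fun y => ENNReal.ofReal (h y)) x Υ + c := by
    rw [← M.opG_const hx hΥ c]
    rw [← M.opG_add (hmeas.add_const _).ennreal_ofReal, ← M.opG_add hmeas.ennreal_ofReal]
    exact M.opG_congr (fun y hy => ofReal_add_add_ofReal_neg (hc y hy)) x Υ
  have := ereal_le_iff (l := ρ * M.calL x Υ) (L := M.opL M.f x Υ) (H := M.opH M.r x Υ) (hc x hx)
    hneg hK
  rw [opL_add_opH_add_opG] at this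
  exact this

/-- The control that follows `Υ` up to the time `t`, and then the control `Υ'`. -/
noncomputable def concat (t : ℝ≥0) (Υ Υ' : OrdControl 𝕌 × 𝕌) : OrdControl 𝕌 × 𝕌 :=
  (⟨fun s => open Classical in if s < t then Υ.1 s else Υ'.1 (s - t),
    Measurable.ite measurableSet_Iio Υ.1.measurable_toFun
      (Υ'.1.measurable_toFun.comp (by fun_prop))⟩, Υ'.2)

/-- The control `Υ` from the time `t` on. -/
noncomputable def shift (t : ℝ≥0) (Υ : OrdControl 𝕌 × 𝕌) : OrdControl 𝕌 × 𝕌 :=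
  (⟨fun s => Υ.1 (t + s), Υ.1.measurable_toFun.comp (by fun_prop)⟩, Υ.2)

theorem concat_mem (M : Model d 𝕌) {x : Space d} {t : ℝ≥0} (ht : (t : ℝ≥0∞) < M.tstar x)
    {Υ Υ' : OrdControl 𝕌 × 𝕌} (hΥ : Υ ∈ M.V x) (hΥ' : Υ' ∈ M.V (M.φ x t)) :
    concat t Υ Υ' ∈ M.V x := by
  refine ⟨fun s hs => ?_, ?_⟩
  · by_cases hst : s < t
    · simp only [concat, hst, if_true]
      exact hΥ.1 s hs
    · have hadd : t + (s - t) = s := add_tsub_cancel_of_le (not_lt.mp hst)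
      have hφ : M.φ x s = M.φ (M.φ x t) (s - t) := by rw [← M.φ_add, hadd]
      simp only [concat, hst, if_false]
      rw [hφ] at hs ⊢
      exact hΥ'.1 _ hs
  · rw [← M.exitPoint_flow ht]
    exact hΥ'.2

theorem shift_mem (M : Model d 𝕌) {x : Space d} {t : ℝ≥0} (ht : (t : ℝ≥0∞) < M.tstar x)
    {Υ : OrdControl 𝕌 × 𝕌} (hΥ : Υ ∈ M.V x) : shift t Υ ∈ M.V (M.φ x t) := by
  refine ⟨fun s hs => ?_, ?_⟩
  · rw [← M.φ_add] at hs ⊢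
    exact hΥ.1 _ hs
  · rw [M.exitPoint_flow ht]
    exact hΥ.2

theorem calL_split (M : Model d 𝕌) {x : Space d} {t : ℝ≥0} (ht : (t : ℝ≥0∞) < M.tstar x)
    (Υ : OrdControl 𝕌 × 𝕌) : M.calL x Υ = M.stage 1 x Υ.1 t
      + expNeg (M.cumRate x Υ.1 t) * M.calL (M.φ x t) (shift t Υ) := by
  rw [calL_eq_stage, calL_eq_stage, M.tstar_eq_add ht, stage_add]
  rfl

theorem stageValue_split (M : Model d 𝕌) (k : Space d → ℝ≥0∞) {x : Space d} {t : ℝ≥0}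
    (ht : (t : ℝ≥0∞) < M.tstar x) (Υ : OrdControl 𝕌 × 𝕌) :
    M.stageValue k x Υ = M.stage (M.runGain k) x Υ.1 t
      + expNeg (M.cumRate x Υ.1 t) * M.stageValue k (M.φ x t) (shift t Υ) := by
  rw [stageValue, stageValue, M.exitPoint_flow ht, M.tstar_eq_add ht, stage_add, cumRate_add,
    expNeg_add]
  simp only [shift]
  ring

theorem calL_congr (M : Model d 𝕌) (x : Space d) {Υ Υ' : OrdControl 𝕌 × 𝕌}
    (h : ∀ᵐ s ∂leb, Υ.1 s = Υ'.1 s) : M.calL x Υ = M.calL x Υ' := by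
  rw [calL_eq_stage, calL_eq_stage]
  exact M.stage_congr 1 x (h.mono fun s hs _ => hs)

theorem stageValue_congr (M : Model d 𝕌) (k : Space d → ℝ≥0∞) (x : Space d)
    {Υ Υ' : OrdControl 𝕌 × 𝕌} (h : ∀ᵐ s ∂leb, Υ.1 s = Υ'.1 s) (h' : Υ.2 = Υ'.2) :
    M.stageValue k x Υ = M.stageValue k x Υ' := by
  rw [stageValue, stageValue, M.stage_congr _ x (h.mono fun s hs _ => hs),
    M.cumRate_congr x (h.mono fun s hs _ => hs), h']

/-- The optimality inequality up to a time before `t_*(x)`: the control is continued by a minimizer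
from `φ(x,t)`, whose contribution cancels. -/
theorem IsSubsolution.le_stage {M : Model d 𝕌} {ρ : ℝ≥0} {k : Space d → ℝ≥0∞}
    (hk : M.IsSubsolution ρ k) {x : Space d} (hx : x ∈ M.E) {t : ℝ≥0}
    (ht : (t : ℝ≥0∞) < M.tstar x) {Υ Υ' : OrdControl 𝕌 × 𝕌} (hΥ : Υ ∈ M.V x)
    (hΥ' : Υ' ∈ M.V (M.φ x t)) (hmin : M.IsMinimizer ρ k (M.φ x t) Υ') :
    k x + ρ * M.stage 1 x Υ.1 t
      ≤ M.stage (M.runGain k) x Υ.1 t + expNeg (M.cumRate x Υ.1 t) * k (M.φ x t) := by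
  have hfin := (hk _ (M.flow_mem hx ht) Υ' hΥ').1
  have h := (hk x hx _ (M.concat_mem ht hΥ hΥ')).2
  have hagree : ∀ᵐ s : ℝ≥0 ∂leb, (s : ℝ≥0∞) < t → (concat t Υ Υ').1 s = Υ.1 s :=
    Eventually.of_forall fun s hs => if_pos (ENNReal.coe_lt_coe.mp hs)
  have htail : ∀ᵐ s ∂leb, (shift t (concat t Υ Υ')).1 s = Υ'.1 s := by
    refine Eventually.of_forall fun s => ?_
    simp [shift, concat]
  rw [M.calL_split ht, M.stageValue_split k ht, M.stage_congr _ x hagree,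
    M.stage_congr _ x hagree, M.cumRate_congr x hagree, M.calL_congr _ htail,
    M.stageValue_congr k _ htail rfl] at h
  set e := expNeg (M.cumRate x Υ.1 t) with he
  have hne : e * (ρ * M.calL (M.φ x t) Υ') ≠ ∞ := ENNReal.mul_ne_top (expNeg_ne_top _) hfin
  refine ENNReal.le_of_add_le_add_right hne ?_
  calc k x + ρ * M.stage 1 x Υ.1 t + e * (ρ * M.calL (M.φ x t) Υ')
      = k x + ρ * (M.stage 1 x Υ.1 t + e * M.calL (M.φ x t) Υ') := by ring
    _ ≤ M.stage (M.runGain k) x Υ.1 t + e * M.stageValue k (M.φ x t) Υ' := h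
    _ ≤ M.stage (M.runGain k) x Υ.1 t + e * (k (M.φ x t) + ρ * M.calL (M.φ x t) Υ') := by
        gcongr; exact hmin
    _ = _ := by ring

/-- For a minimizer the reverse inequality holds up to any time before `t_*(x)`: otherwise its
continuation from `φ(x,t)` would violate the optimality inequality there. -/
theorem IsSubsolution.stage_le {M : Model d 𝕌} {ρ : ℝ≥0} {k : Space d → ℝ≥0∞}
    (hk : M.IsSubsolution ρ k) {x : Space d} (hx : x ∈ M.E) {t : ℝ≥0}
    (ht : (t : ℝ≥0∞) < M.tstar x) {Υ : OrdControl 𝕌 × 𝕌} (hΥ : Υ ∈ M.V x)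
    (hmin : M.IsMinimizer ρ k x Υ) :
    M.stage (M.runGain k) x Υ.1 t + expNeg (M.cumRate x Υ.1 t) * k (M.φ x t)
      ≤ k x + ρ * M.stage 1 x Υ.1 t := by
  obtain ⟨hfin, h⟩ := hk _ (M.flow_mem hx ht) _ (M.shift_mem ht hΥ)
  have hmin' : M.stageValue k x Υ ≤ k x + ρ * M.calL x Υ := hmin
  rw [M.calL_split ht, M.stageValue_split k ht] at hmin'
  set e := expNeg (M.cumRate x Υ.1 t) with he
  set Υ' := shift t Υ
  have hne : e * (ρ * M.calL (M.φ x t) Υ') ≠ ∞ := ENNReal.mul_ne_top (expNeg_ne_top _) hfin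
  refine ENNReal.le_of_add_le_add_right hne ?_
  calc M.stage (M.runGain k) x Υ.1 t + e * k (M.φ x t) + e * (ρ * M.calL (M.φ x t) Υ')
      = M.stage (M.runGain k) x Υ.1 t + e * (k (M.φ x t) + ρ * M.calL (M.φ x t) Υ') := by ring
    _ ≤ M.stage (M.runGain k) x Υ.1 t + e * M.stageValue k (M.φ x t) Υ' := by gcongr
    _ ≤ k x + ρ * (M.stage 1 x Υ.1 t + e * M.calL (M.φ x t) Υ') := hmin'
    _ = _ := by ring

/-- The expectation of the costs up to the first jump or the time `v`, whichever comes first,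
together with that of `k` at the state reached then. -/
noncomputable def stageStop (M : Model d 𝕌) (k : Space d → ℝ≥0∞) (x : Space d)
    (Υ : OrdControl 𝕌 × 𝕌) (v : ℝ≥0) : ℝ≥0∞ :=
  M.stage (M.runGain k) x Υ.1 (min v (M.tstar x)) +
    open Classical in if (v : ℝ≥0∞) < M.tstar x then expNeg (M.cumRate x Υ.1 v) * k (M.φ x v)
    else expNeg (M.cumRate x Υ.1 (M.tstar x)) * M.exitGain k (M.exitPoint x, Υ.2)

theorem IsSubsolution.le_stageStop {M : Model d 𝕌} {ρ : ℝ≥0} {k : Space d → ℝ≥0∞}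
    (hk : M.IsSubsolution ρ k) (hex : ∀ y ∈ M.E, ∃ Υ ∈ M.V y, M.IsMinimizer ρ k y Υ)
    {x : Space d} (hx : x ∈ M.E) {Υ : OrdControl 𝕌 × 𝕌} (hΥ : Υ ∈ M.V x) (v : ℝ≥0) :
    k x + ρ * M.stage 1 x Υ.1 (min v (M.tstar x)) ≤ M.stageStop k x Υ v := by
  unfold stageStop
  by_cases hv : (v : ℝ≥0∞) < M.tstar x
  · obtain ⟨Υ', hΥ', hmin⟩ := hex _ (M.flow_mem hx hv)
    rw [if_pos hv, min_eq_left hv.le]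
    exact hk.le_stage hx hv hΥ hΥ' hmin
  · rw [if_neg hv, min_eq_right (not_lt.mp hv), ← calL_eq_stage]
    exact (hk x hx Υ hΥ).2

theorem IsSubsolution.stageStop_le {M : Model d 𝕌} {ρ : ℝ≥0} {k : Space d → ℝ≥0∞}
    (hk : M.IsSubsolution ρ k) {x : Space d} (hx : x ∈ M.E) {Υ : OrdControl 𝕌 × 𝕌}
    (hΥ : Υ ∈ M.V x) (hmin : M.IsMinimizer ρ k x Υ) (v : ℝ≥0) :
    M.stageStop k x Υ v ≤ k x + ρ * M.stage 1 x Υ.1 (min v (M.tstar x)) := by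
  unfold stageStop
  by_cases hv : (v : ℝ≥0∞) < M.tstar x
  · rw [if_pos hv, min_eq_left hv.le]
    exact hk.stage_le hx hv hΥ hmin
  · rw [if_neg hv, min_eq_right (not_lt.mp hv), ← calL_eq_stage]
    exact hmin

/-! ### Expectations over one sojourn -/

/-- The control that the policy `U` uses after the `n`-th jump, from the location `z`. -/
def Policy.control {M : Model d 𝕌} (U : M.Policy) (n : ℕ) (z : M.E) : OrdControl 𝕌 × 𝕌 :=
  (⟨U.u n z, U.measurable_u.comp (by fun_prop : Measurable fun t : ℝ≥0 => (n, z, t))⟩, U.ub n z)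

theorem Policy.control_mem {M : Model d 𝕌} (U : M.Policy) (n : ℕ) (z : M.E) :
    U.control n z ∈ M.V z := ⟨fun t ht => U.u_mem n z t ht, U.ub_mem n z⟩

theorem Policy.measurable_control {M : Model d 𝕌} (U : M.Policy) (n : ℕ) (z : M.E) :
    Measurable (U.u n z) := (U.control n z).1.measurable_toFun

theorem lintegral_sojournLaw (M : Model d 𝕌) (x : Space d) {ν : ℝ≥0 → 𝕌} (hν : Measurable ν)
    {G : ℝ≥0∞ → ℝ≥0∞} (hG : Measurable G) :
    ∫⁻ S, G S ∂(M.sojournLaw x ν)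
      = ∫⁻ s in before (M.tstar x),
          expNeg (M.cumRate x ν s) * (M.lam (M.φ x s, ν s) * G s) ∂leb
        + expNeg (M.cumRate x ν (M.tstar x)) * G (M.tstar x) := by
  have hl : Measurable fun s : ℝ≥0 => (M.lam (M.φ x s, ν s) : ℝ≥0∞) :=
    (M.measurable_lam.comp ((M.measurable_flow x).prodMk hν)).coe_nnreal_ennreal
  have hd : Measurable fun s : ℝ≥0 =>
      (M.lam (M.φ x s, ν s) : ℝ≥0∞) * expNeg (M.cumRate x ν s) :=
    hl.mul (M.measurable_expNeg_cumRate x ν)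
  have hG' : Measurable fun s : ℝ≥0 => G s := hG.comp measurable_coe_nnreal_ennreal
  rw [sojournLaw, lintegral_add_measure, lintegral_map hG measurable_coe_nnreal_ennreal,
    lintegral_withDensity_eq_lintegral_mul _ hd hG', lintegral_smul_measure, lintegral_dirac' _ hG,
    smul_eq_mul]
  congr 1
  refine lintegral_congr fun s => ?_
  simp only [Pi.mul_apply]
  ring

/-- The expectation of a function of the sojourn time, on the event that it is at most `v`. -/
theorem lintegral_sojournLaw_le (M : Model d 𝕌) (x : Space d) {ν : ℝ≥0 → 𝕌} (hν : Measurable ν)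
    {G : ℝ≥0∞ → ℝ≥0∞} (hG : Measurable G) (v : ℝ≥0) :
    ∫⁻ S, (Set.Iic (v : ℝ≥0∞)).indicator G S ∂(M.sojournLaw x ν)
      = ∫⁻ s in before (min v (M.tstar x)),
          expNeg (M.cumRate x ν s) * (M.lam (M.φ x s, ν s) * G s) ∂leb
        + open Classical in if (v : ℝ≥0∞) < M.tstar x then 0
          else expNeg (M.cumRate x ν (M.tstar x)) * G (M.tstar x) := by
  rw [M.lintegral_sojournLaw x hν (hG.indicator measurableSet_Iic)]
  congr 1
  · have h1 : ∀ s : ℝ≥0, expNeg (M.cumRate x ν s)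
        * (M.lam (M.φ x s, ν s) * (Set.Iic (v : ℝ≥0∞)).indicator G s)
        = (Set.Iic v).indicator
          (fun s : ℝ≥0 => expNeg (M.cumRate x ν s) * (M.lam (M.φ x s, ν s) * G s)) s := by
      intro s
      by_cases hs : s ≤ v
      · rw [Set.indicator_of_mem (show (s : ℝ≥0∞) ∈ Set.Iic (v : ℝ≥0∞) from
          ENNReal.coe_le_coe.mpr hs), Set.indicator_of_mem (show s ∈ Set.Iic v from hs)]
      · rw [Set.indicator_of_notMem (show (s : ℝ≥0∞) ∉ Set.Iic (v : ℝ≥0∞) from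
          fun h => hs (ENNReal.coe_le_coe.mp h)), Set.indicator_of_notMem
          (show s ∉ Set.Iic v from hs), mul_zero, mul_zero]
    simp only [h1]
    rw [lintegral_indicator measurableSet_Iic, Measure.restrict_restrict measurableSet_Iic]
    refine setLIntegral_congr ?_
    -- `v` itself is a null set
    have hv : ∀ᵐ s ∂leb, s ≠ v := by
      rw [ae_iff]
      simp
    filter_upwards [hv] with s hs
    refine propext ⟨fun h => ?_, fun h => ?_⟩
    · exact lt_min (ENNReal.coe_lt_coe.mpr (lt_of_le_of_ne h.1 hs)) h.2
    · exact ⟨(ENNReal.coe_lt_coe.mp (lt_of_lt_of_le h (min_le_left _ _))).le,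
        lt_of_lt_of_le h (min_le_right _ _)⟩
  · by_cases hv : (v : ℝ≥0∞) < M.tstar x
    · rw [if_pos hv, Set.indicator_of_notMem (show M.tstar x ∉ Set.Iic (v : ℝ≥0∞) from not_le.mpr hv),
        mul_zero]
    · rw [if_neg hv, Set.indicator_of_mem (show M.tstar x ∈ Set.Iic (v : ℝ≥0∞) from not_lt.mp hv)]

theorem Policy.sojournLaw_Ioi {M : Model d 𝕌} (U : M.Policy) (n : ℕ) (z : M.E) (s : ℝ≥0) :
    M.sojournLaw z (U.u n z) (Set.Ioi (s : ℝ≥0∞))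
      = (before (M.tstar z)).indicator (fun s => expNeg (M.cumRate z (U.u n z) s)) s := by
  have := U.isProbabilityMeasure_sojournLaw n z
  have hle : M.sojournLaw z (U.u n z) (Set.Iic (s : ℝ≥0∞)) = M.stage (fun p => (M.lam p : ℝ≥0∞)) z
      (U.u n z) (min s (M.tstar z)) + open Classical in if (s : ℝ≥0∞) < M.tstar z then 0
          else expNeg (M.cumRate z (U.u n z) (M.tstar z)) := by
    have h := M.lintegral_sojournLaw_le z (U.measurable_control n z) (G := 1) measurable_one s
    rw [lintegral_indicator_one measurableSet_Iic] at h
    simpa [stage] using h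
  have htot := fun τ hτ => M.stage_lam_add_expNeg z.2 (U.control_mem n z) (τ := τ) hτ
  have hadd : M.sojournLaw z (U.u n z) (Set.Iic (s : ℝ≥0∞))
      + M.sojournLaw z (U.u n z) (Set.Ioi (s : ℝ≥0∞)) = 1 := by
    rw [← Set.compl_Iic, measure_add_measure_compl measurableSet_Iic, measure_univ]
  refine (ENNReal.add_right_inj (measure_ne_top (M.sojournLaw z (U.u n z)) (Set.Iic (s : ℝ≥0∞)))).mp ?_
  rw [hadd, hle]
  by_cases hs : (s : ℝ≥0∞) < M.tstar z
  · rw [if_pos hs, Set.indicator_of_mem (show s ∈ before (M.tstar z) from hs), min_eq_left hs.le,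
      add_zero]
    exact (htot _ hs.le).symm
  · rw [if_neg hs, Set.indicator_of_notMem (show s ∉ before (M.tstar z) from hs),
      min_eq_right (not_lt.mp hs), add_zero]
    exact (htot _ le_rfl).symm

/-- The sojourn time is positive and at most `t_*(z)`. -/
theorem Policy.ae_sojournLaw {M : Model d 𝕌} (U : M.Policy) (n : ℕ) (z : M.E) :
    ∀ᵐ S ∂(M.sojournLaw z (U.u n z)), 0 < S ∧ S ≤ M.tstar z := by
  have hm : MeasurableSet {S : ℝ≥0∞ | 0 < S ∧ S ≤ M.tstar z} := measurableSet_Ioc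
  rw [ae_iff, ← Set.compl_ofPred, ← lintegral_indicator_one hm.compl,
    M.lintegral_sojournLaw z (U.measurable_control n z) (measurable_one.indicator hm.compl),
    Set.indicator_of_notMem (show M.tstar z ∉ {S : ℝ≥0∞ | 0 < S ∧ S ≤ M.tstar z}ᶜ from
      fun h => h ⟨M.tstar_pos z.2, le_rfl⟩), mul_zero, add_zero]
  refine (lintegral_eq_zero_iff' ?_).mpr ?_
  · have hl : Measurable fun s : ℝ≥0 => (M.lam (M.φ z s, U.u n z s) : ℝ≥0∞) :=
      (M.measurable_lam.comp ((M.measurable_flow z).prodMk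
        (U.measurable_control n z))).coe_nnreal_ennreal
    exact ((M.measurable_expNeg_cumRate z _).mul (hl.mul ((measurable_one.indicator hm.compl).comp
      measurable_coe_nnreal_ennreal))).aemeasurable
  · have h0 : ∀ᵐ s ∂leb, s ≠ (0 : ℝ≥0) := by
      rw [ae_iff]
      simp
    filter_upwards [ae_restrict_mem (measurableSet_before _), ae_restrict_of_ae h0] with s hs hs0
    have hs' : (s : ℝ≥0∞) < M.tstar z := hs
    rw [Set.indicator_of_notMem (show (s : ℝ≥0∞) ∉ {S : ℝ≥0∞ | 0 < S ∧ S ≤ M.tstar z}ᶜ from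
        fun h => h ⟨by simpa [pos_iff_ne_zero] using hs0, hs'.le⟩),
      mul_zero, mul_zero, Pi.zero_apply]

/-- The expectation of the integral of `w` along the flow, up to the next jump or the time `v`. -/
theorem Policy.lintegral_sojournLaw_run {M : Model d 𝕌} (U : M.Policy) (n : ℕ) (z : M.E)
    {w : Space d × 𝕌 → ℝ≥0∞} (hw : Measurable w) (v : ℝ≥0) :
    ∫⁻ S, ∫⁻ s in before (min S v), w (M.φ z s, U.u n z s) ∂leb ∂(M.sojournLaw z (U.u n z))
      = M.stage w z (U.u n z) (min v (M.tstar z)) := by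
  have := U.isProbabilityMeasure_sojournLaw n z
  have hwm : Measurable fun s : ℝ≥0 => w (M.φ z s, U.u n z s) :=
    hw.comp ((M.measurable_flow z).prodMk (U.measurable_control n z))
  have hset : MeasurableSet {p : ℝ≥0∞ × ℝ≥0 | (p.2 : ℝ≥0∞) < p.1} :=
    measurableSet_lt (by fun_prop) (by fun_prop)
  calc ∫⁻ S, ∫⁻ s in before (min S v), w (M.φ z s, U.u n z s) ∂leb ∂(M.sojournLaw z (U.u n z))
      = ∫⁻ S, ∫⁻ s in before v, {p : ℝ≥0∞ × ℝ≥0 | (p.2 : ℝ≥0∞) < p.1}.indicator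
          (fun p => w (M.φ z p.2, U.u n z p.2)) (S, s) ∂leb ∂(M.sojournLaw z (U.u n z)) := by
        refine lintegral_congr fun S => ?_
        have h1 : before (min S v) = before S ∩ before v := by ext s; simp [before]
        have h2 : (fun s : ℝ≥0 => {p : ℝ≥0∞ × ℝ≥0 | (p.2 : ℝ≥0∞) < p.1}.indicator
          (fun p => w (M.φ z p.2, U.u n z p.2)) (S, s))
          = (before S).indicator fun s => w (M.φ z s, U.u n z s) := rfl
        rw [h1, ← Measure.restrict_restrict (measurableSet_before _),
          ← lintegral_indicator (measurableSet_before _), h2]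
    _ = ∫⁻ s in before v, ∫⁻ S, {p : ℝ≥0∞ × ℝ≥0 | (p.2 : ℝ≥0∞) < p.1}.indicator
          (fun p => w (M.φ z p.2, U.u n z p.2)) (S, s) ∂(M.sojournLaw z (U.u n z)) ∂leb := by
        refine lintegral_lintegral_swap (Measurable.aemeasurable ?_)
        exact (hwm.comp measurable_snd).indicator hset
    _ = ∫⁻ s in before v, (before (M.tstar z)).indicator
          (fun s => expNeg (M.cumRate z (U.u n z) s) * w (M.φ z s, U.u n z s)) s ∂leb := by
        refine lintegral_congr fun s => ?_
        have h2 : (fun S : ℝ≥0∞ => {p : ℝ≥0∞ × ℝ≥0 | (p.2 : ℝ≥0∞) < p.1}.indicator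
          (fun p => w (M.φ z p.2, U.u n z p.2)) (S, s))
          = (Set.Ioi (s : ℝ≥0∞)).indicator fun _ => w (M.φ z s, U.u n z s) := rfl
        rw [h2, lintegral_indicator_const measurableSet_Ioi, U.sojournLaw_Ioi]
        by_cases hs : s ∈ before (M.tstar z)
        · simp only [Set.indicator_of_mem hs, mul_comm]
        · simp only [Set.indicator_of_notMem hs, mul_zero]
    _ = _ := by
        have h1 : before (min (v : ℝ≥0∞) (M.tstar z)) = before (M.tstar z) ∩ before v := by
          ext s; simp [before, and_comm]
        rw [lintegral_indicator (measurableSet_before _),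
          Measure.restrict_restrict (measurableSet_before _), ← h1]
        rfl

/-! ### One step of the embedded chain -/

/-- The time spent before `t` between two jumps, the first at the time `T`; `y` is the pair of the
sojourn time and the location after the second jump. -/
noncomputable def timeStep {M : Model d 𝕌} (t : ℝ≥0) (T : ℝ≥0∞) (y : ℝ≥0∞ × M.E) : ℝ≥0∞ :=
  min y.1 (t - T)

/-- The running cost incurred before `t` between two jumps, the first at the time `T`, to `z`. -/
noncomputable def runStep {M : Model d 𝕌} (U : M.Policy) (n : ℕ) (t : ℝ≥0) (T : ℝ≥0∞) (z : M.E)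
    (y : ℝ≥0∞ × M.E) : ℝ≥0∞ :=
  ∫⁻ s in before (min y.1 (t - T)), (M.f (M.φ z s, U.u n z s) : ℝ≥0∞) ∂leb

/-- The boundary cost of the second of two jumps, the first at the time `T`, to `z`, if it happens
up to `t`. -/
noncomputable def boundaryStep {M : Model d 𝕌} (U : M.Policy) (n : ℕ) (t : ℝ≥0) (T : ℝ≥0∞) (z : M.E)
    (y : ℝ≥0∞ × M.E) : ℝ≥0∞ :=
  open Classical in
  if T + y.1 ≤ t ∧ M.φ z y.1.toNNReal ∈ frontier M.E then
    (M.r (M.φ z y.1.toNNReal, U.ub n z) : ℝ≥0∞) else 0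

/-- The value of `k` at the state at the time `t`, if `t` lies between the two jumps. -/
noncomputable def stayStep {M : Model d 𝕌} (k : Space d → ℝ≥0∞) (t : ℝ≥0) (T : ℝ≥0∞) (z : M.E)
    (y : ℝ≥0∞ × M.E) : ℝ≥0∞ :=
  open Classical in if T ≤ t ∧ t < T + y.1 then k (M.φ z (t - T.toNNReal)) else 0

/-- The value of `k` after the second jump, if it happens up to `t`. -/
noncomputable def jumpStep {M : Model d 𝕌} (k : Space d → ℝ≥0∞) (t : ℝ≥0) (T : ℝ≥0∞)
    (y : ℝ≥0∞ × M.E) : ℝ≥0∞ :=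
  open Classical in if T + y.1 ≤ t then k y.2 else 0

theorem lintegral_stepKernel {M : Model d 𝕌} (U : M.Policy) (n : ℕ) (z : M.E)
    {F : ℝ≥0∞ × M.E → ℝ≥0∞} (hF : Measurable F) :
    ∫⁻ y, F y ∂(stepKernel U n z)
      = ∫⁻ S, ∫⁻ z', F (S, z') ∂(M.Q (jumpPoint U n (z, S))) ∂(M.sojournLaw z (U.u n z)) := by
  rw [stepKernel, Kernel.lintegral_compProd _ _ _ hF]
  rfl

theorem lintegral_stepKernel_fst {M : Model d 𝕌} (U : M.Policy) (n : ℕ) (z : M.E)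
    {F : ℝ≥0∞ → ℝ≥0∞} (hF : Measurable F) :
    ∫⁻ y, F y.1 ∂(stepKernel U n z) = ∫⁻ S, F S ∂(M.sojournLaw z (U.u n z)) := by
  have := M.markov_Q
  have hF' : Measurable fun y : ℝ≥0∞ × M.E => F y.1 := hF.comp measurable_fst
  rw [lintegral_stepKernel U n z hF']
  simp

theorem le_sub_iff_of_le {t : ℝ≥0} {T S : ℝ≥0∞} (hT : T ≤ t) :
    T + S ≤ t ↔ S ≤ ((t - T.toNNReal : ℝ≥0) : ℝ≥0∞) := by
  lift T to ℝ≥0 using ne_top_of_le_ne_top ENNReal.coe_ne_top hT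
  rw [ENNReal.toNNReal_coe, ENNReal.coe_sub, add_comm]
  exact (ENNReal.cancel_of_ne ENNReal.coe_ne_top).le_tsub_iff_right hT |>.symm

theorem coe_sub_toNNReal {t : ℝ≥0} {T : ℝ≥0∞} (hT : T ≤ t) :
    (t : ℝ≥0∞) - T = ((t - T.toNNReal : ℝ≥0) : ℝ≥0∞) := by
  lift T to ℝ≥0 using ne_top_of_le_ne_top ENNReal.coe_ne_top hT
  rw [ENNReal.toNNReal_coe, ENNReal.coe_sub]

section OneStep

variable {M : Model d 𝕌} (U : M.Policy) (n : ℕ) (z : M.E) {t : ℝ≥0} {T : ℝ≥0∞}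

theorem lintegral_runStep (hT : T ≤ t) :
    ∫⁻ y, runStep U n t T z y ∂(stepKernel U n z)
      = M.stage (fun p => (M.f p : ℝ≥0∞)) z (U.u n z) (min ((t - T.toNNReal : ℝ≥0) : ℝ≥0∞) (M.tstar z)) := by
  rw [← U.lintegral_sojournLaw_run n z M.measurable_f.coe_nnreal_ennreal, ← coe_sub_toNNReal hT]
  refine lintegral_stepKernel_fst U n z
    (F := fun S => ∫⁻ s in before (min S (t - T)), (M.f (M.φ z s, U.u n z s) : ℝ≥0∞) ∂leb) ?_
  refine Monotone.measurable fun a b hab => lintegral_mono_set fun s hs => ?_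
  exact lt_of_lt_of_le hs (min_le_min_right _ hab)

theorem lintegral_timeStep (hT : T ≤ t) :
    ∫⁻ y, timeStep t T y ∂(stepKernel U n z)
      = M.stage 1 z (U.u n z) (min ((t - T.toNNReal : ℝ≥0) : ℝ≥0∞) (M.tstar z)) := by
  rw [← U.lintegral_sojournLaw_run n z measurable_one, ← coe_sub_toNNReal hT]
  simp only [Pi.one_apply, setLIntegral_one, leb_before]
  exact lintegral_stepKernel_fst U n z (F := fun S => min S (t - T))
    (measurable_id.min measurable_const)

theorem lintegral_stayStep {k : Space d → ℝ≥0∞} (hT : T ≤ t) :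
    ∫⁻ y, stayStep k t T z y ∂(stepKernel U n z)
      = (before (M.tstar z)).indicator
        (fun v => expNeg (M.cumRate z (U.u n z) v) * k (M.φ z v)) (t - T.toNNReal) := by
  have h : ∀ y : ℝ≥0∞ × M.E, stayStep k t T z y
      = (Set.Ioi ((t - T.toNNReal : ℝ≥0) : ℝ≥0∞)).indicator
        (fun _ => k (M.φ z (t - T.toNNReal))) y.1 := by
    intro y
    rw [stayStep, Set.indicator_apply]
    refine if_congr ?_ rfl rfl
    rw [Set.mem_Ioi, ← not_le, ← not_le, le_sub_iff_of_le hT]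
    exact and_iff_right hT
  simp only [h]
  rw [lintegral_stepKernel_fst U n z (measurable_const.indicator measurableSet_Ioi),
    lintegral_indicator_const measurableSet_Ioi, U.sojournLaw_Ioi]
  by_cases hv : t - T.toNNReal ∈ before (M.tstar z)
  · simp only [Set.indicator_of_mem hv, mul_comm]
  · simp only [Set.indicator_of_notMem hv, mul_zero]

theorem lintegral_boundaryStep (hT : T ≤ t) :
    ∫⁻ y, boundaryStep U n t T z y ∂(stepKernel U n z)
      = open Classical in if ((t - T.toNNReal : ℝ≥0) : ℝ≥0∞) < M.tstar z then 0
        else expNeg (M.cumRate z (U.u n z) (M.tstar z)) * M.r (M.exitPoint z, U.ub n z) := by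
  classical
  let G : ℝ≥0∞ → ℝ≥0∞ := fun S => if M.φ z S.toNNReal ∈ frontier M.E then
    (M.r (M.φ z S.toNNReal, U.ub n z) : ℝ≥0∞) else 0
  have hφ : Measurable fun S : ℝ≥0∞ => M.φ z S.toNNReal :=
    (M.measurable_flow z).comp ENNReal.measurable_toNNReal
  have hG : Measurable G := Measurable.ite (isClosed_frontier.measurableSet.preimage hφ)
    (M.measurable_r.comp (hφ.prodMk measurable_const)).coe_nnreal_ennreal measurable_const
  have h : ∀ y : ℝ≥0∞ × M.E, boundaryStep U n t T z y
      = (Set.Iic ((t - T.toNNReal : ℝ≥0) : ℝ≥0∞)).indicator G y.1 := by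
    intro y
    simp only [boundaryStep, Set.indicator_apply, Set.mem_Iic, le_sub_iff_of_le hT, ite_and, G]
  simp only [h]
  rw [lintegral_stepKernel_fst U n z (hG.indicator measurableSet_Iic),
    M.lintegral_sojournLaw_le z (U.measurable_control n z) hG]
  -- no boundary cost is incurred at a jump before `t_*(z)`
  have h0 : ∫⁻ s in before (min ((t - T.toNNReal : ℝ≥0) : ℝ≥0∞) (M.tstar z)),
      expNeg (M.cumRate z (U.u n z) s) * (M.lam (M.φ z s, U.u n z s) * G s) ∂leb = 0 := by
    rw [← lintegral_zero (μ := leb.restrict _)]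
    refine setLIntegral_congr_fun (measurableSet_before _) fun s hs => ?_
    have hs' : (s : ℝ≥0∞) < M.tstar z := lt_of_lt_of_le hs (min_le_right _ _)
    have hE : M.φ z s ∉ frontier M.E := by
      rw [frontier, M.isOpen_E.interior_eq]
      exact fun h => h.2 (M.flow_mem z.2 hs')
    simp only [G, ENNReal.toNNReal_coe, hE, if_false, mul_zero]
  rw [h0, zero_add]
  by_cases hv : ((t - T.toNNReal : ℝ≥0) : ℝ≥0∞) < M.tstar z
  · rw [if_pos hv, if_pos hv]
  · have htop : M.tstar z ≠ ∞ := ne_top_of_le_ne_top ENNReal.coe_ne_top (not_lt.mp hv)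
    rw [if_neg hv, if_neg hv]
    simp only [G, M.flow_tstar_mem_frontier z.2 htop, if_true, exitPoint, htop, if_false]

theorem lintegral_jumpStep {k : Space d → ℝ≥0∞} (hk : Measurable k) (hT : T ≤ t) :
    ∫⁻ y, jumpStep k t T y ∂(stepKernel U n z)
      = M.stage (fun p => M.lam p * ∫⁻ z, k z ∂(M.Q p)) z (U.u n z)
          (min ((t - T.toNNReal : ℝ≥0) : ℝ≥0∞) (M.tstar z))
        + open Classical in if ((t - T.toNNReal : ℝ≥0) : ℝ≥0∞) < M.tstar z then 0
          else expNeg (M.cumRate z (U.u n z) (M.tstar z))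
            * ∫⁻ z', k z' ∂(M.Q (M.exitPoint z, U.ub n z)) := by
  classical
  let G : ℝ≥0∞ → ℝ≥0∞ := fun S => ∫⁻ z', k z' ∂(M.Q (jumpPoint U n (z, S)))
  have hG : Measurable G := (M.measurable_lintegral_Q hk).comp
    ((U.measurable_jumpPoint n).comp (measurable_const.prodMk measurable_id))
  have hF : Measurable (jumpStep k t T : ℝ≥0∞ × M.E → ℝ≥0∞) :=
    Measurable.ite (measurableSet_le (measurable_const.add measurable_fst) measurable_const)
      (hk.comp (measurable_subtype_coe.comp measurable_snd)) measurable_const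
  have h : ∀ S, ∫⁻ z', jumpStep k t T (S, z') ∂(M.Q (jumpPoint U n (z, S)))
      = (Set.Iic ((t - T.toNNReal : ℝ≥0) : ℝ≥0∞)).indicator G S := by
    intro S
    rw [Set.indicator_apply]
    simp only [jumpStep, le_sub_iff_of_le hT, Set.mem_Iic]
    split_ifs
    · rfl
    · simp
  rw [lintegral_stepKernel U n z hF]
  simp only [h]
  rw [M.lintegral_sojournLaw_le z (U.measurable_control n z) hG]
  congr 1
  · refine setLIntegral_congr_fun (measurableSet_before _) fun s hs => ?_
    have hs' : (s : ℝ≥0∞) < M.tstar z := lt_of_lt_of_le hs (min_le_right _ _)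
    simp only [G, jumpPoint, hs', if_true, ENNReal.toNNReal_coe]
  · simp only [G, jumpPoint, lt_self_iff_false, if_false]

/-- The expectations of one step add up to the functional of the finite-horizon optimality
inequalities. -/
theorem lintegral_step_eq_stageStop {k : Space d → ℝ≥0∞} (hk : Measurable k) (hT : T ≤ t) :
    ∫⁻ y, runStep U n t T z y ∂(stepKernel U n z) + ∫⁻ y, boundaryStep U n t T z y ∂(stepKernel U n z)
      + ∫⁻ y, stayStep k t T z y ∂(stepKernel U n z) + ∫⁻ y, jumpStep k t T y ∂(stepKernel U n z)
      = M.stageStop k z (U.control n z) (t - T.toNNReal) := by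
  rw [lintegral_runStep U n z hT, lintegral_boundaryStep U n z hT, lintegral_stayStep U n z hT,
    lintegral_jumpStep U n z hk hT, stageStop]
  have hrun : M.stage (M.runGain k) z (U.control n z).1
        (min ((t - T.toNNReal : ℝ≥0) : ℝ≥0∞) (M.tstar z))
      = M.stage (fun p => (M.f p : ℝ≥0∞)) z (U.u n z)
          (min ((t - T.toNNReal : ℝ≥0) : ℝ≥0∞) (M.tstar z))
        + M.stage (fun p => M.lam p * ∫⁻ z, k z ∂(M.Q p)) z (U.u n z)
          (min ((t - T.toNNReal : ℝ≥0) : ℝ≥0∞) (M.tstar z)) :=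
    M.stage_fun_add M.measurable_f.coe_nnreal_ennreal _ z (U.measurable_control n z) _
  rw [hrun]
  by_cases hv : ((t - T.toNNReal : ℝ≥0) : ℝ≥0∞) < M.tstar z
  · rw [if_pos hv, if_pos hv, if_pos hv,
      Set.indicator_of_mem (show t - T.toNNReal ∈ before (M.tstar z) from hv)]
    simp only [Policy.control]
    ring
  · rw [if_neg hv, if_neg hv, if_neg hv,
      Set.indicator_of_notMem (show t - T.toNNReal ∉ before (M.tstar z) from hv), exitGain]
    simp only [Policy.control]
    ring

end OneStep

/-! ### Measurability of the one-step functionals -/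

theorem measurable_flow_prod (M : Model d 𝕌) : Measurable fun p : M.E × ℝ≥0 => M.φ p.1 p.2 :=
  M.continuous_φ.measurable.comp ((measurable_subtype_coe.comp measurable_fst).prodMk measurable_snd)

section Measurability

variable {M : Model d 𝕌} (U : M.Policy) (n : ℕ) (t : ℝ≥0)

theorem measurable_timeStep :
    Measurable fun p : ℝ≥0∞ × M.E × (ℝ≥0∞ × M.E) => timeStep t p.1 p.2.2 := by
  unfold timeStep
  fun_prop

theorem measurable_runStep :
    Measurable fun p : ℝ≥0∞ × M.E × (ℝ≥0∞ × M.E) => runStep U n t p.1 p.2.1 p.2.2 := by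
  have : (fun p : ℝ≥0∞ × M.E × (ℝ≥0∞ × M.E) => runStep U n t p.1 p.2.1 p.2.2) = fun p => ∫⁻ s,
      {q : (ℝ≥0∞ × M.E × (ℝ≥0∞ × M.E)) × ℝ≥0 | (q.2 : ℝ≥0∞) < min q.1.2.2.1 (t - q.1.1)}.indicator
        (fun q => (M.f (M.φ q.1.2.1 q.2, U.u n q.1.2.1 q.2) : ℝ≥0∞)) (p, s) ∂leb := by
    ext p
    rw [runStep, ← lintegral_indicator (measurableSet_before _)]
    rfl
  rw [this]
  apply Measurable.lintegral_prod_right'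
  apply Measurable.indicator
  · exact (M.measurable_f.comp ((U.measurable_path n).comp (by fun_prop :
      Measurable fun q : (ℝ≥0∞ × M.E × (ℝ≥0∞ × M.E)) × ℝ≥0 => (q.1.2.1, q.2)))).coe_nnreal_ennreal
  · exact measurableSet_lt (by fun_prop) (by fun_prop)

theorem measurable_boundaryStep :
    Measurable fun p : ℝ≥0∞ × M.E × (ℝ≥0∞ × M.E) => boundaryStep U n t p.1 p.2.1 p.2.2 := by
  unfold boundaryStep
  have hφ : Measurable fun p : ℝ≥0∞ × M.E × (ℝ≥0∞ × M.E) => M.φ p.2.1 p.2.2.1.toNNReal :=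
    M.measurable_flow_prod.comp (by fun_prop :
      Measurable fun p : ℝ≥0∞ × M.E × (ℝ≥0∞ × M.E) => (p.2.1, p.2.2.1.toNNReal))
  have hub : Measurable fun p : ℝ≥0∞ × M.E × (ℝ≥0∞ × M.E) => U.ub n p.2.1 :=
    U.measurable_ub.comp (by fun_prop : Measurable fun p : ℝ≥0∞ × M.E × (ℝ≥0∞ × M.E) => (n, p.2.1))
  refine Measurable.ite ?_ (M.measurable_r.comp (hφ.prodMk hub)).coe_nnreal_ennreal measurable_const
  have hle : MeasurableSet {p : ℝ≥0∞ × M.E × (ℝ≥0∞ × M.E) | p.1 + p.2.2.1 ≤ t} :=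
    measurableSet_le (by fun_prop) measurable_const
  exact hle.inter (isClosed_frontier.measurableSet.preimage hφ)

theorem measurable_stayStep {k : Space d → ℝ≥0∞} (hk : Measurable k) :
    Measurable fun p : ℝ≥0∞ × M.E × (ℝ≥0∞ × M.E) => stayStep k t p.1 p.2.1 p.2.2 := by
  unfold stayStep
  refine Measurable.ite ?_ (hk.comp (M.measurable_flow_prod.comp (by fun_prop :
    Measurable fun p : ℝ≥0∞ × M.E × (ℝ≥0∞ × M.E) => (p.2.1, t - p.1.toNNReal)))) measurable_const
  have hlt : MeasurableSet {p : ℝ≥0∞ × M.E × (ℝ≥0∞ × M.E) | (t : ℝ≥0∞) < p.1 + p.2.2.1} :=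
    measurableSet_lt measurable_const (by fun_prop)
  exact (measurable_fst measurableSet_Iic).inter hlt

theorem measurable_jumpStep {k : Space d → ℝ≥0∞} (hk : Measurable k) :
    Measurable fun p : ℝ≥0∞ × M.E × (ℝ≥0∞ × M.E) => jumpStep k t p.1 p.2.2 := by
  unfold jumpStep
  exact Measurable.ite (measurableSet_le (by fun_prop) measurable_const)
    (hk.comp (by fun_prop)) measurable_const

end Measurability

/-! ### The Markov property of the embedded chain -/

instance {M : Model d 𝕌} (U : M.Policy) (x : M.E) : IsProbabilityMeasure (law U x) := by
  unfold law
  infer_instance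

theorem T_zero {M : Model d 𝕌} (ω : M.Path) : T 0 ω = 0 := by simp [T]

theorem T_succ {M : Model d 𝕌} (n : ℕ) (ω : M.Path) : T (n + 1) ω = T n ω + (ω (n + 1)).1 :=
  Finset.sum_range_succ _ _

theorem monotone_T {M : Model d 𝕌} (ω : M.Path) : Monotone fun n => T n ω :=
  monotone_nat_of_le_succ fun n => by rw [T_succ]; exact le_self_add

theorem measurable_T {M : Model d 𝕌} (n : ℕ) : Measurable (T n : M.Path → ℝ≥0∞) :=
  Finset.measurable_sum _ fun i _ => measurable_fst.comp (measurable_pi_apply (i + 1))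

theorem measurable_Z {M : Model d 𝕌} (n : ℕ) : Measurable (Z n : M.Path → M.E) :=
  measurable_snd.comp (measurable_pi_apply n)

theorem measurable_T_Z_next {M : Model d 𝕌} (n : ℕ) :
    Measurable fun ω : M.Path => (T n ω, Z n ω, ω (n + 1)) :=
  (measurable_T n).prodMk ((measurable_Z n).prodMk (measurable_pi_apply _))

/-- Given the past up to the `n`-th jump, the next sojourn time and location have the law
`stepKernel U n (Z n)`. -/
theorem lintegral_law_next {M : Model d 𝕌} (U : M.Policy) (x : M.E) (n : ℕ)
    {F : ℝ≥0∞ × M.E × (ℝ≥0∞ × M.E) → ℝ≥0∞} (hF : Measurable F) :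
    ∫⁻ ω, F (T n ω, Z n ω, ω (n + 1)) ∂(law U x)
      = ∫⁻ ω, ∫⁻ y, F (T n ω, Z n ω, y) ∂(stepKernel U n (Z n ω)) ∂(law U x) := by
  classical
  -- the past up to the `n`-th jump is extended to a path, so that `T n` can be evaluated
  let e : ((i : Finset.Iic n) → ℝ≥0∞ × M.E) → M.Path := fun y j =>
    if hj : j ≤ n then y ⟨j, Finset.mem_Iic.mpr hj⟩ else (0, x)
  have he : Measurable e := by
    refine measurable_pi_lambda _ fun j => ?_
    by_cases hj : j ≤ n
    · simp only [e, hj, dite_true]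
      exact measurable_pi_apply _
    · simp only [e, hj, dite_false]
      exact measurable_const
  let G : ((i : Finset.Iic n) → ℝ≥0∞ × M.E) × (ℝ≥0∞ × M.E) → ℝ≥0∞ := fun p =>
    F (T n (e p.1), Z n (e p.1), p.2)
  have hG : Measurable G := hF.comp (((measurable_T n).comp (he.comp measurable_fst)).prodMk
    (((measurable_Z n).comp (he.comp measurable_fst)).prodMk measurable_snd))
  have hT : ∀ ω : M.Path, T n (e (Preorder.frestrictLe n ω)) = T n ω := by
    intro ω
    refine Finset.sum_congr rfl fun i hi => ?_
    have : i + 1 ≤ n := Finset.mem_range.mp hi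
    simp [e, this]
  have hZ : ∀ ω : M.Path, Z n (e (Preorder.frestrictLe n ω)) = Z n ω := by
    intro ω
    simp [Z, e]
  have hmap := Kernel.partialTraj_compProd_eq_map_traj (X := fun _ => ℝ≥0∞ × M.E)
    (κ := histKernel U) (Nat.zero_le n) (x₀ := fun _ => ((0 : ℝ≥0∞), x))
  have hmarg := Kernel.traj_map_frestrictLe_apply (X := fun _ => ℝ≥0∞ × M.E)
    (κ := histKernel U) 0 n (fun _ => ((0 : ℝ≥0∞), x))
  calc ∫⁻ ω, F (T n ω, Z n ω, ω (n + 1)) ∂(law U x)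
      = ∫⁻ ω, G (Preorder.frestrictLe n ω, ω (n + 1)) ∂(law U x) := by
        refine lintegral_congr fun ω => ?_
        simp only [G, hT, hZ]
    _ = ∫⁻ p, G p ∂((law U x).map fun ω => (Preorder.frestrictLe n ω, ω (n + 1))) := by
        rw [lintegral_map hG ((Preorder.measurable_frestrictLe n).prodMk (measurable_pi_apply _))]
    _ = ∫⁻ y, ∫⁻ w, G (y, w) ∂(histKernel U n y) ∂(Kernel.partialTraj
          (X := fun _ => ℝ≥0∞ × M.E) (histKernel U) 0 n fun _ => ((0 : ℝ≥0∞), x)) := by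
        rw [law, ← hmap, Measure.lintegral_compProd hG]
    _ = ∫⁻ ω, ∫⁻ w, G (Preorder.frestrictLe n ω, w) ∂(histKernel U n (Preorder.frestrictLe n ω))
          ∂(law U x) := by
        rw [← hmarg, lintegral_map hG.lintegral_kernel_prod_right'
          (Preorder.measurable_frestrictLe n)]
        rfl
    _ = _ := by
        refine lintegral_congr fun ω => ?_
        have : histKernel U n (Preorder.frestrictLe n ω) = stepKernel U n (Z n ω) := rfl
        rw [this]
        simp only [G, hT, hZ]

theorem lintegral_law_zero {M : Model d 𝕌} (U : M.Policy) (x : M.E)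
    {F : ℝ≥0∞ × M.E → ℝ≥0∞} (hF : Measurable F) : ∫⁻ ω, F (ω 0) ∂(law U x) = F (0, x) := by
  have hF' : Measurable fun ω : M.Path => F (ω 0) := hF.comp (measurable_pi_apply 0)
  rw [law, Kernel.lintegral_traj _ hF']
  simp [Function.updateFinset]

theorem ae_sojourn {M : Model d 𝕌} (U : M.Policy) (x : M.E) :
    ∀ᵐ ω ∂(law U x), ∀ n, 0 < (ω (n + 1)).1 ∧ (ω (n + 1)).1 ≤ M.tstar (Z n ω) := by
  rw [ae_all_iff]
  intro n
  let A : Set (ℝ≥0∞ × M.E × (ℝ≥0∞ × M.E)) := {p | ¬ (0 < p.2.2.1 ∧ p.2.2.1 ≤ M.tstar p.2.1)}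
  have hpos : MeasurableSet {p : ℝ≥0∞ × M.E × (ℝ≥0∞ × M.E) | 0 < p.2.2.1} :=
    measurableSet_lt measurable_const (by fun_prop)
  have hle : MeasurableSet {p : ℝ≥0∞ × M.E × (ℝ≥0∞ × M.E) | p.2.2.1 ≤ M.tstar p.2.1} :=
    measurableSet_le (by fun_prop) ((measurable_tstar M).comp
      (by fun_prop : Measurable fun p : ℝ≥0∞ × M.E × (ℝ≥0∞ × M.E) => p.2.1))
  have hA : MeasurableSet A := (hpos.inter hle).compl
  have h := lintegral_law_next U x n (measurable_one.indicator hA : Measurable (A.indicator 1))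
  have h0 : ∀ ω : M.Path, ∫⁻ y, A.indicator 1 (T n ω, Z n ω, y) ∂(stepKernel U n (Z n ω)) = 0 := by
    intro ω
    have hm : MeasurableSet {S : ℝ≥0∞ | ¬ (0 < S ∧ S ≤ M.tstar (Z n ω))} := measurableSet_Ioc.compl
    have := lintegral_stepKernel_fst U n (Z n ω)
      (measurable_one.indicator hm : Measurable (Set.indicator _ (1 : ℝ≥0∞ → ℝ≥0∞)))
    rw [lintegral_indicator_one hm] at this
    exact this.trans (ae_iff.mp (U.ae_sojournLaw n (Z n ω)))
  simp only [h0, lintegral_zero] at h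
  rw [ae_iff, ← lintegral_indicator_one]
  · exact h
  · exact hA.preimage (measurable_T_Z_next n)

/-- The jump times almost surely do not accumulate. -/
theorem ae_exists_lt_T {M : Model d 𝕌} (hjump : M.FiniteJumps) (U : M.Policy) (x : M.E) :
    ∀ᵐ ω ∂(law U x), ∀ t : ℝ≥0, ∃ n, (t : ℝ≥0∞) < T n ω := by
  have h : ∀ᵐ ω ∂(law U x), ∀ m : ℕ,
      (∑' i : ℕ, {ω' : M.Path | T (i + 1) ω' ≤ (m : ℝ≥0)}.indicator 1 ω : ℝ≥0∞) < ∞ := by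
    rw [ae_all_iff]
    intro m
    refine ae_lt_top ?_ (hjump x U m).ne
    exact Measurable.tsum fun i =>
      measurable_one.indicator (measurableSet_le (measurable_T _) measurable_const)
  filter_upwards [h] with ω hω t
  obtain ⟨m, hm⟩ := exists_nat_ge t
  have hfin := ENNReal.finite_const_le_of_tsum_ne_top (hω m).ne one_ne_zero
  obtain ⟨i, hi⟩ := hfin.exists_notMem
  refine ⟨i + 1, lt_of_le_of_lt (ENNReal.coe_le_coe.mpr hm) ?_⟩
  by_contra hcon
  refine hi ?_
  have hmem : ω ∈ {ω' : M.Path | T (i + 1) ω' ≤ (m : ℝ≥0)} := not_lt.mp hcon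
  simp only [Set.mem_ofPred_eq]
  rw [Set.indicator_of_mem hmem, Pi.one_apply]

/-! ### The process between the jumps -/

theorem N_eq {M : Model d 𝕌} {ω : M.Path} {s : ℝ≥0} {n : ℕ} (h₁ : T n ω ≤ s)
    (h₂ : (s : ℝ≥0∞) < T (n + 1) ω) : N s ω = n := by
  refine le_antisymm (Nat.sInf_le h₂) (le_csInf ⟨n, h₂⟩ fun m hm => ?_)
  by_contra hlt
  have : T (m + 1) ω ≤ T n ω := monotone_T ω (by omega)
  exact absurd (lt_of_lt_of_le hm (this.trans h₁)) (lt_irrefl _)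

theorem T_N_le {M : Model d 𝕌} (ω : M.Path) {s : ℝ≥0} {m : ℕ} (hm : (s : ℝ≥0∞) < T m ω) :
    T (N s ω) ω ≤ s ∧ (s : ℝ≥0∞) < T (N s ω + 1) ω := by
  have hne : {n | (s : ℝ≥0∞) < T (n + 1) ω}.Nonempty :=
    ⟨m, hm.trans_le (monotone_T ω (Nat.le_succ m))⟩
  refine ⟨?_, Nat.sInf_mem hne⟩
  rcases Nat.eq_zero_or_pos (N s ω) with h0 | hpos
  · rw [h0, T_zero]
    exact zero_le
  · have : N s ω - 1 ∉ {n | (s : ℝ≥0∞) < T (n + 1) ω} := Nat.notMem_of_lt_sInf (by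
      change N s ω - 1 < N s ω
      omega)
    have h' : ¬ (s : ℝ≥0∞) < T (N s ω - 1 + 1) ω := this
    rw [Nat.sub_add_cancel hpos] at h'
    exact not_lt.mp h'

theorem sum_timeStep {M : Model d 𝕌} (t : ℝ≥0) (ω : M.Path) (m : ℕ) :
    ∑ i ∈ Finset.range m, timeStep t (T i ω) (ω (i + 1)) = min (T m ω) t := by
  induction m with
  | zero => simp [T_zero]
  | succ m ih =>
    rw [Finset.sum_range_succ, ih, T_succ, timeStep]
    rcases le_total (T m ω) t with h | h
    · rw [min_eq_left h, ← min_add_add_left, add_tsub_cancel_of_le h]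
    · rw [min_eq_right h, tsub_eq_zero_of_le h, min_eq_right zero_le, add_zero,
        min_eq_right (h.trans le_self_add)]

theorem boundaryCost_eq {M : Model d 𝕌} (U : M.Policy) (t : ℝ≥0) (ω : M.Path) :
    boundaryCost U t ω = ∑' n, boundaryStep U n t (T n ω) (Z n ω) (ω (n + 1)) := by
  classical
  refine tsum_congr fun n => ?_
  rw [boundaryStep]
  exact if_congr (by rw [T_succ]) rfl rfl

theorem runningCost_eq {M : Model d 𝕌} (U : M.Policy) (t : ℝ≥0) {ω : M.Path}
    (hω : ∀ s : ℝ≥0, ∃ n, (s : ℝ≥0∞) < T n ω) :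
    runningCost U t ω = ∑' n, runStep U n t (T n ω) (Z n ω) (ω (n + 1)) := by
  classical
  let c : ℕ → ℝ≥0 → ℝ≥0∞ := fun n s => (M.f (M.φ (Z n ω) s, U.u n (Z n ω) s) : ℝ≥0∞)
  have hc : ∀ n, Measurable (c n) := fun n => (M.measurable_f.comp
    ((M.measurable_flow _).prodMk (U.measurable_control n _))).coe_nnreal_ennreal
  let g : ℕ → ℝ≥0 → ℝ≥0∞ := fun n =>
    {s : ℝ≥0 | T n ω ≤ s ∧ (s : ℝ≥0∞) < T (n + 1) ω}.indicator fun s => c n (s - (T n ω).toNNReal)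
  have hg : ∀ n, Measurable (g n) := fun n => by
    refine Measurable.indicator ((hc n).comp (by fun_prop)) ?_
    exact (measurable_coe_nnreal_ennreal measurableSet_Ici).inter
      (measurable_coe_nnreal_ennreal measurableSet_Iio)
  have hsum : ∀ s : ℝ≥0,
      (M.f (state s ω, U.u (N s ω) (Z (N s ω) ω) (elapsed s ω)) : ℝ≥0∞) = ∑' n, g n s := by
    intro s
    obtain ⟨m, hm⟩ := hω s
    have hN := T_N_le ω hm
    rw [tsum_eq_single (N s ω)]
    · have hs : s ∈ {s' : ℝ≥0 | T (N s ω) ω ≤ s' ∧ (s' : ℝ≥0∞) < T (N s ω + 1) ω} := hN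
      exact (Set.indicator_of_mem hs fun r => c (N s ω) (r - (T (N s ω) ω).toNNReal)).symm
    · intro n hn
      have hns : s ∉ {s : ℝ≥0 | T n ω ≤ s ∧ (s : ℝ≥0∞) < T (n + 1) ω} :=
        fun h => hn (N_eq h.1 h.2).symm
      exact Set.indicator_of_notMem hns _
  have hset : ({s : ℝ≥0 | s ≤ t} : Set ℝ≥0) =ᵐ[leb] before t := by
    have ht : ∀ᵐ s ∂leb, s ≠ t := by
      rw [ae_iff]
      simp
    filter_upwards [ht] with s hs
    refine propext ⟨fun h => ?_, fun h => (ENNReal.coe_lt_coe.mp h).le⟩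
    exact ENNReal.coe_lt_coe.mpr (lt_of_le_of_ne h hs)
  rw [runningCost, setLIntegral_congr hset]
  simp only [hsum]
  rw [lintegral_tsum fun n => (hg n).aemeasurable]
  refine tsum_congr fun n => ?_
  rw [runStep]
  -- the `n`-th term is supported in the `n`-th sojourn, which starts at `T n`
  rcases le_or_gt (t : ℝ≥0∞) (T n ω) with h | h
  · rw [tsub_eq_zero_of_le h, min_eq_right zero_le]
    have h0 : before 0 = ∅ := by ext s; simp [before]
    rw [h0, Measure.restrict_empty, lintegral_zero_measure, ← lintegral_zero (μ := leb.restrict _)]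
    refine setLIntegral_congr_fun (measurableSet_before _) fun s hs => ?_
    refine Set.indicator_of_notMem (fun h' => ?_) _
    exact absurd (lt_of_lt_of_le hs (h.trans h'.1)) (lt_irrefl _)
  · obtain ⟨τ, hτ⟩ : ∃ τ : ℝ≥0, T n ω = τ :=
      ⟨(T n ω).toNNReal, (ENNReal.coe_toNNReal (h.trans_le le_top).ne).symm⟩
    have hsplit : (t : ℝ≥0∞) = τ + (t - τ) := by
      rw [hτ] at h
      exact (add_tsub_cancel_of_le h.le).symm
    have hfirst : ∫⁻ s in before τ, g n s ∂leb = 0 := by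
      rw [← lintegral_zero (μ := leb.restrict _)]
      refine setLIntegral_congr_fun (measurableSet_before _) fun s hs => ?_
      refine Set.indicator_of_notMem (fun h' => ?_) _
      have h1 := h'.1
      rw [hτ] at h1
      exact absurd (lt_of_lt_of_le hs h1) (lt_irrefl _)
    have hsecond : ∀ s, g n (τ + s) = (before (ω (n + 1)).1).indicator (c n) s := by
      intro s
      simp only [g, Set.indicator_apply, Set.mem_ofPred_eq, T_succ, hτ, ENNReal.toNNReal_coe,
        add_tsub_cancel_left, before]
      refine if_congr ?_ rfl rfl
      rw [ENNReal.coe_add, ENNReal.add_lt_add_iff_left ENNReal.coe_ne_top]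
      exact and_iff_right le_self_add
    have hinter : before (min (ω (n + 1)).1 (t - τ)) = before (ω (n + 1)).1 ∩ before (t - τ) := by
      ext s; simp [before]
    rw [hτ, hinter]
    conv_lhs => rw [hsplit]
    rw [setLIntegral_before_add, hfirst, zero_add]
    simp only [hsecond]
    rw [lintegral_indicator (measurableSet_before _),
      Measure.restrict_restrict (measurableSet_before _)]

/-- The state at the time `t ∧ T m`, decomposed according to the sojourn that contains `t`. -/
theorem apply_stopped {M : Model d 𝕌} (g : Space d → ℝ≥0∞) (t : ℝ≥0) (m : ℕ) {ω : M.Path}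
    (hω : ∀ n, 0 < (ω (n + 1)).1) :
    g (stopped t m ω) = ∑ i ∈ Finset.range m, stayStep g t (T i ω) (Z i ω) (ω (i + 1))
      + open Classical in if T m ω ≤ t then g (Z m ω) else 0 := by
  classical
  by_cases h : T m ω ≤ t
  · have hsum : ∑ i ∈ Finset.range m, stayStep g t (T i ω) (Z i ω) (ω (i + 1)) = 0 := by
      refine Finset.sum_eq_zero fun i hi => if_neg fun h' => ?_
      have h1 : T (i + 1) ω ≤ t := (monotone_T ω (Finset.mem_range.mp hi)).trans h
      rw [T_succ] at h1
      exact absurd h'.2 (not_lt.mpr h1)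
    have hfin : T m ω ≠ ∞ := ne_top_of_le_ne_top ENNReal.coe_ne_top h
    have hN : N (T m ω).toNNReal ω = m := by
      refine N_eq ?_ ?_
      · rw [ENNReal.coe_toNNReal hfin]
      · rw [ENNReal.coe_toNNReal hfin, T_succ]
        exact ENNReal.lt_add_right hfin (hω m).ne'
    have hst : stopped t m ω = Z m ω := by
      rw [stopped, min_eq_right h, state, elapsed, hN, tsub_self, M.φ_zero]
    rw [hsum, if_pos h, zero_add, hst]
  · have hlt : (t : ℝ≥0∞) < T m ω := not_le.mp h
    obtain ⟨h1, h2⟩ := T_N_le ω hlt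
    have hst : stopped t m ω = M.φ (Z (N t ω) ω) (t - (T (N t ω) ω).toNNReal) := by
      rw [stopped, min_eq_left hlt.le, ENNReal.toNNReal_coe]
      rfl
    have hmem : N t ω ∈ Finset.range m := by
      refine Finset.mem_range.mpr ?_
      by_contra hcon
      exact absurd (hlt.trans_le (monotone_T ω (not_lt.mp hcon))) (not_lt.mpr h1)
    rw [if_neg h, add_zero, Finset.sum_eq_single_of_mem _ hmem, hst]
    · refine (if_pos ⟨h1, ?_⟩).symm
      rw [← T_succ]
      exact h2
    · intro i _ hi
      refine if_neg fun h' => hi ?_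
      refine (N_eq h'.1 ?_).symm
      rw [T_succ]
      exact h'.2

/-! ### The expected balance over the first jumps -/

/-- The value of `k` at the location `z` after a jump at the time `T`, if that jump happens up to
`t`. -/
noncomputable def startStep {M : Model d 𝕌} (k : Space d → ℝ≥0∞) (t : ℝ≥0) (T : ℝ≥0∞) (z : M.E) :
    ℝ≥0∞ :=
  open Classical in if T ≤ t then k z else 0

/-- The cost incurred up to `t` between two jumps, the first excluded and the second included. -/
noncomputable def costStep {M : Model d 𝕌} (U : M.Policy) (n : ℕ) (t : ℝ≥0) (T : ℝ≥0∞) (z : M.E)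
    (y : ℝ≥0∞ × M.E) : ℝ≥0∞ :=
  runStep U n t T z y + boundaryStep U n t T z y

theorem startStep_succ {M : Model d 𝕌} (k : Space d → ℝ≥0∞) (t : ℝ≥0) (n : ℕ) (ω : M.Path) :
    startStep k t (T (n + 1) ω) (Z (n + 1) ω) = jumpStep k t (T n ω) (ω (n + 1)) := by
  rw [startStep, jumpStep, T_succ]
  rfl

section Measurability

variable {M : Model d 𝕌} (U : M.Policy) (n : ℕ) (t : ℝ≥0)

theorem measurable_startStep {k : Space d → ℝ≥0∞} (hk : Measurable k) :
    Measurable fun p : ℝ≥0∞ × M.E => startStep k t p.1 p.2 := by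
  unfold startStep
  exact Measurable.ite (measurable_fst measurableSet_Iic)
    (hk.comp (measurable_subtype_coe.comp measurable_snd)) measurable_const

theorem measurable_costStep :
    Measurable fun p : ℝ≥0∞ × M.E × (ℝ≥0∞ × M.E) => costStep U n t p.1 p.2.1 p.2.2 :=
  (measurable_runStep U n t).add (measurable_boundaryStep U n t)

theorem measurable_section {F : ℝ≥0∞ × M.E × (ℝ≥0∞ × M.E) → ℝ≥0∞} (hF : Measurable F) (T : ℝ≥0∞)
    (z : M.E) : Measurable fun y => F (T, z, y) :=
  hF.comp (by fun_prop)

end Measurability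

section Balance

variable {M : Model d 𝕌} (U : M.Policy)

/-- The expected costs and terminal value of one sojourn, cut off at `t`. -/
theorem lintegral_gain {k : Space d → ℝ≥0∞} (hk : Measurable k) (n : ℕ) (z : M.E) {t : ℝ≥0}
    {T : ℝ≥0∞} (hT : T ≤ t) :
    ∫⁻ y, (costStep U n t T z y + stayStep k t T z y + jumpStep k t T y) ∂(stepKernel U n z)
      = M.stageStop k z (U.control n z) (t - T.toNNReal) := by
  have hr := measurable_section (measurable_runStep U n t) T z
  have hc := measurable_section (measurable_costStep U n t) T z
  have hs := measurable_section (M := M) (measurable_stayStep t hk) T z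
  have hcs : Measurable fun y => costStep U n t T z y + stayStep k t T z y := hc.add hs
  rw [← lintegral_step_eq_stageStop U n z hk hT, lintegral_add_left hcs,
    lintegral_add_left hc]
  simp only [costStep]
  rw [lintegral_add_left hr]

/-- The expected loss of one sojourn: the initial value of `k`, and the rate `ρ` per unit of time. -/
theorem lintegral_loss {k : Space d → ℝ≥0∞} (ρ : ℝ≥0) (n : ℕ) (z : M.E) {t : ℝ≥0} {T : ℝ≥0∞}
    (hT : T ≤ t) :
    ∫⁻ y, (startStep k t T z + ρ * timeStep t T y) ∂(stepKernel U n z)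
      = k z + ρ * M.stage 1 z (U.u n z)
          (min ((t - T.toNNReal : ℝ≥0) : ℝ≥0∞) (M.tstar z)) := by
  have ht := measurable_section (M := M) (measurable_timeStep t) T z
  rw [lintegral_add_left measurable_const, lintegral_const, measure_univ, mul_one,
    lintegral_const_mul _ ht, lintegral_timeStep U n z hT, startStep, if_pos hT]

theorem lintegral_loss_le_gain {ρ : ℝ≥0} {k : Space d → ℝ≥0∞} (hk : Measurable k)
    (hsub : M.IsSubsolution ρ k) (hex : ∀ y ∈ M.E, ∃ Υ ∈ M.V y, M.IsMinimizer ρ k y Υ)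
    (n : ℕ) (z : M.E) (t : ℝ≥0) (T : ℝ≥0∞) :
    ∫⁻ y, (startStep k t T z + ρ * timeStep t T y) ∂(stepKernel U n z)
      ≤ ∫⁻ y, (costStep U n t T z y + stayStep k t T z y + jumpStep k t T y) ∂(stepKernel U n z) := by
  by_cases hT : T ≤ t
  · rw [lintegral_loss U ρ n z hT, lintegral_gain U hk n z hT]
    exact hsub.le_stageStop hex z.2 (U.control_mem n z) _
  · have h : ∀ y : ℝ≥0∞ × M.E, startStep k t T z + ρ * timeStep t T y = 0 := fun y => by
      rw [startStep, if_neg hT, timeStep, tsub_eq_zero_of_le (not_le.mp hT).le, min_zero, mul_zero,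
        add_zero]
    simp only [h, lintegral_zero]
    exact zero_le

theorem lintegral_gain_le_loss {ρ : ℝ≥0} {k : Space d → ℝ≥0∞} (hk : Measurable k)
    (hsub : M.IsSubsolution ρ k) (n : ℕ) (z : M.E) (hmin : M.IsMinimizer ρ k z (U.control n z))
    (t : ℝ≥0) (T : ℝ≥0∞) :
    ∫⁻ y, (costStep U n t T z y + stayStep k t T z y + jumpStep k t T y) ∂(stepKernel U n z)
      ≤ ∫⁻ y, (startStep k t T z + ρ * timeStep t T y) ∂(stepKernel U n z) := by
  by_cases hT : T ≤ t
  · rw [lintegral_loss U ρ n z hT, lintegral_gain U hk n z hT]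
    exact hsub.stageStop_le z.2 (U.control_mem n z) hmin _
  · have hT' : ∀ S : ℝ≥0∞, ¬ T + S ≤ t := fun S h => hT (le_self_add.trans h)
    have h0 : before 0 = ∅ := by ext s; simp [before]
    have h : ∀ y : ℝ≥0∞ × M.E,
        costStep U n t T z y + stayStep k t T z y + jumpStep k t T y = 0 := fun y => by
      simp [costStep, runStep, boundaryStep, stayStep, jumpStep, hT, hT',
        tsub_eq_zero_of_le (not_le.mp hT).le, h0]
    simp only [h, lintegral_zero]
    exact zero_le

variable (x : M.E)

theorem lintegral_lintegral_loss {k : Space d → ℝ≥0∞} (hk : Measurable k) (ρ : ℝ≥0) (n : ℕ) (t : ℝ≥0) :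
    ∫⁻ ω, ∫⁻ y, (startStep k t (T n ω) (Z n ω) + ρ * timeStep t (T n ω) y)
        ∂(stepKernel U n (Z n ω)) ∂(law U x)
      = ∫⁻ ω, startStep k t (T n ω) (Z n ω) ∂(law U x)
        + ρ * ∫⁻ ω, timeStep t (T n ω) (ω (n + 1)) ∂(law U x) := by
  have hst := (measurable_startStep (M := M) t hk).comp
    (by fun_prop : Measurable fun p : ℝ≥0∞ × M.E × (ℝ≥0∞ × M.E) => (p.1, p.2.1))
  have hti := measurable_timeStep (M := M) t
  have hst' : Measurable fun ω : M.Path => startStep k t (T n ω) (Z n ω) :=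
    hst.comp (measurable_T_Z_next n)
  have hti' : Measurable fun ω : M.Path => timeStep t (T n ω) (ω (n + 1)) :=
    hti.comp (measurable_T_Z_next n)
  rw [← lintegral_const_mul _ hti', ← lintegral_add_left hst']
  exact (lintegral_law_next U x n (hst.add (hti.const_mul (ρ : ℝ≥0∞)))).symm

theorem lintegral_lintegral_gain {k : Space d → ℝ≥0∞} (hk : Measurable k) (n : ℕ) (t : ℝ≥0) :
    ∫⁻ ω, ∫⁻ y, (costStep U n t (T n ω) (Z n ω) y + stayStep k t (T n ω) (Z n ω) y
        + jumpStep k t (T n ω) y) ∂(stepKernel U n (Z n ω)) ∂(law U x)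
      = ∫⁻ ω, costStep U n t (T n ω) (Z n ω) (ω (n + 1)) ∂(law U x)
        + ∫⁻ ω, stayStep k t (T n ω) (Z n ω) (ω (n + 1)) ∂(law U x)
        + ∫⁻ ω, startStep k t (T (n + 1) ω) (Z (n + 1) ω) ∂(law U x) := by
  have hc := measurable_costStep U n t
  have hs := measurable_stayStep (M := M) t hk
  have hj := measurable_jumpStep (M := M) t hk
  have hc' : Measurable fun ω : M.Path => costStep U n t (T n ω) (Z n ω) (ω (n + 1)) :=
    hc.comp (measurable_T_Z_next n)
  have hs' : Measurable fun ω : M.Path => stayStep k t (T n ω) (Z n ω) (ω (n + 1)) :=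
    hs.comp (measurable_T_Z_next n)
  have hcs' : Measurable fun ω : M.Path => costStep U n t (T n ω) (Z n ω) (ω (n + 1))
      + stayStep k t (T n ω) (Z n ω) (ω (n + 1)) := hc'.add hs'
  simp only [startStep_succ]
  rw [← lintegral_add_left hc', ← lintegral_add_left hcs']
  exact (lintegral_law_next U x n ((hc.add hs).add hj)).symm

theorem lintegral_startStep_zero {k : Space d → ℝ≥0∞} (hk : Measurable k) (t : ℝ≥0) :
    ∫⁻ ω, startStep k t (T 0 ω) (Z 0 ω) ∂(law U x) = k x := by
  simp only [startStep, T_zero, zero_le, if_true]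
  exact lintegral_law_zero U x (F := fun y => k y.2) (hk.comp (by fun_prop))

/-- The expectation of the value of `k` at the time `t ∧ T m`. -/
theorem lintegral_stopped {k : Space d → ℝ≥0∞} (hk : Measurable k) (t : ℝ≥0) (m : ℕ) :
    ∫⁻ ω, k (stopped t m ω) ∂(law U x)
      = ∑ i ∈ Finset.range m, ∫⁻ ω, stayStep k t (T i ω) (Z i ω) (ω (i + 1)) ∂(law U x)
        + ∫⁻ ω, startStep k t (T m ω) (Z m ω) ∂(law U x) := by
  have hs : ∀ i, Measurable fun ω : M.Path => stayStep k t (T i ω) (Z i ω) (ω (i + 1)) := fun i =>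
    (measurable_stayStep (M := M) t hk).comp (measurable_T_Z_next i)
  rw [← lintegral_finsetSum _ fun i _ => hs i,
    ← lintegral_add_left (Finset.measurable_sum _ fun i _ => hs i)]
  refine lintegral_congr_ae ?_
  filter_upwards [ae_sojourn U x] with ω hω
  exact apply_stopped k t m fun n => (hω n).1

theorem aemeasurable_stopped {k : Space d → ℝ≥0∞} (hk : Measurable k) (t : ℝ≥0) (m : ℕ) :
    AEMeasurable (fun ω => k (stopped t m ω)) (law U x) := by
  have hs : ∀ i, Measurable fun ω : M.Path => stayStep k t (T i ω) (Z i ω) (ω (i + 1)) := fun i =>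
    (measurable_stayStep (M := M) t hk).comp (measurable_T_Z_next i)
  have hst : Measurable fun ω : M.Path => startStep k t (T m ω) (Z m ω) :=
    (measurable_startStep (M := M) t hk).comp ((measurable_T m).prodMk (measurable_Z m))
  refine ⟨fun ω => ∑ i ∈ Finset.range m, stayStep k t (T i ω) (Z i ω) (ω (i + 1))
    + startStep k t (T m ω) (Z m ω), (Finset.measurable_sum _ fun i _ => hs i).add hst, ?_⟩
  filter_upwards [ae_sojourn U x] with ω hω
  exact apply_stopped k t m fun n => (hω n).1

/-- The state at the time `t ∧ T m` almost surely lies in `E`: a sojourn lasts at most `t_*`. -/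
theorem ae_stopped_mem (t : ℝ≥0) (m : ℕ) : ∀ᵐ ω ∂(law U x), stopped t m ω ∈ M.E := by
  classical
  filter_upwards [ae_sojourn U x] with ω hω
  have h := apply_stopped (M.Eᶜ.indicator 1) t m fun n => (hω n).1
  have h0 : ∀ i, stayStep (M.Eᶜ.indicator 1) t (T i ω) (Z i ω) (ω (i + 1)) = 0 := by
    intro i
    refine ite_eq_right_iff.mpr fun h' => ?_
    have hlt : ((t - (T i ω).toNNReal : ℝ≥0) : ℝ≥0∞) < M.tstar (Z i ω) := by
      refine lt_of_lt_of_le ?_ (hω i).2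
      rw [← not_le, ← le_sub_iff_of_le h'.1]
      exact not_le.mpr h'.2
    have hn : M.φ (Z i ω) (t - (T i ω).toNNReal) ∉ M.Eᶜ := not_not.mpr (M.flow_mem (Z i ω).2 hlt)
    exact Set.indicator_of_notMem hn _
  have h1 : M.Eᶜ.indicator (1 : Space d → ℝ≥0∞) (Z m ω) = 0 :=
    Set.indicator_of_notMem (not_not.mpr (Z m ω).2) _
  simp only [h0, h1, Finset.sum_const_zero, ite_self, add_zero] at h
  by_contra hcon
  rw [Set.indicator_of_mem (show stopped t m ω ∈ M.Eᶜ from hcon)] at h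
  exact one_ne_zero h

theorem lintegral_sum_timeStep (t : ℝ≥0) (m : ℕ) :
    ∑ i ∈ Finset.range m, ∫⁻ ω, timeStep t (T i ω) (ω (i + 1)) ∂(law U x)
      = ∫⁻ ω, min (T m ω) t ∂(law U x) := by
  have ht : ∀ i, Measurable fun ω : M.Path => timeStep t (T i ω) (ω (i + 1)) := fun i =>
    (measurable_timeStep (M := M) t).comp (measurable_T_Z_next i)
  rw [← lintegral_finsetSum _ fun i _ => ht i]
  exact lintegral_congr fun ω => sum_timeStep t ω m

theorem lintegral_cost (hjump : M.FiniteJumps) (t : ℝ≥0) :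
    ∫⁻ ω, (runningCost U t ω + boundaryCost U t ω) ∂(law U x)
      = ∑' n, ∫⁻ ω, costStep U n t (T n ω) (Z n ω) (ω (n + 1)) ∂(law U x) := by
  have hc : ∀ n, Measurable fun ω : M.Path => costStep U n t (T n ω) (Z n ω) (ω (n + 1)) :=
    fun n => (measurable_costStep U n t).comp (measurable_T_Z_next n)
  rw [← lintegral_tsum fun n => (hc n).aemeasurable]
  refine lintegral_congr_ae ?_
  filter_upwards [ae_exists_lt_T hjump U x] with ω hω
  rw [runningCost_eq U t hω, boundaryCost_eq, ← ENNReal.tsum_add]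
  rfl

theorem iSup_lintegral_min_T (hjump : M.FiniteJumps) (t : ℝ≥0) :
    ⨆ m, ∫⁻ ω, min (T m ω) t ∂(law U x) = t := by
  rw [← lintegral_iSup (fun m => (measurable_T m).min measurable_const)
    fun a b hab ω => min_le_min_right _ (monotone_T ω hab)]
  have h : ∀ᵐ ω ∂(law U x), ⨆ m, min (T m ω) (t : ℝ≥0∞) = t := by
    filter_upwards [ae_exists_lt_T hjump U x] with ω hω
    obtain ⟨n, hn⟩ := hω t
    refine le_antisymm (iSup_le fun m => min_le_right _ _) ?_
    exact le_iSup_of_le n (le_min hn.le le_rfl)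
  rw [lintegral_congr_ae h, lintegral_const, measure_univ, mul_one]

/-- The optimality inequality, summed over the first `m` sojourns. -/
theorem le_sum_cost_add_stopped {ρ : ℝ≥0} {k : Space d → ℝ≥0∞} (hk : Measurable k)
    (hsub : M.IsSubsolution ρ k) (hex : ∀ y ∈ M.E, ∃ Υ ∈ M.V y, M.IsMinimizer ρ k y Υ)
    (t : ℝ≥0) (m : ℕ) :
    k x + ρ * ∫⁻ ω, min (T m ω) t ∂(law U x)
      ≤ ∑ i ∈ Finset.range m, ∫⁻ ω, costStep U i t (T i ω) (Z i ω) (ω (i + 1)) ∂(law U x)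
        + ∫⁻ ω, k (stopped t m ω) ∂(law U x) := by
  rw [← lintegral_sum_timeStep, lintegral_stopped U x hk, ← lintegral_startStep_zero U x hk t]
  induction m with
  | zero => simp
  | succ m ih =>
    have hstep := lintegral_mono (μ := law U x) fun ω =>
      lintegral_loss_le_gain U hk hsub hex m (Z m ω) t (T m ω)
    rw [lintegral_lintegral_loss U x hk, lintegral_lintegral_gain U x hk] at hstep
    rw [Finset.sum_range_succ, Finset.sum_range_succ, Finset.sum_range_succ, mul_add, ← add_assoc]
    refine (add_le_add_left ih _).trans ?_
    rw [← add_assoc, add_assoc (_ + _)]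
    refine (add_le_add_right hstep _).trans (le_of_eq ?_)
    ring

/-- The reverse inequality, for a policy that uses minimizing controls only. -/
theorem sum_cost_add_stopped_le {ρ : ℝ≥0} {k : Space d → ℝ≥0∞} (hk : Measurable k)
    (hsub : M.IsSubsolution ρ k) (hmin : ∀ n (z : M.E), M.IsMinimizer ρ k z (U.control n z))
    (t : ℝ≥0) (m : ℕ) :
    ∑ i ∈ Finset.range m, ∫⁻ ω, costStep U i t (T i ω) (Z i ω) (ω (i + 1)) ∂(law U x)
        + ∫⁻ ω, k (stopped t m ω) ∂(law U x)
      ≤ k x + ρ * ∫⁻ ω, min (T m ω) t ∂(law U x) := by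
  rw [← lintegral_sum_timeStep, lintegral_stopped U x hk, ← lintegral_startStep_zero U x hk t]
  induction m with
  | zero => simp
  | succ m ih =>
    have hstep := lintegral_mono (μ := law U x) fun ω =>
      lintegral_gain_le_loss U hk hsub m (Z m ω) (hmin m (Z m ω)) t (T m ω)
    rw [lintegral_lintegral_loss U x hk, lintegral_lintegral_gain U x hk] at hstep
    rw [Finset.sum_range_succ, Finset.sum_range_succ, Finset.sum_range_succ, mul_add,
      ← add_assoc (∫⁻ ω, startStep k t (T 0 ω) (Z 0 ω) ∂(law U x))]
    refine le_trans ?_ (add_le_add_left ih _)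
    rw [← add_assoc (Finset.sum _ _) (Finset.sum _ _), add_assoc (_ + _)]
    refine le_trans (le_of_eq ?_) (add_le_add_right hstep _)
    ring

end Balance

/-! ### Bounds on the average cost -/

section AverageCost

variable {M : Model d 𝕌} (U : M.Policy) (x : M.E)

/-- A bound on `E[h(X(t ∧ T m))]`, a difference in `EReal`, as a bound on the integral of
`h + c ≥ 0`. -/
theorem lintegral_stopped_le {h : Space d → ℝ} (hmeas : Measurable h) {c : ℝ≥0}
    (hc : ∀ x ∈ M.E, 0 ≤ h x + c) {t : ℝ≥0} {m : ℕ} {b : ℝ≥0}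
    (hb : expStopped U h x t m < ((b : ℝ≥0∞) : EReal)) :
    ∫⁻ ω, ENNReal.ofReal (h (stopped t m ω) + c) ∂(law U x) ≤ b + c := by
  have hadd : ∫⁻ ω, ENNReal.ofReal (h (stopped t m ω) + c) ∂(law U x)
      + ∫⁻ ω, ENNReal.ofReal (-h (stopped t m ω)) ∂(law U x)
      = ∫⁻ ω, ENNReal.ofReal (h (stopped t m ω)) ∂(law U x) + c := by
    have hc' : ∫⁻ _, (c : ℝ≥0∞) ∂(law U x) = c := by rw [lintegral_const, measure_univ, mul_one]
    rw [← lintegral_add_left' (aemeasurable_stopped U x (hmeas.add_const _).ennreal_ofReal t m)]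
    conv_rhs => rw [← hc']
    rw [← lintegral_add_left' (aemeasurable_stopped U x hmeas.ennreal_ofReal t m)]
    refine lintegral_congr_ae ?_
    filter_upwards [ae_stopped_mem U x t m] with ω hω
    exact ofReal_add_add_ofReal_neg (hc _ hω)
  have hneg : ∫⁻ ω, ENNReal.ofReal (-h (stopped t m ω)) ∂(law U x) ≤ c := by
    refine (lintegral_mono_ae (g := fun _ => (c : ℝ≥0∞)) ?_).trans_eq (by
      rw [lintegral_const, measure_univ, mul_one])
    filter_upwards [ae_stopped_mem U x t m] with ω hω
    rw [← ENNReal.ofReal_coe_nnreal]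
    exact ENNReal.ofReal_le_ofReal (by linarith [hc _ hω])
  rw [expStopped] at hb
  generalize ∫⁻ ω, ENNReal.ofReal (h (stopped t m ω)) ∂(law U x) = P at *
  generalize ∫⁻ ω, ENNReal.ofReal (-h (stopped t m ω)) ∂(law U x) = R at *
  lift R to ℝ≥0 using ne_top_of_le_ne_top ENNReal.coe_ne_top hneg
  have hP : P ≤ b + R := by
    have h1 := (EReal.sub_lt_iff (Or.inl (EReal.coe_ennreal_ne_bot _))
      (Or.inl (by simp))).mp hb
    rw [← EReal.coe_ennreal_add] at h1
    exact (EReal.coe_ennreal_lt_coe_ennreal_iff.mp h1).le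
  refine (ENNReal.add_le_add_iff_right (ENNReal.coe_ne_top (r := R))).mp ?_
  rw [hadd]
  calc P + c ≤ b + R + c := add_le_add_left hP _
    _ = b + c + R := by ring

/-- No policy costs less than `ρ`. -/
theorem le_avgCost (hjump : M.FiniteJumps) {ρ : ℝ≥0} {h : Space d → ℝ} (hmeas : Measurable h)
    {c : ℝ≥0} (hc : ∀ x ∈ M.E, 0 ≤ h x + c)
    (hsub : M.IsSubsolution ρ fun y => ENNReal.ofReal (h y + c))
    (hex : ∀ y ∈ M.E, ∃ Υ ∈ M.V y, M.IsMinimizer ρ (fun y => ENNReal.ofReal (h y + c)) y Υ)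
    (hgrowth : limsup (fun t : ℝ≥0 => limsup (fun m : ℕ => expStopped U h x t m) atTop
      / ((t : ℝ) : EReal)) atTop = 0) :
    (ρ : ℝ≥0∞) ≤ avgCost U x := by
  have hk : Measurable fun y => ENNReal.ofReal (h y + c) := (hmeas.add_const _).ennreal_ofReal
  -- the summed optimality inequalities, in the limit `m → ∞`
  have hbound : ∀ (t b : ℝ≥0), limsup (fun m : ℕ => expStopped U h x t m) atTop
      < ((b : ℝ≥0∞) : EReal) →
      (ρ : ℝ≥0∞) * t ≤ ∫⁻ ω, (runningCost U t ω + boundaryCost U t ω) ∂(law U x) + (b + c) := by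
    intro t b hb
    have hev := eventually_lt_of_limsup_lt hb
    obtain ⟨m₀, hm₀⟩ := eventually_atTop.mp hev
    rw [← iSup_lintegral_min_T U x hjump t, ENNReal.mul_iSup]
    refine iSup_le fun m => ?_
    have hmono : ∫⁻ ω, min (T m ω) (t : ℝ≥0∞) ∂(law U x)
        ≤ ∫⁻ ω, min (T (max m m₀) ω) (t : ℝ≥0∞) ∂(law U x) :=
      lintegral_mono fun ω => min_le_min_right _ (monotone_T ω (le_max_left m m₀))
    calc (ρ : ℝ≥0∞) * ∫⁻ ω, min (T m ω) (t : ℝ≥0∞) ∂(law U x)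
        ≤ ENNReal.ofReal (h x + c) + ρ * ∫⁻ ω, min (T (max m m₀) ω) (t : ℝ≥0∞) ∂(law U x) :=
          (mul_le_mul_right hmono _).trans le_add_self
      _ ≤ _ := le_sum_cost_add_stopped U x hk hsub hex t (max m m₀)
      _ ≤ _ := by
          rw [lintegral_cost U x hjump]
          exact add_le_add (ENNReal.sum_le_tsum _)
            (lintegral_stopped_le U x hmeas hc (hm₀ _ (le_max_right m m₀)))
  refine ENNReal.le_of_forall_pos_le_add fun ε hε _ => ?_
  have hε2 : 0 < ε / 2 := half_pos hε
  have h1 : ∀ᶠ t : ℝ≥0 in atTop, limsup (fun m : ℕ => expStopped U h x t m) atTop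
      / ((t : ℝ) : EReal) < (((ε / 2 : ℝ≥0) : ℝ) : EReal) := by
    refine eventually_lt_of_limsup_lt ?_
    rw [hgrowth]
    exact_mod_cast hε2
  -- for such `t`, both the growth term and the shift `c` are at most `ε / 2 * t`
  have h2 : ∀ᶠ t : ℝ≥0 in atTop, c / (ε / 2) ≤ t := eventually_ge_atTop _
  rw [← tsub_le_iff_right]
  refine le_trans ?_ (liminf_le_limsup (f := atTop) (u := fun t : ℝ≥0 =>
    (∫⁻ ω, (runningCost U t ω + boundaryCost U t ω) ∂(law U x)) / (t : ℝ≥0∞)))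
  refine le_liminf_of_le (by isBoundedDefault) ?_
  filter_upwards [h1, h2, eventually_gt_atTop 0] with t ht1 ht2 ht0
  have ht0' : (0 : EReal) < ((t : ℝ) : EReal) := by exact_mod_cast ht0
  have hb : limsup (fun m : ℕ => expStopped U h x t m) atTop
      < (((ε / 2 * t : ℝ≥0) : ℝ≥0∞) : EReal) := by
    have := (EReal.div_lt_iff ht0' (EReal.coe_ne_top _)).mp ht1
    rw [← EReal.coe_mul, ← NNReal.coe_mul] at this
    exact this
  have hc2 : c ≤ ε / 2 * t := by
    rw [mul_comm]
    exact (div_le_iff₀ hε2).mp ht2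
  have hmain := hbound t _ hb
  rw [tsub_le_iff_right, ← ENNReal.mul_le_mul_iff_left (ENNReal.coe_ne_zero.mpr ht0.ne')
    ENNReal.coe_ne_top, add_mul, ENNReal.div_mul_cancel (ENNReal.coe_ne_zero.mpr ht0.ne')
    ENNReal.coe_ne_top]
  refine hmain.trans (add_le_add_right ?_ _)
  rw [← ENNReal.coe_add, ← ENNReal.coe_mul, ENNReal.coe_le_coe]
  calc ε / 2 * t + c ≤ ε / 2 * t + ε / 2 * t := add_le_add_right hc2 _
    _ = ε * t := by rw [← add_mul, add_halves]

/-- A policy that uses minimizing controls costs at most `ρ`. -/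
theorem avgCost_le (hjump : M.FiniteJumps) {ρ : ℝ≥0} {k : Space d → ℝ≥0∞} (hk : Measurable k)
    (hx : k x ≠ ∞) (hsub : M.IsSubsolution ρ k)
    (hmin : ∀ n (z : M.E), M.IsMinimizer ρ k z (U.control n z)) : avgCost U x ≤ ρ := by
  have hbound : ∀ t : ℝ≥0, ∫⁻ ω, (runningCost U t ω + boundaryCost U t ω) ∂(law U x)
      ≤ k x + ρ * t := by
    intro t
    rw [lintegral_cost U x hjump, ENNReal.tsum_eq_iSup_nat]
    refine iSup_le fun m => ?_
    refine (le_self_add.trans (sum_cost_add_stopped_le U x hk hsub hmin t m)).trans ?_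
    refine add_le_add_right (mul_le_mul_right ?_ _) _
    exact (le_iSup (fun m => ∫⁻ ω, min (T m ω) (t : ℝ≥0∞) ∂(law U x)) m).trans_eq
      (iSup_lintegral_min_T U x hjump t)
  refine ENNReal.le_of_forall_pos_le_add fun ε hε _ => ?_
  refine limsup_le_of_le (by isBoundedDefault) ?_
  filter_upwards [eventually_ge_atTop ((k x).toNNReal / ε), eventually_gt_atTop 0] with t ht ht0
  have hkt : k x ≤ ε * t := by
    rw [← ENNReal.coe_toNNReal hx, ← ENNReal.coe_mul, ENNReal.coe_le_coe, mul_comm]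
    exact (div_le_iff₀ hε).mp ht
  rw [ENNReal.div_le_iff (ENNReal.coe_ne_zero.mpr ht0.ne') ENNReal.coe_ne_top, add_mul, add_comm]
  exact (hbound t).trans (add_le_add_left hkt _)

end AverageCost

/-- A policy induced by `Γ` uses the controls of `Γ` up to null sets, and these do not affect the
one-stage functionals. -/
theorem Policy.IsInducedBy.isMinimizer {M : Model d 𝕌} {U : M.Policy} {Γ : M.E → OrdControl 𝕌 × 𝕌}
    (hU : U.IsInducedBy Γ) {ρ : ℝ≥0} {k : Space d → ℝ≥0∞}
    (hΓ : ∀ z : M.E, M.IsMinimizer ρ k z (Γ z)) (n : ℕ) (z : M.E) :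
    M.IsMinimizer ρ k z (U.control n z) := by
  obtain ⟨h2, h1⟩ := hU n z
  have h := hΓ z
  rw [IsMinimizer] at h ⊢
  rwa [M.calL_congr z (Υ := U.control n z) (Υ' := Γ z) h1,
    M.stageValue_congr k z (Υ := U.control n z) (Υ' := Γ z) h1 h2]

end Model

end PDMP

theorem theorem4p1 {d : ℕ} {𝕌 : Type*} [MetricSpace 𝕌] [CompactSpace 𝕌] [MeasurableSpace 𝕌]
    [BorelSpace 𝕌] (M : PDMP.Model d 𝕌) (hjump : M.FiniteJumps)
    (ρ : ℝ≥0) (h : PDMP.Space d → ℝ) (hmeas : Measurable h) (hbdd : ∃ c, ∀ x ∈ M.E, c ≤ h x)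
    -- the optimality equation
    (hopt : ∀ x : M.E, M.opT ρ h x = (h x : EReal))
    -- the growth condition
    (hgrowth : ∀ (U : M.Policy) (x : M.E),
      limsup (fun t : ℝ≥0 =>
        limsup (fun m : ℕ => PDMP.Model.expStopped U h x t m) atTop / ((t : ℝ) : EReal)) atTop = 0)
    -- the optimal measurable selector, a Borel map into the ordinary controls
    (Γ : M.E → PDMP.OrdControl 𝕌 × 𝕌) (hΓ_meas : Measurable Γ) (hΓ_mem : ∀ x : M.E, Γ x ∈ M.V x)
    (hΓ_opt : ∀ x : M.E, M.opT ρ h x = M.oneStage ρ h x (Γ x)) :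
    -- the policy built from the selector is admissible, after a change on a null set of times,
    -- and as it stands if the selector is jointly measurable
    (∃ U : M.Policy, U.IsInducedBy Γ ∧ ∀ n, U.u n = U.u 0) ∧
    (Measurable (fun p : M.E × ℝ≥0 => (Γ p.1).1 p.2) →
      ∃ U : M.Policy, ∀ n x, U.ub n x = (Γ x).2 ∧ ∀ t, U.u n x t = (Γ x).1 t) ∧
    -- it is optimal, and its cost is `ρ`
    (∀ U : M.Policy, U.IsInducedBy Γ →
      ∀ x : M.E, (ρ : ℝ≥0∞) = M.value x ∧ M.value x = PDMP.Model.avgCost U x) := by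
  refine ⟨M.exists_policy_isInducedBy hΓ_meas hΓ_mem,
    fun hjoint => M.exists_policy_eq hΓ_meas hΓ_mem hjoint, fun U hU x => ?_⟩
  obtain ⟨b, hb⟩ := hbdd
  obtain ⟨c, hc⟩ : ∃ c : ℝ≥0, ∀ x ∈ M.E, 0 ≤ h x + c := by
    refine ⟨(-b).toNNReal, fun x hx => ?_⟩
    linarith [hb x hx, Real.le_coe_toNNReal (-b)]
  have hsub : M.IsSubsolution ρ fun y => ENNReal.ofReal (h y + c) := fun y hy Υ hΥ => by
    refine (M.oneStage_shift ρ hmeas hc hy hΥ).1 ?_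
    rw [← hopt ⟨y, hy⟩]
    exact iInf₂_le Υ hΥ
  have hmin : ∀ z : M.E, M.IsMinimizer ρ (fun y => ENNReal.ofReal (h y + c)) z (Γ z) := fun z =>
    (M.oneStage_shift ρ hmeas hc z.2 (hΓ_mem z)).2 ((hΓ_opt z).symm.trans (hopt z))
  have hlower : ∀ U' : M.Policy, (ρ : ℝ≥0∞) ≤ PDMP.Model.avgCost U' x := fun U' =>
    PDMP.Model.le_avgCost U' x hjump hmeas hc hsub
      (fun y hy => ⟨Γ ⟨y, hy⟩, hΓ_mem ⟨y, hy⟩, hmin ⟨y, hy⟩⟩) (hgrowth U' x)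
  have hupper : PDMP.Model.avgCost U x ≤ ρ :=
    PDMP.Model.avgCost_le U x hjump (hmeas.add_const _).ennreal_ofReal
      ENNReal.ofReal_ne_top hsub (hU.isMinimizer hmin)
  have hvalue : (ρ : ℝ≥0∞) = M.value x :=
    le_antisymm (le_iInf hlower) ((iInf_le _ U).trans hupper)
  exact ⟨hvalue, hvalue ▸ le_antisymm (hlower U) hupper⟩
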